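/- \textbf{Setting.} An episodic two-player zero-sum kernel mixture Markov game has a countable state space $\mathcal S$, a finite action set $\mathcal A$ for each player, a horizon $H\ge 1$, known rewards $r_h:\mathcal Z\to[-1,1]$ and transition laws $\mathbb P_h(\cdot\mid z)$, where $h\in[H]$ and $z=(x,a,b)\in\mathcal Z=\mathcal S\times\mathcal A\times\mathcal A$. There are a real Hilbert space $\mathcal H$, features $\phi(s'\mid z)\in\mathcal H$ and parameters $\theta_h^*\in\mathcal H$ with $\mathbb P_h(s'\mid z)=\langle\phi(s'\mid z),\theta^*_h\rangle$ and $\|\theta_h^*\|\le B$ for all $h\in[H]$. Put $\phi_V(z)=\sum_{s'}V(s')\phi(s'\mid z)$; it is assumed that this sum converges and $\|\phi_V(z)\|\le 1$ for every $V:\mathcal S\to[-1,1]$ and $z\in\mathcal Z$. For $\lambda>0$ let $$\Gamma_K(T,\lambda)=\sup\ \tfrac12\log\det\Big(I+\tfrac1\lambda\big(\langle\phi_{V_p}(z_p),\phi_{V_q}(z_q)\rangle\big)_{p,q\le T}\Big),$$ the supremum being over $V_1,\dots,V_T:\mathcal S\to[-H,H]$ and $z_1,\dots,z_T\in\mathcal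 Z$. For Markov policies $\pi$ of the max-player and $\nu$ of the min-player, $V_h^{\pi,\nu}(x)$ is the expected total reward over steps $h,\dots,H$ from $x_h=x$; $V_h^{*,\nu}=\sup_\pi V_h^{\pi,\nu}$ and $V_h^{\pi,*}=\inf_\nu V_h^{\pi,\nu}$. \textbf{Parameters.} Fix $T\ge1$, $\delta\in(0,1)$, and put $d_{\rm eff}=\Gamma_K(T,1/B^2)$, $\lambda_1=d_{\rm eff}/(B^2H^2)$, $\lambda_2=H^2/B^2$, $\alpha=H/\sqrt{d_{\rm eff}}$, $L_t=\log(4t^2H/\delta)$ and $$\beta_t=16\sqrt{\Gamma_K(T,\lambda_1\alpha^2)}\sqrt{L_t}+\tfrac{8H}{\alpha}L_t+\sqrt{\lambda_1}B,\qquad \beta^{(1)}_t=\tfrac{16H}{\alpha}\sqrt{\Gamma_K(T,\lambda_1\alpha^2)}\sqrt{L_t}+\tfrac{8H}{\alpha}L_t+\sqrt{\lambda_1}B,$$ $$\beta^{(2)}_t=16H^2\sqrt{\Gamma_K(T,\lambda_2/H^2)}\sqrt{L_t}+8H^2L_t+\sqrt{\lambda_2}B.$$ \textbf{Algorithm (KernelCCE-VTR+).}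 In episode $t=1,\dots,T$ set $\overline V^t_{H+1}=\underline V^t_{H+1}=0$. For $h=H,\dots,1$ let $\overline\theta^t_{h,1}$ and $\overline\theta^t_{h,2}$ be the minimizers over $\theta\in\mathcal H$ of $$\sum_{\tau<t}\frac{\big(\overline V^\tau_{h+1}(x^\tau_{h+1})-\langle\phi_{\overline V^\tau_{h+1}}(z^\tau_h),\theta\rangle\big)^2}{(\overline R^\tau_h)^2}+\lambda_1\|\theta\|^2,\qquad \sum_{\tau<t}\Big(\overline V^\tau_{h+1}(x^\tau_{h+1})^2-\langle\phi_{(\overline V^\tau_{h+1})^2}(z^\tau_h),\theta\rangle\Big)^2+\lambda_2\|\theta\|^2 .$$ With inputs $\psi_\tau$ ($\tau<t$) of the $i$-th regression (for $i=1$: $\phi_{\overline V^\tau_{h+1}}(z^\tau_h)/\overline R^\tau_h$; for $i=2$: $\phi_{(\overline V^\tau_{h+1})^2}(z^\tau_h)$), Gram matrix $K_i$, $f_1=\phi_{\overline V^t_{h+1}}(z)$, $f_2=\phi_{(\overline V^t_{h+1})^2}(z)$ and $k_i=(\langle\psi_\tau,f_i\rangle)_{\tau<t}$, put $\overline w^t_{h,i}(z)=\lambda_i^{-1/2}\big(\|f_i\|^2-k_i^\top(K_i+\lambda_iI)^{-1}k_i\big)^{1/2}$.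 Let $$\overline Q^t_h(z)=\Pi_{[-H,H]}\big[r_h(z)+\langle\phi_{\overline V^t_{h+1}}(z),\overline\theta^t_{h,1}\rangle+\beta_t\overline w^t_{h,1}(z)\big],$$ define $\underline Q^t_h$ in the same way from the underlined quantities, with $-\beta_t\underline w^t_{h,1}$ in place of the bonus, let $\sigma^t_h(x)$ be any coarse correlated equilibrium, as returned by a fixed subroutine $\mathtt{FIND\_CCE}(\overline Q^t_h,\underline Q^t_h,x)$, that is, a law $\sigma$ on $\mathcal A\times\mathcal A$ with $\mathbb E_{(a,b)\sim\sigma}\overline Q^t_h(x,a,b)\ge\mathbb E_{(a,b)\sim\sigma}\overline Q^t_h(x,a',b)$ for all $a'\in\mathcal A$ and $\mathbb E_{(a,b)\sim\sigma}\underline Q^t_h(x,a,b)\le\mathbb E_{(a,b)\sim\sigma}\underline Q^t_h(x,a,b')$ for all $b'\in\mathcal A$, and let $\overline V^t_h(x)$, $\underline V^t_h(x)$ be the expectations of $\overline Q^t_h(x,\cdot)$, $\underline Q^t_h(x,\cdot)$ under $\sigma^t_h(x)$. Then an initial state $x^t_1$ is received (arbitrary, possibly depending on the past), and for $h=1,\dots,H$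 the actions $(a^t_h,b^t_h)\sim\sigma^t_h(x^t_h)$ are played, $z_h^t=(x_h^t,a_h^t,b_h^t)$, and $x^t_{h+1}\sim\mathbb P_h(\cdot\mid z^t_h)$ is observed. The normalizations are $$(\overline R^t_h)^2=\max\Big\{\Pi_{[0,H^2]}\langle\phi_{(\overline V^t_{h+1})^2}(z^t_h),\overline\theta^t_{h,2}\rangle-\big(\Pi_{[-H,H]}\langle\phi_{\overline V^t_{h+1}}(z^t_h),\overline\theta^t_{h,1}\rangle\big)^2+\overline E^t_h,\ \alpha^2\Big\},$$ $$\overline E^t_h=\min\{H^2,\beta^{(2)}_t\overline w^t_{h,2}(z^t_h)\}+\min\{H^2,2H\beta^{(1)}_t\overline w^t_{h,1}(z^t_h)\},$$ and $\underline R^t_h$ is defined likewise from the underlined quantities. Let $\pi^t_h(x)$ and $\nu^t_h(x)$ be the first and second marginals of $\sigma^t_h(x)$ and $$\mathrm{Regret}(T)=\sum_{t=1}^T\big(V_1^{*,\nu^t}(x^t_1)-V_1^{\pi^t,*}(x^t_1)\big).$$ \textbf{Theorem.} There are universal constants $C>0$ and $k\in\mathbb N$ such that in this setting, for all games, $\mathtt{FIND\_CCE}$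 subroutines, $H,T\ge1$, $B$ and $\delta\in(0,1)$, with probability at least $1-\delta$, writing $L=\log(4T^2H/\delta)$, $$\mathrm{Regret}(T)\le C\,L^k\Big(d_{\rm eff}^2H^3+\sqrt{d_{\rm eff}H^4+d_{\rm eff}^2H^3}\,\sqrt T+\big(d_{\rm eff}^7H^8+d_{\rm eff}^4H^9\big)^{1/4}T^{1/4}\Big),$$ and, on the same event, if $d_{\rm eff}\ge H$ and $T$ is large enough that $T\ge d_{\rm eff}^3H^2+d_{\rm eff}^2H^3$, then $\mathrm{Regret}(T)\le C\,L^k\,d_{\rm eff}H^{3/2}\sqrt T$. -/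

import Mathlib

open MeasureTheory
open scoped InnerProductSpace

noncomputable section

namespace KernelMG

/-! ### Discrete expectations, clipping -/

/-- Expectation of a real function under a discrete law. -/
def expect {α : Type*} (p : PMF α) (f : α → ℝ) : ℝ := ∑' a, (p a).toReal * f a

/-- Projection of `x` onto the interval `[lo, hi]`. -/
def clip (lo hi x : ℝ) : ℝ := max lo (min hi x)

/-! ### Kernel mixture Markov games

Steps are numbered `1, …, H` and episodes `1, …, T`, as natural numbers; what happens at other
indices plays no role. A state-action triplet is `z = (x, a, b) : S × A × A`, the first action being
that of the maximizing player. -/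

section Game

variable {S A F : Type*} [NormedAddCommGroup F] [InnerProductSpace ℝ F]

/-- An episodic two-player zero-sum kernel mixture Markov game with horizon `H`: known rewards in
`[-1, 1]`, transition laws on the (countable) state space `S`, feature vectors `φ(s' | z)` in the
Hilbert space `F`, and parameters `θ_h` with `P_h(s' | z) = ⟪φ(s' | z), θ_h⟫`. -/
structure Game (S A F : Type*) [NormedAddCommGroup F] [InnerProductSpace ℝ F] (H : ℕ) where
  reward : ℕ → S × A × A → ℝ
  trans : ℕ → S × A × A → PMF S
  phi : S → S × A × A → F
  theta : ℕ → F
  reward_mem : ∀ h ∈ Finset.Icc 1 H, ∀ z, reward h z ∈ Set.Icc (-1 : ℝ) 1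
  trans_eq : ∀ h ∈ Finset.Icc 1 H, ∀ z s, (trans h z s).toReal = ⟪phi s z, theta h⟫_ℝ
  /-- `φ_V(z) = ∑_s V(s) φ(s | z)` exists and has norm at most `1` for every `V : S → [-1, 1]`
  (the summability is automatic for finite `S`). -/
  phi_bound : ∀ V : S → ℝ, (∀ s, V s ∈ Set.Icc (-1 : ℝ) 1) → ∀ z,
    Summable (fun s => V s • phi s z) ∧ ‖∑' s, V s • phi s z‖ ≤ 1

variable {H : ℕ} (G : Game S A F H)

/-- `φ_V(z) = ∑_s V(s) φ(s | z)`. -/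
def Game.feat (V : S → ℝ) (z : S × A × A) : F := ∑' s, V s • G.phi s z

/-- The weighted kernel `k_{V₁,V₂}(z₁, z₂) = ⟪φ_{V₁}(z₁), φ_{V₂}(z₂)⟫`. -/
def Game.kernel (V₁ V₂ : S → ℝ) (z₁ z₂ : S × A × A) : ℝ := ⟪G.feat V₁ z₁, G.feat V₂ z₂⟫_ℝ

/-- For finite `S` the weighted kernel is the double sum of the inner products of the features. -/
theorem Game.kernel_eq_sum [Fintype S] (V₁ V₂ : S → ℝ) (z₁ z₂ : S × A × A) :
    G.kernel V₁ V₂ z₁ z₂ = ∑ s₁, ∑ s₂, V₁ s₁ * V₂ s₂ * ⟪G.phi s₁ z₁, G.phi s₂ z₂⟫_ℝ := by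
  simp only [Game.kernel, Game.feat, tsum_fintype, sum_inner, inner_sum, real_inner_smul_left,
    real_inner_smul_right]
  rw [Finset.sum_comm]
  exact Finset.sum_congr rfl fun s₁ _ => Finset.sum_congr rfl fun s₂ _ => by ring

/-- The effective dimension `Γ_K(T, lam)`: the supremum of `(1/2) log det (I + K / lam)` over
`V_1, …, V_T : S → [-H, H]` and `z_1, …, z_T`, with `K_{pq} = k_{V_p, V_q}(z_p, z_q)`. -/
def Game.effDim (T : ℕ) (lam : ℝ) : ℝ :=
  ⨆ p : (Fin T → S → Set.Icc (-(H : ℝ)) H) × (Fin T → S × A × A),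
    1 / 2 * Real.log (1 + lam⁻¹ • Matrix.of fun i j =>
      G.kernel (fun s => p.1 i s) (fun s => p.1 j s) (p.2 i) (p.2 j)).det

/-! ### Policies, values, duality gap -/

/-- A Markov policy of one player: a law on actions for every step and state. -/
abbrev Policy (S A : Type*) := ℕ → S → PMF A

/-- Law of the next `n` triplets `(x_h, a_h, b_h), (x_{h+1}, a_{h+1}, b_{h+1}), …` when step `h`
starts in state `x` and the players use `π` and `ν` independently of each other. -/
def Game.trajLaw (π ν : Policy S A) : ℕ → ℕ → S → PMF (List (S × A × A))
  | 0, _, _ => PMF.pure []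
  | n + 1, h, x => (π h x).bind fun a => (ν h x).bind fun b => (G.trans h (x, a, b)).bind fun y =>
      (Game.trajLaw π ν n (h + 1) y).map fun τ => (x, a, b) :: τ

/-- Total reward of a list of triplets, the first of which belongs to step `h`. -/
def Game.totalReward : ℕ → List (S × A × A) → ℝ
  | _, [] => 0
  | h, z :: τ => G.reward h z + Game.totalReward (h + 1) τ

/-- `V_h^{π,ν}(x)`: expected total reward over the steps `h, …, H` from `x_h = x`. -/
def Game.value (π ν : Policy S A) (h : ℕ) (x : S) : ℝ :=
  expect (G.trajLaw π ν (H + 1 - h) h x) (G.totalReward h)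

/-- `V_h^{*,ν}(x)`: value of the best response of the maximizing player to `ν`. -/
def Game.maxValue (ν : Policy S A) (h : ℕ) (x : S) : ℝ := ⨆ π : Policy S A, G.value π ν h x

/-- `V_h^{π,*}(x)`: value of the best response of the minimizing player to `π`. -/
def Game.minValue (π : Policy S A) (h : ℕ) (x : S) : ℝ := ⨅ ν : Policy S A, G.value π ν h x

end Game

/-! ### Coarse correlated equilibria -/

section CCE

variable {S A : Type*}

/-- `σ` is a coarse correlated equilibrium at the state `x` for the payoffs `Q₁` (to be maximized by
the first player) and `Q₂` (to be minimized by the second one). -/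
def IsCCE (Q₁ Q₂ : S × A × A → ℝ) (x : S) (σ : PMF (A × A)) : Prop :=
  (∀ a', expect (σ.map Prod.snd) (fun b => Q₁ (x, a', b)) ≤ expect σ (fun c => Q₁ (x, c))) ∧
  (∀ b', expect σ (fun c => Q₂ (x, c)) ≤ expect (σ.map Prod.fst) (fun a => Q₂ (x, a, b')))

/-- An implementation of the subroutine `FIND_CCE`: any map that returns, for all payoffs and every
state, a coarse correlated equilibrium. Such maps exist, see the instance below. -/
structure CCEFinder (S A : Type*) where
  find : (S × A × A → ℝ) → (S × A × A → ℝ) → S → PMF (A × A)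
  isCCE : ∀ Q₁ Q₂ x, IsCCE Q₁ Q₂ x (find Q₁ Q₂ x)

/-- Change of variables for expectations under discrete laws on finite types. -/
theorem expect_map {α β : Type*} [Finite α] [Finite β] (p : PMF α) (g : α → β) (f : β → ℝ) :
    expect (p.map g) f = expect p fun a => f (g a) := by
  classical
  have := Fintype.ofFinite α
  have := Fintype.ofFinite β
  simp only [expect, tsum_fintype, PMF.map_apply]
  have h : ∀ b, (∑ a, if b = g a then p a else 0).toReal = ∑ a, if b = g a then (p a).toReal else 0 := by
    intro b
    rw [ENNReal.toReal_sum]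
    · exact Finset.sum_congr rfl fun a _ => by split_ifs <;> simp
    · intro a _
      split_ifs
      · exact p.apply_ne_top a
      · simp
  simp only [h, Finset.sum_mul, ite_mul, zero_mul]
  rw [Finset.sum_comm]
  simp

/-- Nonnegative weights are a multiple of a probability vector. -/
theorem exists_weights [Fintype A] [Nonempty A] (y : A → ℝ) (hy : ∀ a, 0 ≤ y a) :
    ∃ p : A → ℝ, (∀ a, 0 ≤ p a) ∧ ∑ a, p a = 1 ∧ ∀ a, y a = (∑ a, y a) * p a := by
  classical
  by_cases h : ∑ a, y a = 0
  · have h0 : ∀ a, y a = 0 := fun a =>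
      (Finset.sum_eq_zero_iff_of_nonneg fun a _ => hy a).1 h a (Finset.mem_univ a)
    refine ⟨Pi.single (Classical.arbitrary A) 1, fun a => ?_, by simp, fun a => by simp [h0]⟩
    by_cases ha : a = Classical.arbitrary A
    · subst ha; simp
    · simp [ha]
  · refine ⟨fun a => y a / ∑ a, y a, fun a => div_nonneg (hy a) (Finset.sum_nonneg fun a _ => hy a),
      ?_, fun a => by field_simp⟩
    rw [← Finset.sum_div, div_self h]

/-- Coarse correlated equilibria exist. -/
theorem exists_isCCE [Finite A] [Nonempty A] (Q₁ Q₂ : S × A × A → ℝ) (x : S) :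
    ∃ σ, IsCCE Q₁ Q₂ x σ := by
  classical
  have := Fintype.ofFinite A
  let g : (A × A → ℝ) →ₗ[ℝ] (A ⊕ A → ℝ) :=
    { toFun := fun w => Sum.elim (fun a' => ∑ c, w c * (Q₁ (x, a', c.2) - Q₁ (x, c)))
        (fun b' => ∑ c, w c * (Q₂ (x, c) - Q₂ (x, c.1, b')))
      map_add' := by
        intro v w; ext (i | i) <;> simp [add_mul, Finset.sum_add_distrib]
      map_smul' := by
        intro r w; ext (i | i) <;> simp [Finset.mul_sum, mul_assoc] }
  have hg : Continuous g := g.continuous_of_finiteDimensional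
  suffices h : ∃ w ∈ stdSimplex ℝ (A × A), g w ∈ Set.Iic (0 : A ⊕ A → ℝ) by
    obtain ⟨w, ⟨hw0, hw1⟩, hw⟩ := h
    let σ : PMF (A × A) := PMF.ofFintype (fun c => ENNReal.ofReal (w c)) (by
      rw [← ENNReal.ofReal_sum_of_nonneg fun c _ => hw0 c, hw1, ENNReal.ofReal_one])
    have hσ : ∀ f : A × A → ℝ, expect σ f = ∑ c, w c * f c := by
      intro f
      simp [expect, tsum_fintype, σ, ENNReal.toReal_ofReal (hw0 _)]
    refine ⟨σ, fun a' => ?_, fun b' => ?_⟩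
    · have := hw (Sum.inl a')
      simp only [g, LinearMap.coe_mk, AddHom.coe_mk, Sum.elim_inl, mul_sub,
        Finset.sum_sub_distrib, Pi.zero_apply] at this
      rw [expect_map, hσ, hσ]
      linarith
    · have := hw (Sum.inr b')
      simp only [g, LinearMap.coe_mk, AddHom.coe_mk, Sum.elim_inr, mul_sub,
        Finset.sum_sub_distrib, Pi.zero_apply] at this
      rw [expect_map, hσ, hσ]
      linarith
  by_contra! hno
  obtain ⟨f, u, v, h1, h2, h3⟩ := geometric_hahn_banach_compact_closed
    ((convex_stdSimplex ℝ (A × A)).linear_image g) ((isCompact_stdSimplex ℝ (A × A)).image hg)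
    (convex_Iic (0 : A ⊕ A → ℝ)) isClosed_Iic (by
      rw [Set.disjoint_left]
      rintro _ ⟨w, hw, rfl⟩
      exact hno w hw)
  have hv : v < 0 := by simpa using h3 0 (by simp)
  have hf : ∀ i, f (Pi.single i 1) ≤ 0 := by
    intro i
    by_contra! hi
    have := h3 ((v / f (Pi.single i 1)) • Pi.single i 1) (by
      intro j
      have : v / f (Pi.single i 1) ≤ 0 := (div_neg_of_neg_of_pos hv hi).le
      by_cases hj : j = i
      · subst hj; simpa using this
      · simp [hj])
    rw [map_smul, smul_eq_mul, div_mul_cancel₀ _ hi.ne'] at this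
    exact lt_irrefl _ this
  have hfsum : ∀ w, f w = ∑ i, w i * f (Pi.single i 1) := by
    intro w
    conv_lhs => rw [pi_eq_sum_univ' w]
    simp [map_sum]
  obtain ⟨p, hp0, hp1, hp⟩ := exists_weights (fun a : A => - f (Pi.single (Sum.inl a) 1))
    fun a => by linarith [hf (Sum.inl a)]
  obtain ⟨q, hq0, hq1, hq⟩ := exists_weights (fun a : A => - f (Pi.single (Sum.inr a) 1))
    fun a => by linarith [hf (Sum.inr a)]
  generalize (∑ a : A, - f (Pi.single (Sum.inl a) 1)) = P at hp
  generalize (∑ a : A, - f (Pi.single (Sum.inr a) 1)) = R at hq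
  have key := h1 _ ⟨fun c => p c.1 * q c.2, ⟨fun c => mul_nonneg (hp0 _) (hq0 _), by
    rw [Fintype.sum_prod_type]
    simp [← Finset.mul_sum, hq1, hp1]⟩, rfl⟩
  rw [hfsum, Fintype.sum_sum_type] at key
  have e1 : ∀ a, f (Pi.single (Sum.inl a) 1) = - (P * p a) := fun a => by linarith [hp a]
  have e2 : ∀ a, f (Pi.single (Sum.inr a) 1) = - (R * q a) := fun a => by linarith [hq a]
  simp only [e1, e2, g, LinearMap.coe_mk, AddHom.coe_mk, Sum.elim_inl, Sum.elim_inr,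
    Fintype.sum_prod_type, mul_sub, Finset.sum_sub_distrib] at key
  have z1 : ∑ a', (∑ a, ∑ b, p a * q b * Q₁ (x, a', b) - ∑ a, ∑ b, p a * q b * Q₁ (x, a, b))
      * -(P * p a') = 0 := by
    have i1 : ∀ a', ∑ a, ∑ b, p a * q b * Q₁ (x, a', b) = ∑ b, q b * Q₁ (x, a', b) := by
      intro a'
      simp only [mul_assoc, ← Finset.mul_sum, ← Finset.sum_mul, hp1, one_mul]
    have i2 : ∑ a, ∑ b, p a * q b * Q₁ (x, a, b) = ∑ a, p a * ∑ b, q b * Q₁ (x, a, b) := by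
      simp only [mul_assoc, ← Finset.mul_sum]
    simp only [i1, i2]
    have : ∀ a', (∑ b, q b * Q₁ (x, a', b) - ∑ a, p a * ∑ b, q b * Q₁ (x, a, b)) * -(P * p a')
      = - P * (p a' * ∑ b, q b * Q₁ (x, a', b)) +
        P * (∑ a, p a * ∑ b, q b * Q₁ (x, a, b)) * p a' := fun a' => by ring
    simp only [this, Finset.sum_add_distrib, ← Finset.mul_sum, hp1]
    ring
  have z2 : ∑ b', (∑ a, ∑ b, p a * q b * Q₂ (x, a, b) - ∑ a, ∑ b, p a * q b * Q₂ (x, a, b'))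
      * -(R * q b') = 0 := by
    have i1 : ∀ b', ∑ a, ∑ b, p a * q b * Q₂ (x, a, b') = ∑ a, p a * Q₂ (x, a, b') := by
      intro b'
      simp only [mul_assoc, ← Finset.mul_sum, ← Finset.sum_mul, hq1, one_mul]
    have i2 : ∑ a, ∑ b, p a * q b * Q₂ (x, a, b) = ∑ b, q b * ∑ a, p a * Q₂ (x, a, b) := by
      rw [Finset.sum_comm]
      simp only [mul_comm (p _) (q _), mul_assoc, ← Finset.mul_sum]
    simp only [i1, i2]
    have : ∀ b', (∑ b, q b * ∑ a, p a * Q₂ (x, a, b) - ∑ a, p a * Q₂ (x, a, b')) * -(R * q b')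
      = R * (q b' * ∑ a, p a * Q₂ (x, a, b')) -
        R * (∑ b, q b * ∑ a, p a * Q₂ (x, a, b)) * q b' := fun b' => by ring
    simp only [this, Finset.sum_sub_distrib, ← Finset.mul_sum, hq1]
    ring
  linarith

instance [Finite A] [Nonempty A] : Nonempty (CCEFinder S A) :=
  ⟨⟨fun Q₁ Q₂ x => (exists_isCCE Q₁ Q₂ x).choose, fun Q₁ Q₂ x => (exists_isCCE Q₁ Q₂ x).choose_spec⟩⟩

end CCE

/-! ### Kernel ridge regression -/

section Ridge

variable {F : Type*} [NormedAddCommGroup F] [InnerProductSpace ℝ F] {n : ℕ}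

/-- `(K + lam I)⁻¹` for the Gram matrix `K` of the inputs `ψ`. -/
def ridgeInv (lam : ℝ) (ψ : Fin n → F) : Matrix (Fin n) (Fin n) ℝ :=
  (Matrix.gram ℝ ψ + lam • 1)⁻¹

/-- The ridge estimate `Ψᵀ (K + lam I)⁻¹ y` for inputs `ψ` and outputs `y`. -/
def ridge (lam : ℝ) (ψ : Fin n → F) (y : Fin n → ℝ) : F :=
  ∑ i, (ridgeInv lam ψ).mulVec y i • ψ i

/-- The ridge estimate minimizes the regularized least squares objective. -/
theorem ridge_isMin {lam : ℝ} (hlam : 0 < lam) (ψ : Fin n → F) (y : Fin n → ℝ) (θ : F) :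
    ∑ i, (y i - ⟪ψ i, ridge lam ψ y⟫_ℝ) ^ 2 + lam * ‖ridge lam ψ y‖ ^ 2
      ≤ ∑ i, (y i - ⟪ψ i, θ⟫_ℝ) ^ 2 + lam * ‖θ‖ ^ 2 := by
  set c := (ridgeInv lam ψ).mulVec y with hc
  have hpd : (Matrix.gram ℝ ψ + lam • (1 : Matrix (Fin n) (Fin n) ℝ)).PosDef :=
    (Matrix.PosDef.one.smul hlam).posSemidef_add (Matrix.posSemidef_gram ℝ ψ)
  have hy : (Matrix.gram ℝ ψ + lam • (1 : Matrix (Fin n) (Fin n) ℝ)).mulVec c = y := by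
    rw [hc, ridgeInv, Matrix.mulVec_mulVec, Matrix.mul_nonsing_inv _ hpd.det_pos.ne'.isUnit,
      Matrix.one_mulVec]
  have hr : ∀ i, y i - ⟪ψ i, ridge lam ψ y⟫_ℝ = lam * c i := by
    intro i
    have := congrFun hy i
    rw [Matrix.add_mulVec, Matrix.smul_mulVec, Matrix.one_mulVec, Pi.add_apply, Pi.smul_apply,
      smul_eq_mul] at this
    rw [← this]
    simp only [ridge, inner_sum, real_inner_smul_right, ← hc]
    simp [Matrix.mulVec, dotProduct, mul_comm]
  obtain ⟨u, rfl⟩ : ∃ u, θ = ridge lam ψ y + u := ⟨θ - ridge lam ψ y, by abel⟩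
  have hcross : ⟪ridge lam ψ y, u⟫_ℝ = ∑ i, c i * ⟪ψ i, u⟫_ℝ := by
    simp only [ridge, sum_inner, real_inner_smul_left, ← hc]
  have h1 : ∀ i, (y i - ⟪ψ i, ridge lam ψ y + u⟫_ℝ) ^ 2
      = (y i - ⟪ψ i, ridge lam ψ y⟫_ℝ) ^ 2 - 2 * lam * (c i * ⟪ψ i, u⟫_ℝ) + ⟪ψ i, u⟫_ℝ ^ 2 := by
    intro i
    rw [inner_add_right, ← sub_sub, sub_sq, hr i]
    ring
  simp only [h1, Finset.sum_add_distrib, Finset.sum_sub_distrib, ← Finset.mul_sum, ← hcross]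
  rw [norm_add_sq_real]
  have : 0 ≤ ∑ i, ⟪ψ i, u⟫_ℝ ^ 2 := Finset.sum_nonneg fun i _ => sq_nonneg _
  have : 0 ≤ lam * ‖u‖ ^ 2 := by positivity
  linarith

/-- The width `lam^{-1/2} (⟪f, f⟫ - kᵀ (K + lam I)⁻¹ k)^{1/2}`, where `k_i = ⟪ψ_i, f⟫`. -/
def width (lam : ℝ) (ψ : Fin n → F) (f : F) : ℝ :=
  (√lam)⁻¹ * √(⟪f, f⟫_ℝ -
    (fun i => ⟪ψ i, f⟫_ℝ) ⬝ᵥ (ridgeInv lam ψ).mulVec (fun i => ⟪ψ i, f⟫_ℝ))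

end Ridge

/-! ### The algorithm -/

section Algorithm

variable {S A F : Type*} [NormedAddCommGroup F] [InnerProductSpace ℝ F] {H : ℕ}

/-- Parameters of the algorithm. -/
structure Params where
  lam₁ : ℝ
  lam₂ : ℝ
  alpha : ℝ
  beta : ℕ → ℝ
  beta₁ : ℕ → ℝ
  beta₂ : ℕ → ℝ

/-- Everything that is observed: `x t h` is the state and `act t h` the pair of actions at step `h`
of episode `t`. -/
structure Obs (S A : Type*) where
  x : ℕ → ℕ → S
  act : ℕ → ℕ → A × A

/-- The triplet `z_h^t`. -/
def Obs.z (D : Obs S A) (t h : ℕ) : S × A × A := (D.x t h, D.act t h)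

/-- What one side (optimistic or pessimistic) keeps of an episode: the value estimates `V_h^t` and
the normalizations `R_h^t`. -/
structure Side (S : Type*) where
  V : ℕ → S → ℝ
  R : ℕ → ℝ

variable (G : Game S A F H) (P : Params) (fc : CCEFinder S A) (D : Obs S A)

section OneSide

/- `past i` is the record of episode `i + 1`, for `i < n`; at episode `t` we have `n = t - 1`. -/
variable {n : ℕ} (past : Fin n → Side S)

/-- Inputs of the weighted regression: `φ_{V_{h+1}^τ}(z_h^τ) / R_h^τ`. -/
def psi₁ (h : ℕ) (i : Fin n) : F :=
  ((past i).R h)⁻¹ • G.feat ((past i).V (h + 1)) (D.z (i + 1) h)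

/-- Outputs of the weighted regression: `V_{h+1}^τ(x_{h+1}^τ) / R_h^τ`. -/
def out₁ (h : ℕ) (i : Fin n) : ℝ := (past i).V (h + 1) (D.x (i + 1) (h + 1)) / (past i).R h

/-- Inputs of the regression for the second moment: `φ_{(V_{h+1}^τ)²}(z_h^τ)`. -/
def psi₂ (h : ℕ) (i : Fin n) : F :=
  G.feat (fun s => (past i).V (h + 1) s ^ 2) (D.z (i + 1) h)

/-- Outputs of the regression for the second moment: `(V_{h+1}^τ(x_{h+1}^τ))²`. -/
def out₂ (h : ℕ) (i : Fin n) : ℝ := (past i).V (h + 1) (D.x (i + 1) (h + 1)) ^ 2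

/-- `θ_{h,1}^t`. -/
def theta₁ (h : ℕ) : F := ridge P.lam₁ (psi₁ G D past h) (out₁ D past h)

/-- `θ_{h,2}^t`. -/
def theta₂ (h : ℕ) : F := ridge P.lam₂ (psi₂ G D past h) (out₂ D past h)

/-- The action value estimate of episode `t` at step `h`, given `V = V_{h+1}^t`; the bonus is added
on the optimistic side (`sgn = 1`) and subtracted on the pessimistic side (`sgn = -1`). -/
def qEst (sgn : ℝ) (t h : ℕ) (V : S → ℝ) (z : S × A × A) : ℝ :=
  clip (-H) H (G.reward h z + ⟪G.feat V z, theta₁ G P D past h⟫_ℝ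
    + sgn * (P.beta t * width P.lam₁ (psi₁ G D past h) (G.feat V z)))

/-- Estimate of the variance of `V = V_{h+1}^t` under `P_h(· | z)`. -/
def varEst (h : ℕ) (V : S → ℝ) (z : S × A × A) : ℝ :=
  clip 0 ((H : ℝ) ^ 2) ⟪G.feat (fun s => V s ^ 2) z, theta₂ G P D past h⟫_ℝ
    - clip (-H) H ⟪G.feat V z, theta₁ G P D past h⟫_ℝ ^ 2

/-- The error margin `E_h^t` of the variance estimate. -/
def errEst (t h : ℕ) (V : S → ℝ) (z : S × A × A) : ℝ :=
  min ((H : ℝ) ^ 2)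
      (P.beta₂ t * width P.lam₂ (psi₂ G D past h) (G.feat (fun s => V s ^ 2) z))
    + min ((H : ℝ) ^ 2)
      (2 * H * P.beta₁ t * width P.lam₁ (psi₁ G D past h) (G.feat V z))

/-- The normalization `R_h^t`, with `(R_h^t)² = max (varEst + E_h^t) α²`. -/
def rEst (t h : ℕ) (V : S → ℝ) (z : S × A × A) : ℝ :=
  √(max (varEst G P D past h V z + errEst G P D past t h V z) (P.alpha ^ 2))

end OneSide

section Planning

variable {n : ℕ} (past : Fin n → Side S × Side S)

/-- Backward induction of episode `t`: the optimistic and pessimistic value estimates with `m` steps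
to go, that is, at step `H + 1 - m`. -/
def plan (t : ℕ) : ℕ → (S → ℝ) × (S → ℝ)
  | 0 => (0, 0)
  | m + 1 =>
      let W := plan t m
      let up := qEst G P D (fun i => (past i).1) 1 t (H - m) W.1
      let low := qEst G P D (fun i => (past i).2) (-1) t (H - m) W.2
      (fun x => expect (fc.find up low x) fun c => up (x, c),
       fun x => expect (fc.find up low x) fun c => low (x, c))

/-- The joint action law `σ_h^t(x)`. -/
def jointLaw (t h : ℕ) (x : S) : PMF (A × A) :=
  fc.find (qEst G P D (fun i => (past i).1) 1 t h (plan G P fc D past t (H - h)).1)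
    (qEst G P D (fun i => (past i).2) (-1) t h (plan G P fc D past t (H - h)).2) x

end Planning

/-- The records (optimistic, pessimistic) of episode `t`; the value estimates use only the data of
the earlier episodes, and `R_h^t` uses in addition `z_h^t`. -/
def record (t : ℕ) : Side S × Side S :=
  let past : Fin (t - 1) → Side S × Side S := fun i => record (i.val + 1)
  let W : ℕ → (S → ℝ) × (S → ℝ) := fun h => plan G P fc D past t (H + 1 - h)
  (⟨fun h => (W h).1, fun h => rEst G P D (fun i => (past i).1) t h (W (h + 1)).1 (D.z t h)⟩,
   ⟨fun h => (W h).2, fun h => rEst G P D (fun i => (past i).2) t h (W (h + 1)).2 (D.z t h)⟩)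
termination_by t
decreasing_by have := i.isLt; omega

/-- The joint policy `σ^t` that `KernelCCE-VTR+` plays in episode `t`. -/
def joint (t h : ℕ) (x : S) : PMF (A × A) :=
  jointLaw G P fc D (fun i : Fin (t - 1) => record G P fc D (i.val + 1)) t h x

/-- `π^t`: the marginal of `σ^t` for the maximizing player. -/
def maxPolicy (t : ℕ) : Policy S A := fun h x => (joint G P fc D t h x).map Prod.fst

/-- `ν^t`: the marginal of `σ^t` for the minimizing player. -/
def minPolicy (t : ℕ) : Policy S A := fun h x => (joint G P fc D t h x).map Prod.snd

/-- `Regret(T) = ∑_{t ≤ T} (V_1^{*,ν^t}(x_1^t) - V_1^{π^t,*}(x_1^t))`. -/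
def regret (T : ℕ) : ℝ :=
  ∑ t ∈ Finset.Icc 1 T, (G.maxValue (minPolicy G P fc D t) 1 (D.x t 1)
    - G.minValue (maxPolicy G P fc D t) 1 (D.x t 1))

/-- The choice of the parameters: with `d = Γ_K(T, 1/B²)`,
`λ₁ = d/(B²H²)`, `λ₂ = H²/B²`, `α = H/√d`, and the Bernstein-type radii. -/
def tuned (B : ℝ) (T : ℕ) (δ : ℝ) : Params :=
  let d := G.effDim T (1 / B ^ 2)
  let lam₁ := d / (B ^ 2 * (H : ℝ) ^ 2)
  let lam₂ := (H : ℝ) ^ 2 / B ^ 2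
  let α := (H : ℝ) / √d
  let L : ℕ → ℝ := fun t => Real.log (4 * (t : ℝ) ^ 2 * H / δ)
  { lam₁ := lam₁
    lam₂ := lam₂
    alpha := α
    beta := fun t => 16 * √(G.effDim T (lam₁ * α ^ 2)) * √(L t) + 8 * H / α * L t + √lam₁ * B
    beta₁ := fun t => 16 * H / α * √(G.effDim T (lam₁ * α ^ 2)) * √(L t) + 8 * H / α * L t
      + √lam₁ * B
    beta₂ := fun t => 16 * (H : ℝ) ^ 2 * √(G.effDim T (lam₂ / (H : ℝ) ^ 2)) * √(L t)
      + 8 * (H : ℝ) ^ 2 * L t + √lam₂ * B }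

end Algorithm

/-! ### The interaction as a random process -/

section Interaction

variable {S A F Ω : Type*} [NormedAddCommGroup F] [InnerProductSpace ℝ F] {H : ℕ}
  [MeasurableSpace S] [MeasurableSpace A]

/-- The `σ`-algebra generated by what is observed before the actions of step `h` of episode `t` are
drawn: all earlier episodes, the states up to step `h`, and the actions before step `h`. -/
abbrev stateHist (H : ℕ) (X : ℕ → ℕ → Ω → S) (Y : ℕ → ℕ → Ω → A × A) (t h : ℕ) :
    MeasurableSpace Ω :=
  (⨆ (τ : ℕ) (k : ℕ) (_ : 1 ≤ τ ∧ 1 ≤ k ∧ ((τ < t ∧ k ≤ H + 1) ∨ (τ = t ∧ k ≤ h))),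
    MeasurableSpace.comap (X τ k) inferInstance) ⊔
  (⨆ (τ : ℕ) (k : ℕ) (_ : 1 ≤ τ ∧ 1 ≤ k ∧ ((τ < t ∧ k ≤ H) ∨ (τ = t ∧ k < h))),
    MeasurableSpace.comap (Y τ k) inferInstance)

/-- As `stateHist`, together with the actions of step `h` of episode `t`. -/
abbrev actHist (H : ℕ) (X : ℕ → ℕ → Ω → S) (Y : ℕ → ℕ → Ω → A × A) (t h : ℕ) :
    MeasurableSpace Ω :=
  stateHist H X Y t h ⊔ MeasurableSpace.comap (Y t h) inferInstance

/-- The observations along the outcome `ω`. -/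
def obs (X : ℕ → ℕ → Ω → S) (Y : ℕ → ℕ → Ω → A × A) (ω : Ω) : Obs S A :=
  ⟨fun t h => X t h ω, fun t h => Y t h ω⟩

/-- The random states `X t h` and action pairs `Y t h` arise from `T` episodes of `KernelCCE-VTR+`
in the game `G`: given the past, the actions are drawn from `σ_h^t(x_h^t)` and the next state from
`P_h(· | z_h^t)`. The initial states `X t 1` are arbitrary (random, possibly depending on the
past). -/
structure IsRun [MeasurableSpace Ω] (μ : Measure Ω) (G : Game S A F H) (P : Params)
    (fc : CCEFinder S A) (T : ℕ) (X : ℕ → ℕ → Ω → S) (Y : ℕ → ℕ → Ω → A × A) : Prop where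
  measurable_state : ∀ t h, Measurable (X t h)
  measurable_act : ∀ t h, Measurable (Y t h)
  act_law : ∀ t ∈ Finset.Icc 1 T, ∀ h ∈ Finset.Icc 1 H, ∀ c : A × A,
    μ[(Y t h ⁻¹' {c}).indicator (fun _ => (1 : ℝ)) | stateHist H X Y t h]
      =ᵐ[μ] fun ω => (joint G P fc (obs X Y ω) t h (X t h ω) c).toReal
  state_law : ∀ t ∈ Finset.Icc 1 T, ∀ h ∈ Finset.Icc 1 H, ∀ s : S,
    μ[(X t (h + 1) ⁻¹' {s}).indicator (fun _ => (1 : ℝ)) | actHist H X Y t h]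
      =ᵐ[μ] fun ω => (G.trans h (X t h ω, Y t h ω) s).toReal

end Interaction

end KernelMG

end

/-!
The three effective dimensions in the parameters coincide with `d = Γ_K(T, 1/B²)`, because `λ₁ α² =
λ₂ / H² = 1 / B²`. A total probability of one forces `B ≥ 1`, hence `d ≥ 1/3`, as soon as there is
a state-action triplet, so that no parameter degenerates (`Game.one_le_bound`,
`Game.one_third_le_effDim`, `tuned_good`).

*Ridge regression.* Only finitely many inputs occur at a time, so the inverse covariance `(λ + ∑ ψ
⊗ ψ)⁻¹` can be built up by rank-one updates (`covInv`). The width is the norm of a vector in the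
geometry of the inverse covariance (`width_eq`), the estimate is the inverse covariance applied to
`∑ y ψ`, and the leverages `ω / (1 + ω)`, where `ω` is the squared width of the next input, add up
to at most `log det (I + K / λ)` (`sum_leverage_le`), that is, to at most `2 d`.

*Concentration.* With noise `η` that is centered given the past, bounded by `M` and of conditional
variance at most `σ²`, the squared norm `N` of `∑ η ψ` in the geometry of the inverse covariance
increases by at most `2 η g + η² v`, where `v` is the leverage and `g² ≤ N v`. Hence `√(c² + N)`
has increments that are linear in `η` up to a multiple of `η² v`, and a direct exponential
supermartingale gives the Bernstein-type bound `measure_selfNormalized_le`. The observations are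
discrete, so every quantity that depends only on the past is measurable with respect to it
(`stateHist_discrete`, `actHist_discrete`); the exponential moments are then computed conditionally
on the past.

*The good event.* The Bernstein radius `β` requires normalized noise of variance at most `1`, that
is `R² ≥ Var V`. The two cruder regressions show that this is the case (`nextVar_le_rVal_sq`). As
`R² ≥ Var V` is a property of the past, the noise may be set to zero where it fails before the
concentration inequality is applied, which avoids any circularity (`noise₁'`,
`abs_inner_theta₁_sub_le_beta`). A union bound over steps, episodes, the two sides and four
martingale sums gives `IsRun.likely_goodEvent`.

*The deterministic part.* On the good event, the equilibrium inequalities imply by backward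
induction that the estimates sandwich the best response values (`value_le_vEst_true`,
`vEst_false_le_value`). The gap of the estimates telescopes along the trajectory, so the regret is
at most the sum `W` of the truncated bonuses up to martingale terms (`regret_le_sumBonus`). By the
Cauchy–Schwarz inequality `W ≲ √(d H) β √(∑ R²)` (`sumBonus_le`), and `∑ R²` is the sum of the
conditional variances up to the margins of the variance estimates (`sumSqR_le`). The squares of the
value estimates telescope as well, which bounds the sum of the variances by `H² T + H W` up to a
constant factor and martingale terms (`sum_nextVar_le`). Solving the resulting quadratic inequality
for `W` (`sumBonus_le_of_recursion`) yields the first bound, and the second one follows from it by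
comparing the terms (`rate_le`).
-/


open MeasureTheory
open scoped InnerProductSpace

noncomputable section

namespace KernelMG

/-! ### Expectations of bounded functions under discrete laws -/

section Expect

variable {α β : Type*} (p : PMF α)

theorem hasSum_toReal : HasSum (fun a => (p a).toReal) 1 := by
  have h := ENNReal.hasSum_toReal (f := fun a => p a) (by rw [p.tsum_coe]; exact ENNReal.one_ne_top)
  simpa [← ENNReal.tsum_toReal_eq fun a => p.apply_ne_top a, p.tsum_coe] using h

variable {p}

theorem summable_expect {f : α → ℝ} {C : ℝ} (hf : ∀ a ∈ p.support, |f a| ≤ C) :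
    Summable fun a => (p a).toReal * f a := by
  refine Summable.of_norm_bounded ((hasSum_toReal p).summable.mul_right C) fun a => ?_
  by_cases ha : a ∈ p.support
  · rw [norm_mul, Real.norm_of_nonneg ENNReal.toReal_nonneg]
    exact mul_le_mul_of_nonneg_left (hf a ha) ENNReal.toReal_nonneg
  · simp [(p.apply_eq_zero_iff a).2 ha]

theorem summable_expect' {f : α → ℝ} {C : ℝ} (hf : ∀ a, |f a| ≤ C) :
    Summable fun a => (p a).toReal * f a := summable_expect fun a _ => hf a

theorem expect_congr {f g : α → ℝ} (h : ∀ a ∈ p.support, f a = g a) :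
    expect p f = expect p g := by
  refine tsum_congr fun a => ?_
  by_cases ha : a ∈ p.support
  · rw [h a ha]
  · simp [(p.apply_eq_zero_iff a).2 ha]

theorem expect_const (c : ℝ) : expect p (fun _ => c) = c := by
  rw [expect, tsum_mul_right, (hasSum_toReal p).tsum_eq, one_mul]

theorem expect_add {f g : α → ℝ} {C D : ℝ} (hf : ∀ a ∈ p.support, |f a| ≤ C)
    (hg : ∀ a ∈ p.support, |g a| ≤ D) :
    expect p (fun a => f a + g a) = expect p f + expect p g := by
  simp only [expect, mul_add]
  exact (summable_expect hf).tsum_add (summable_expect hg)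

theorem expect_mul_left (c : ℝ) (f : α → ℝ) : expect p (fun a => c * f a) = c * expect p f := by
  simp only [expect, mul_left_comm _ c]
  exact tsum_mul_left

theorem expect_sub {f g : α → ℝ} {C D : ℝ} (hf : ∀ a ∈ p.support, |f a| ≤ C)
    (hg : ∀ a ∈ p.support, |g a| ≤ D) :
    expect p (fun a => f a - g a) = expect p f - expect p g := by
  simp only [expect, mul_sub]
  exact (summable_expect hf).tsum_sub (summable_expect hg)

theorem expect_mono {f g : α → ℝ} {C D : ℝ} (hf : ∀ a ∈ p.support, |f a| ≤ C)
    (hg : ∀ a ∈ p.support, |g a| ≤ D) (h : ∀ a ∈ p.support, f a ≤ g a) :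
    expect p f ≤ expect p g := by
  refine (summable_expect hf).tsum_le_tsum (fun a => ?_) (summable_expect hg)
  by_cases ha : a ∈ p.support
  · exact mul_le_mul_of_nonneg_left (h a ha) ENNReal.toReal_nonneg
  · simp [(p.apply_eq_zero_iff a).2 ha]

theorem expect_le {f : α → ℝ} {C D : ℝ} (hf : ∀ a ∈ p.support, |f a| ≤ C)
    (h : ∀ a ∈ p.support, f a ≤ D) : expect p f ≤ D :=
  (expect_mono hf (fun _ _ => le_rfl) h).trans_eq (expect_const D)

theorem le_expect {f : α → ℝ} {C D : ℝ} (hf : ∀ a ∈ p.support, |f a| ≤ C)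
    (h : ∀ a ∈ p.support, D ≤ f a) : D ≤ expect p f :=
  (expect_const D).symm.le.trans (expect_mono (fun _ _ => le_rfl) hf h)

theorem abs_expect_le {f : α → ℝ} {C : ℝ} (hf : ∀ a ∈ p.support, |f a| ≤ C) :
    |expect p f| ≤ C :=
  abs_le.2 ⟨le_expect hf fun a ha => (abs_le.1 (hf a ha)).1,
    expect_le hf fun a ha => (abs_le.1 (hf a ha)).2⟩

theorem expect_nonneg {f : α → ℝ} (h : ∀ a, 0 ≤ f a) : 0 ≤ expect p f :=
  tsum_nonneg fun a => mul_nonneg ENNReal.toReal_nonneg (h a)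

/-- The variance formula `E (f - E f)² = E f² - (E f)²`. -/
theorem expect_sub_sq {f : α → ℝ} {C : ℝ} (hf : ∀ a, |f a| ≤ C) :
    expect p (fun a => (f a - expect p f) ^ 2) = expect p (fun a => f a ^ 2) - expect p f ^ 2 := by
  have h2 : ∀ a ∈ p.support, |f a ^ 2| ≤ C ^ 2 := fun a _ => by
    rw [abs_pow]; exact pow_le_pow_left₀ (abs_nonneg _) (hf a) 2
  have h1 : ∀ a ∈ p.support, |(-2 * expect p f) * f a| ≤ |-2 * expect p f| * C := fun a _ => by
    rw [abs_mul]; exact mul_le_mul_of_nonneg_left (hf a) (abs_nonneg _)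
  have h3 : ∀ a ∈ p.support, |(-2 * expect p f) * f a + expect p f ^ 2|
      ≤ |-2 * expect p f| * C + |expect p f ^ 2| := fun a ha =>
    (abs_add_le _ _).trans (add_le_add (h1 a ha) le_rfl)
  have e : (fun a => (f a - expect p f) ^ 2)
      = fun a => f a ^ 2 + ((-2 * expect p f) * f a + expect p f ^ 2) := by
    funext a; ring
  rw [e, expect_add h2 h3, expect_add h1 (fun _ _ => le_rfl), expect_mul_left, expect_const]
  ring

/-- Jensen's inequality for the square. -/
theorem sq_expect_le {f : α → ℝ} {C : ℝ} (hf : ∀ a, |f a| ≤ C) :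
    expect p f ^ 2 ≤ expect p (fun a => f a ^ 2) := by
  have := expect_sub_sq (p := p) hf
  have h0 : 0 ≤ expect p (fun a => (f a - expect p f) ^ 2) := expect_nonneg fun a => sq_nonneg _
  linarith

theorem expect_pure (a : α) (f : α → ℝ) : expect (PMF.pure a) f = f a := by
  rw [expect, tsum_eq_single a]
  · simp
  · intro b hb
    simp [PMF.pure_apply, hb]

/-- The tower property of discrete expectations. -/
theorem expect_bind {q : α → PMF β} {f : β → ℝ} {C : ℝ}
    (hf : ∀ b ∈ (p.bind q).support, |f b| ≤ C) :
    expect (p.bind q) f = expect p fun a => expect (q a) f := by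
  have hne : ∀ a b, p a * q a b ≠ ⊤ := fun a b =>
    ENNReal.mul_ne_top (p.apply_ne_top a) ((q a).apply_ne_top b)
  have h1 : ∀ b, (p.bind q b).toReal = ∑' a, (p a).toReal * (q a b).toReal := fun b => by
    rw [PMF.bind_apply, ENNReal.tsum_toReal_eq fun a => hne a b]
    simp only [ENNReal.toReal_mul]
  have hs : Summable fun x : α × β => (p x.1).toReal * (q x.1 x.2).toReal := by
    refine (summable_prod_of_nonneg fun x => ?_).2
      ⟨fun a => (hasSum_toReal (q a)).summable.mul_left (p a).toReal, ?_⟩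
    · exact mul_nonneg ENNReal.toReal_nonneg ENNReal.toReal_nonneg
    · have e : ∀ a, ∑' b, (p a).toReal * (q a b).toReal = (p a).toReal := fun a => by
        rw [tsum_mul_left, (hasSum_toReal (q a)).tsum_eq, mul_one]
      simpa only [e] using (hasSum_toReal p).summable
  have hs' : Summable fun x : α × β => (p x.1).toReal * (q x.1 x.2).toReal * f x.2 := by
    refine Summable.of_norm_bounded (hs.mul_right C) fun x => ?_
    rw [norm_mul, Real.norm_of_nonneg (mul_nonneg ENNReal.toReal_nonneg ENNReal.toReal_nonneg)]
    by_cases hx : p x.1 * q x.1 x.2 = 0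
    · rw [← ENNReal.toReal_mul, hx]; simp
    · refine mul_le_mul_of_nonneg_left (hf _ ?_)
        (mul_nonneg ENNReal.toReal_nonneg ENNReal.toReal_nonneg)
      rw [PMF.mem_support_bind_iff]
      exact ⟨x.1, fun h => hx (by rw [h, zero_mul]), fun h => hx (by rw [h, mul_zero])⟩
  calc expect (p.bind q) f
      = ∑' b, ∑' a, (p a).toReal * (q a b).toReal * f b := by
        simp only [expect, h1, tsum_mul_right]
    _ = ∑' a, ∑' b, (p a).toReal * (q a b).toReal * f b :=
        Summable.tsum_comm (f := fun a b => (p a).toReal * (q a b).toReal * f b) hs'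
    _ = _ := by simp only [expect, mul_assoc, tsum_mul_left]

theorem expect_map' {g : α → β} {f : β → ℝ} {C : ℝ}
    (hf : ∀ b ∈ (p.map g).support, |f b| ≤ C) :
    expect (p.map g) f = expect p fun a => f (g a) := by
  rw [← PMF.bind_pure_comp] at hf ⊢
  rw [expect_bind hf]
  simp [expect_pure]

end Expect

/-! ### Clipping -/

theorem clip_mem {lo hi : ℝ} (h : lo ≤ hi) (x : ℝ) : clip lo hi x ∈ Set.Icc lo hi :=
  ⟨le_max_left _ _, max_le h (min_le_left _ _)⟩

theorem clip_mono (lo hi : ℝ) {x y : ℝ} (h : x ≤ y) : clip lo hi x ≤ clip lo hi y :=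
  max_le_max le_rfl (min_le_min le_rfl h)

theorem clip_of_mem {lo hi x : ℝ} (h : x ∈ Set.Icc lo hi) : clip lo hi x = x := by
  rw [clip, min_eq_right h.2, max_eq_right h.1]

theorem abs_clip_sub_le (lo hi x y : ℝ) : |clip lo hi x - clip lo hi y| ≤ |x - y| :=
  (abs_max_sub_max_le_max _ _ _ _).trans (max_le (by simp) <|
    (abs_min_sub_min_le_max _ _ _ _).trans (max_le (by simp) le_rfl))

theorem abs_clip_le {c : ℝ} (h : 0 ≤ c) (x : ℝ) : |clip (-c) c x| ≤ c :=
  abs_le.2 (clip_mem (by linarith) x)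

/-! ### Values of Markov policies -/

section Value

variable {S A F : Type*} [NormedAddCommGroup F] [InnerProductSpace ℝ F] {H : ℕ}
  (G : Game S A F H) (π ν : Policy S A)

theorem Game.abs_totalReward_le (n h : ℕ) (x : S) (h1 : 1 ≤ h) (hn : h + n ≤ H + 1) :
    ∀ τ ∈ (G.trajLaw π ν n h x).support, |G.totalReward h τ| ≤ n := by
  induction n generalizing h x with
  | zero =>
    intro τ hτ
    simp only [Game.trajLaw, PMF.mem_support_pure_iff] at hτ
    simp [hτ, Game.totalReward]
  | succ n ih =>
    intro τ hτ
    simp only [Game.trajLaw, PMF.mem_support_bind_iff, PMF.mem_support_map_iff] at hτ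
    obtain ⟨a, -, b, -, y, -, τ', hτ', rfl⟩ := hτ
    have hr := G.reward_mem h (Finset.mem_Icc.2 ⟨h1, by omega⟩) (x, a, b)
    have := ih (h + 1) y (by omega) (by omega) τ' hτ'
    simp only [Game.totalReward]
    push_cast
    have h2 := abs_add_le (G.reward h (x, a, b)) (G.totalReward (h + 1) τ')
    have h3 : |G.reward h (x, a, b)| ≤ 1 := abs_le.2 hr
    linarith

theorem Game.abs_expect_totalReward_le (n h : ℕ) (x : S) (h1 : 1 ≤ h) (hn : h + n ≤ H + 1) :
    |expect (G.trajLaw π ν n h x) (G.totalReward h)| ≤ n :=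
  abs_expect_le (G.abs_totalReward_le π ν n h x h1 hn)

/-- The Bellman equation for a pair of Markov policies. -/
theorem Game.expect_trajLaw_succ (n h : ℕ) (x : S) (h1 : 1 ≤ h) (hn : h + (n + 1) ≤ H + 1) :
    expect (G.trajLaw π ν (n + 1) h x) (G.totalReward h) =
      expect (π h x) fun a => expect (ν h x) fun b => G.reward h (x, a, b) +
        expect (G.trans h (x, a, b)) fun y =>
          expect (G.trajLaw π ν n (h + 1) y) (G.totalReward (h + 1)) := by
  have hb := G.abs_totalReward_le π ν (n + 1) h x h1 hn
  simp only [Game.trajLaw] at hb ⊢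
  rw [expect_bind hb]
  refine expect_congr fun a ha => ?_
  have hb1 : ∀ τ ∈ ((ν h x).bind fun b => (G.trans h (x, a, b)).bind fun y =>
      (G.trajLaw π ν n (h + 1) y).map fun τ => (x, a, b) :: τ).support,
      |G.totalReward h τ| ≤ ((n + 1 : ℕ) : ℝ) := fun τ hτ =>
    hb τ ((PMF.mem_support_bind_iff _ _ _).2 ⟨a, ha, hτ⟩)
  rw [expect_bind hb1]
  refine expect_congr fun b hb' => ?_
  have hb2 : ∀ τ ∈ ((G.trans h (x, a, b)).bind fun y =>
      (G.trajLaw π ν n (h + 1) y).map fun τ => (x, a, b) :: τ).support,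
      |G.totalReward h τ| ≤ ((n + 1 : ℕ) : ℝ) := fun τ hτ =>
    hb1 τ ((PMF.mem_support_bind_iff _ _ _).2 ⟨b, hb', hτ⟩)
  rw [expect_bind hb2]
  have e : ∀ y ∈ (G.trans h (x, a, b)).support,
      expect ((G.trajLaw π ν n (h + 1) y).map fun τ => (x, a, b) :: τ) (G.totalReward h)
        = G.reward h (x, a, b)
          + expect (G.trajLaw π ν n (h + 1) y) (G.totalReward (h + 1)) := by
    intro y hy
    rw [expect_map' fun τ hτ => hb2 τ ((PMF.mem_support_bind_iff _ _ _).2 ⟨y, hy, hτ⟩)]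
    simp only [Game.totalReward]
    rw [expect_add (fun _ _ => le_rfl)
      (G.abs_totalReward_le π ν n (h + 1) y (by omega) (by omega)), expect_const]
  rw [expect_congr e, expect_add (fun _ _ => le_rfl)
    (fun y _ => G.abs_expect_totalReward_le π ν n (h + 1) y (by omega) (by omega)), expect_const]

/-- A function `W` that is at least the reward plus the expected next value, averaged over the
actions of the policies, and vanishes after the last step bounds the value from above. The
quantities `U` stand for the values of the next step, about which only `|U| ≤ H - h` and `U ≤ W` may
be used. -/
theorem Game.value_le (W : ℕ → S → ℝ) (hW : ∀ x, 0 ≤ W (H + 1) x)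
    (hstep : ∀ h, 1 ≤ h → h ≤ H → ∀ (U : S → ℝ), (∀ y, |U y| ≤ (H : ℝ) - h) →
      (∀ y, U y ≤ W (h + 1) y) → ∀ x,
      (expect (π h x) fun a => expect (ν h x) fun b => G.reward h (x, a, b) +
        expect (G.trans h (x, a, b)) U) ≤ W h x)
    (h : ℕ) (h1 : 1 ≤ h) (hH : h ≤ H + 1) (x : S) : G.value π ν h x ≤ W h x := by
  rw [Game.value]
  obtain ⟨n, hn⟩ : ∃ n, n = H + 1 - h := ⟨_, rfl⟩
  rw [← hn]
  induction n generalizing h x with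
  | zero =>
    obtain rfl : h = H + 1 := by omega
    simpa [Game.trajLaw, expect_pure, Game.totalReward] using hW x
  | succ n ih =>
    rw [G.expect_trajLaw_succ π ν n h x h1 (by omega)]
    refine hstep h h1 (by omega) _ (fun y => ?_) (fun y => ih (h + 1) (by omega) (by omega) y
      (by omega)) x
    refine (G.abs_expect_totalReward_le π ν n (h + 1) y (by omega) (by omega)).trans ?_
    have : (n : ℝ) + h = H := by exact_mod_cast (by omega : n + h = H)
    linarith

/-- The counterpart of `Game.value_le` for lower bounds. -/
theorem Game.le_value (W : ℕ → S → ℝ) (hW : ∀ x, W (H + 1) x ≤ 0)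
    (hstep : ∀ h, 1 ≤ h → h ≤ H → ∀ (U : S → ℝ), (∀ y, |U y| ≤ (H : ℝ) - h) →
      (∀ y, W (h + 1) y ≤ U y) → ∀ x,
      W h x ≤ (expect (π h x) fun a => expect (ν h x) fun b => G.reward h (x, a, b) +
        expect (G.trans h (x, a, b)) U))
    (h : ℕ) (h1 : 1 ≤ h) (hH : h ≤ H + 1) (x : S) : W h x ≤ G.value π ν h x := by
  rw [Game.value]
  obtain ⟨n, hn⟩ : ∃ n, n = H + 1 - h := ⟨_, rfl⟩
  rw [← hn]
  induction n generalizing h x with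
  | zero =>
    obtain rfl : h = H + 1 := by omega
    simpa [Game.trajLaw, expect_pure, Game.totalReward] using hW x
  | succ n ih =>
    rw [G.expect_trajLaw_succ π ν n h x h1 (by omega)]
    refine hstep h h1 (by omega) _ (fun y => ?_) (fun y => ih (h + 1) (by omega) (by omega) y
      (by omega)) x
    refine (G.abs_expect_totalReward_le π ν n (h + 1) y (by omega) (by omega)).trans ?_
    have : (n : ℝ) + h = H := by exact_mod_cast (by omega : n + h = H)
    linarith

end Value

/-! ### The regularized covariance operator and its inverse -/

section Covariance

variable {F : Type*} [NormedAddCommGroup F] [InnerProductSpace ℝ F]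

/-- The regularized covariance operator `f ↦ lam f + ∑_{i < n} ⟪ψ_i, f⟫ ψ_i`. -/
def covOp (lam : ℝ) (ψ : ℕ → F) (n : ℕ) (f : F) : F :=
  lam • f + ∑ i ∈ Finset.range n, ⟪ψ i, f⟫_ℝ • ψ i

/-- The inverse of `covOp`, built up by the Sherman–Morrison formula. -/
def covInv (lam : ℝ) (ψ : ℕ → F) : ℕ → F →ₗ[ℝ] F
  | 0 => lam⁻¹ • LinearMap.id
  | n + 1 => covInv lam ψ n - (1 + ⟪ψ n, covInv lam ψ n (ψ n)⟫_ℝ)⁻¹ •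
      (innerₗ F (covInv lam ψ n (ψ n))).smulRight (covInv lam ψ n (ψ n))

variable {lam : ℝ} (ψ : ℕ → F)

theorem covInv_succ_apply (n : ℕ) (f : F) :
    covInv lam ψ (n + 1) f = covInv lam ψ n f - ((1 + ⟪ψ n, covInv lam ψ n (ψ n)⟫_ℝ)⁻¹ *
      ⟪covInv lam ψ n (ψ n), f⟫_ℝ) • covInv lam ψ n (ψ n) := by
  simp [covInv, mul_smul]

theorem covOp_succ (n : ℕ) (f : F) :
    covOp lam ψ (n + 1) f = covOp lam ψ n f + ⟪ψ n, f⟫_ℝ • ψ n := by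
  simp [covOp, Finset.sum_range_succ, add_assoc]

theorem covOp_sub_smul (n : ℕ) (f g : F) (c : ℝ) :
    covOp lam ψ n (f - c • g) = covOp lam ψ n f - c • covOp lam ψ n g := by
  simp only [covOp, inner_sub_right, real_inner_smul_right, sub_smul, Finset.sum_sub_distrib,
    smul_sub, smul_add, Finset.smul_sum, smul_smul, mul_comm lam c]
  abel

theorem inner_covOp_self (n : ℕ) (u : F) :
    ⟪covOp lam ψ n u, u⟫_ℝ = lam * ‖u‖ ^ 2 + ∑ i ∈ Finset.range n, ⟪ψ i, u⟫_ℝ ^ 2 := by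
  simp only [covOp, inner_add_left, real_inner_smul_left, sum_inner, real_inner_self_eq_norm_sq]
  congr 1
  exact Finset.sum_congr rfl fun i _ => by ring

theorem inner_covInv_comm (n : ℕ) (f g : F) :
    ⟪covInv lam ψ n f, g⟫_ℝ = ⟪f, covInv lam ψ n g⟫_ℝ := by
  induction n generalizing f g with
  | zero => simp [covInv, real_inner_smul_left, real_inner_smul_right]
  | succ n ih =>
    simp only [covInv_succ_apply, inner_sub_left, inner_sub_right, real_inner_smul_left,
      real_inner_smul_right, ih f g, real_inner_comm f]
    ring

theorem covOp_covInv (hlam : 0 < lam) (n : ℕ) (f : F) : covOp lam ψ n (covInv lam ψ n f) = f := by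
  induction n generalizing f with
  | zero => simp [covOp, covInv, smul_smul, hlam.ne']
  | succ n ih =>
    have h0 : 0 ≤ ⟪ψ n, covInv lam ψ n (ψ n)⟫_ℝ := by
      have := inner_covOp_self (lam := lam) ψ n (covInv lam ψ n (ψ n))
      rw [ih (ψ n)] at this
      rw [this]
      exact add_nonneg (by positivity) (Finset.sum_nonneg fun i _ => sq_nonneg _)
    rw [covOp_succ, covInv_succ_apply, covOp_sub_smul, ih, ih, inner_sub_right,
      real_inner_smul_right, inner_covInv_comm]
    generalize ⟪ψ n, covInv lam ψ n (ψ n)⟫_ℝ = w at h0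
    generalize ⟪ψ n, covInv lam ψ n f⟫_ℝ = x
    have : x - (1 + w)⁻¹ * x * w = (1 + w)⁻¹ * x := by
      field_simp
      ring
    rw [this]
    abel

theorem covOp_injective (hlam : 0 < lam) (n : ℕ) : Function.Injective (covOp lam ψ n) := by
  intro f g h
  have h1 : covOp lam ψ n (f - (1 : ℝ) • g) = 0 := by
    rw [covOp_sub_smul, h, one_smul, sub_self]
  rw [one_smul] at h1
  have h2 := inner_covOp_self (lam := lam) ψ n (f - g)
  rw [h1, inner_zero_left] at h2
  have h3 : 0 ≤ ∑ i ∈ Finset.range n, ⟪ψ i, f - g⟫_ℝ ^ 2 := Finset.sum_nonneg fun i _ => sq_nonneg _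
  have h4 : lam * ‖f - g‖ ^ 2 = 0 := le_antisymm (by linarith) (by positivity)
  have h5 : ‖f - g‖ = 0 := by simpa [hlam.ne'] using h4
  exact sub_eq_zero.1 (norm_eq_zero.1 h5)

theorem eq_covInv (hlam : 0 < lam) {n : ℕ} {u f : F} (h : covOp lam ψ n u = f) :
    u = covInv lam ψ n f :=
  covOp_injective ψ hlam n (by rw [h, covOp_covInv ψ hlam])

/-- The squared norm `⟪f, (lam + ∑ ψ_i ⊗ ψ_i)⁻¹ f⟫` of `f` in the geometry of the inverse covariance. -/
def covSq (lam : ℝ) (ψ : ℕ → F) (n : ℕ) (f : F) : ℝ := ⟪f, covInv lam ψ n f⟫_ℝ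

theorem covSq_nonneg (hlam : 0 < lam) (n : ℕ) (f : F) : 0 ≤ covSq lam ψ n f := by
  have := inner_covOp_self (lam := lam) ψ n (covInv lam ψ n f)
  rw [covOp_covInv ψ hlam] at this
  rw [covSq, this]
  exact add_nonneg (by positivity) (Finset.sum_nonneg fun i _ => sq_nonneg _)

/-- The Cauchy–Schwarz inequality for the inverse covariance. -/
theorem abs_inner_covInv_le (hlam : 0 < lam) (n : ℕ) (f g : F) :
    |⟪f, covInv lam ψ n g⟫_ℝ| ≤ √(covSq lam ψ n f) * √(covSq lam ψ n g) := by
  let B : LinearMap.BilinForm ℝ F := (innerₗ F).compl₂ (covInv lam ψ n)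
  have hB : ∀ f g, B f g = ⟪f, covInv lam ψ n g⟫_ℝ := fun f g => by simp [B]
  have h := B.apply_mul_apply_le_of_forall_zero_le (fun x => by
    rw [hB]; exact covSq_nonneg ψ hlam n x) f g
  rw [hB, hB, hB, hB, ← inner_covInv_comm ψ n g f, real_inner_comm _ (covInv lam ψ n g), ← sq] at h
  rw [← Real.sqrt_mul (covSq_nonneg ψ hlam n f)]
  exact Real.abs_le_sqrt h

theorem covSq_succ (n : ℕ) (f : F) : covSq lam ψ (n + 1) f = covSq lam ψ n f -
    (1 + covSq lam ψ n (ψ n))⁻¹ * ⟪ψ n, covInv lam ψ n f⟫_ℝ ^ 2 := by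
  simp only [covSq, covInv_succ_apply, inner_sub_right, real_inner_smul_right]
  rw [inner_covInv_comm, real_inner_comm (covInv lam ψ n (ψ n)) f, inner_covInv_comm]
  ring

theorem covSq_le (hlam : 0 < lam) (n : ℕ) (f : F) : covSq lam ψ n f ≤ ‖f‖ ^ 2 / lam := by
  induction n with
  | zero =>
    simp [covSq, covInv, real_inner_smul_right]
    rw [div_eq_inv_mul]
  | succ n ih =>
    rw [covSq_succ]
    have := covSq_nonneg ψ hlam n (ψ n)
    have : 0 ≤ (1 + covSq lam ψ n (ψ n))⁻¹ * ⟪ψ n, covInv lam ψ n f⟫_ℝ ^ 2 := by positivity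
    linarith

/-- The leverage `w² / (1 + w²)` of the input `ψ_n`, where `w²` is its squared norm in the geometry of
the inverse covariance of its predecessors. -/
def leverage (lam : ℝ) (ψ : ℕ → F) (n : ℕ) : ℝ :=
  covSq lam ψ n (ψ n) / (1 + covSq lam ψ n (ψ n))

theorem leverage_nonneg (hlam : 0 < lam) (n : ℕ) : 0 ≤ leverage lam ψ n :=
  div_nonneg (covSq_nonneg ψ hlam _ _) (by linarith [covSq_nonneg ψ hlam n (ψ n)])

theorem leverage_le_one (hlam : 0 < lam) (n : ℕ) : leverage lam ψ n ≤ 1 :=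
  div_le_one_of_le₀ (by linarith) (by linarith [covSq_nonneg ψ hlam n (ψ n)])

theorem min_one_covSq_le (hlam : 0 < lam) (n : ℕ) :
    min 1 (covSq lam ψ n (ψ n)) ≤ 2 * leverage lam ψ n := by
  have h0 := covSq_nonneg ψ hlam n (ψ n)
  rw [leverage, mul_div_assoc', le_div_iff₀ (by linarith)]
  generalize covSq lam ψ n (ψ n) = w at h0
  rcases le_total 1 w with h | h
  · rw [min_eq_left h]; linarith
  · rw [min_eq_right h]; nlinarith

/-- One step of the squared norm of the noise `b` accumulated so far. -/
theorem covSq_succ_add (hlam : 0 < lam) (n : ℕ) (b : F) (η : ℝ) :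
    covSq lam ψ (n + 1) (b + η • ψ n) ≤ covSq lam ψ n b +
      2 * η * (⟪ψ n, covInv lam ψ n b⟫_ℝ / (1 + covSq lam ψ n (ψ n))) +
      η ^ 2 * leverage lam ψ n := by
  have h0 := covSq_nonneg ψ hlam n (ψ n)
  have e : covSq lam ψ n (b + η • ψ n) = covSq lam ψ n b + 2 * η * ⟪ψ n, covInv lam ψ n b⟫_ℝ
      + η ^ 2 * covSq lam ψ n (ψ n) := by
    simp only [covSq, map_add, map_smul, inner_add_left, inner_add_right, real_inner_smul_left,
      real_inner_smul_right]
    rw [← inner_covInv_comm ψ n b (ψ n), real_inner_comm (ψ n)]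
    ring
  rw [covSq_succ, e, map_add, map_smul, inner_add_right, real_inner_smul_right, leverage]
  change _ - _ * (_ + η * covSq lam ψ n (ψ n)) ^ 2 ≤ _
  generalize covSq lam ψ n (ψ n) = w at h0
  generalize ⟪ψ n, covInv lam ψ n b⟫_ℝ = x
  have h1 : 0 < 1 + w := by linarith
  have : covSq lam ψ n b + 2 * η * x + η ^ 2 * w - (1 + w)⁻¹ * (x + η * w) ^ 2
      = covSq lam ψ n b + 2 * η * (x / (1 + w)) + η ^ 2 * (w / (1 + w)) - (1 + w)⁻¹ * x ^ 2 := by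
    field_simp
    ring
  rw [this]
  have : 0 ≤ (1 + w)⁻¹ * x ^ 2 := by positivity
  linarith

/-! ### The dual description by Gram matrices -/

variable (n : ℕ)

theorem gram_add_posDef (hlam : 0 < lam) {m : ℕ} (ψ : Fin m → F) :
    (Matrix.gram ℝ ψ + lam • (1 : Matrix (Fin m) (Fin m) ℝ)).PosDef :=
  (Matrix.PosDef.one.smul hlam).posSemidef_add (Matrix.posSemidef_gram ℝ ψ)

theorem gram_add_mulVec_ridgeInv (hlam : 0 < lam) {m : ℕ} (ψ : Fin m → F) (y : Fin m → ℝ)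
    (i : Fin m) : ∑ j, ⟪ψ i, ψ j⟫_ℝ * (ridgeInv lam ψ).mulVec y j +
      lam * (ridgeInv lam ψ).mulVec y i = y i := by
  have h : (Matrix.gram ℝ ψ + lam • (1 : Matrix (Fin m) (Fin m) ℝ)).mulVec
      ((ridgeInv lam ψ).mulVec y) = y := by
    rw [ridgeInv, Matrix.mulVec_mulVec,
      Matrix.mul_nonsing_inv _ (gram_add_posDef hlam ψ).det_pos.ne'.isUnit, Matrix.one_mulVec]
  have h := congrFun h i
  rw [Matrix.add_mulVec, Matrix.smul_mulVec, Matrix.one_mulVec] at h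
  generalize (ridgeInv lam ψ).mulVec y = c at h
  simpa [Matrix.mulVec, dotProduct, Matrix.gram] using h

theorem covInv_eq_dual (hlam : 0 < lam) (f : F) :
    covInv lam ψ n f = lam⁻¹ • (f - ∑ i : Fin n,
      (ridgeInv lam (fun i : Fin n => ψ i)).mulVec (fun i => ⟪ψ i, f⟫_ℝ) i • ψ i) := by
  symm
  apply eq_covInv ψ hlam
  have h := gram_add_mulVec_ridgeInv hlam (fun i : Fin n => ψ i) (fun i => ⟪ψ i, f⟫_ℝ)
  set c := (ridgeInv lam (fun i : Fin n => ψ i)).mulVec (fun i => ⟪ψ i, f⟫_ℝ) with hc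
  have h' : ∀ i : Fin n, ⟪ψ i, lam⁻¹ • (f - ∑ j : Fin n, c j • ψ j)⟫_ℝ = c i := by
    intro i
    have := h i
    rw [real_inner_smul_right, inner_sub_right, inner_sum]
    simp only [real_inner_smul_right, mul_comm (c _)]
    rw [← this]
    field_simp
    ring
  rw [covOp, Finset.sum_range]
  simp only [h', smul_smul, mul_inv_cancel₀ hlam.ne', one_smul]
  abel

theorem lam_mul_covSq (hlam : 0 < lam) (f : F) :
    lam * covSq lam ψ n f = ⟪f, f⟫_ℝ - (fun i : Fin n => ⟪ψ i, f⟫_ℝ) ⬝ᵥ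
      (ridgeInv lam (fun i : Fin n => ψ i)).mulVec (fun i => ⟪ψ i, f⟫_ℝ) := by
  rw [covSq, covInv_eq_dual ψ n hlam, real_inner_smul_right, inner_sub_right, inner_sum,
    mul_inv_cancel_left₀ hlam.ne']
  congr 1
  refine Finset.sum_congr rfl fun i _ => ?_
  rw [real_inner_smul_right, real_inner_comm, mul_comm]

theorem width_eq (hlam : 0 < lam) (f : F) :
    width lam (fun i : Fin n => ψ i) f = √(covSq lam ψ n f) := by
  rw [width, ← lam_mul_covSq ψ n hlam, Real.sqrt_mul hlam.le,
    inv_mul_cancel_left₀ (Real.sqrt_pos.2 hlam).ne']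

theorem ridge_eq (hlam : 0 < lam) (y : ℕ → ℝ) :
    ridge lam (fun i : Fin n => ψ i) (fun i : Fin n => y i)
      = covInv lam ψ n (∑ i ∈ Finset.range n, y i • ψ i) := by
  apply eq_covInv ψ hlam
  have h := gram_add_mulVec_ridgeInv hlam (fun i : Fin n => ψ i) (fun i : Fin n => y i)
  rw [covOp, ridge, Finset.sum_range, Finset.sum_range, Finset.smul_sum, ← Finset.sum_add_distrib]
  refine Finset.sum_congr rfl fun i _ => ?_
  rw [inner_sum, smul_smul, ← add_smul]
  congr 1
  simp only [real_inner_smul_right]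
  rw [← h i, add_comm]
  congr 1
  exact Finset.sum_congr rfl fun j _ => mul_comm _ _

/-- The error of the ridge estimate in the direction `f`, when the outputs are `⟪ψ_i, θ⟫ + η_i`. -/
theorem abs_inner_ridge_sub_le (hlam : 0 < lam) (θ : F) (η : ℕ → ℝ) (f : F) :
    |⟪f, ridge lam (fun i : Fin n => ψ i) (fun i : Fin n => ⟪ψ i, θ⟫_ℝ + η i)⟫_ℝ - ⟪f, θ⟫_ℝ|
      ≤ (√(covSq lam ψ n (∑ i ∈ Finset.range n, η i • ψ i)) + √lam * ‖θ‖)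
        * width lam (fun i : Fin n => ψ i) f := by
  have e1 : covInv lam ψ n (∑ i ∈ Finset.range n, ⟪ψ i, θ⟫_ℝ • ψ i)
      = θ - lam • covInv lam ψ n θ := by
    symm
    apply eq_covInv ψ hlam
    rw [covOp_sub_smul, covOp_covInv ψ hlam, covOp]
    abel
  rw [ridge_eq ψ n hlam (fun i => ⟪ψ i, θ⟫_ℝ + η i), width_eq ψ n hlam]
  simp only [add_smul, Finset.sum_add_distrib, map_add, e1]
  rw [inner_add_right, inner_sub_right, real_inner_smul_right]
  set b := ∑ i ∈ Finset.range n, η i • ψ i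
  have h1 := abs_inner_covInv_le ψ hlam n f b
  have h2 := abs_inner_covInv_le ψ hlam n f θ
  have h3 : √(covSq lam ψ n θ) ≤ ‖θ‖ / √lam := by
    rw [← Real.sqrt_sq (norm_nonneg θ), ← Real.sqrt_div (sq_nonneg _)]
    exact Real.sqrt_le_sqrt (covSq_le ψ hlam n θ)
  have hs : 0 < √lam := Real.sqrt_pos.2 hlam
  have h4 : lam * √(covSq lam ψ n θ) ≤ √lam * ‖θ‖ := by
    calc lam * √(covSq lam ψ n θ) ≤ lam * (‖θ‖ / √lam) := by gcongr
      _ = √lam * ‖θ‖ := by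
        nth_rewrite 1 [← Real.mul_self_sqrt hlam.le]
        field_simp
  have e : ⟪f, θ⟫_ℝ - lam * ⟪f, covInv lam ψ n θ⟫_ℝ + ⟪f, covInv lam ψ n b⟫_ℝ - ⟪f, θ⟫_ℝ
      = ⟪f, covInv lam ψ n b⟫_ℝ - lam * ⟪f, covInv lam ψ n θ⟫_ℝ := by ring
  rw [e]
  have h5 : |lam * ⟪f, covInv lam ψ n θ⟫_ℝ| ≤ lam * √(covSq lam ψ n θ) * √(covSq lam ψ n f) := by
    rw [abs_mul, abs_of_pos hlam]
    calc _ ≤ lam * (√(covSq lam ψ n f) * √(covSq lam ψ n θ)) := by gcongr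
      _ = _ := by ring
  have h6 := mul_le_mul_of_nonneg_right h4 (Real.sqrt_nonneg (covSq lam ψ n f))
  have h7 := abs_sub (⟪f, covInv lam ψ n b⟫_ℝ) (lam * ⟪f, covInv lam ψ n θ⟫_ℝ)
  nlinarith

/-- The matrix determinant lemma, iterated: `det (1 + K / lam) = ∏ (1 + w_i²)`. -/
theorem det_one_add_gram (hlam : 0 < lam) :
    (1 + lam⁻¹ • Matrix.gram ℝ (fun i : Fin n => ψ i)).det
      = ∏ i ∈ Finset.range n, (1 + covSq lam ψ i (ψ i)) := by
  induction n with
  | zero => simp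
  | succ n ih =>
    rw [Finset.prod_range_succ, ← ih]
    set φ : Fin n → F := fun i => ψ i
    set M := 1 + lam⁻¹ • Matrix.gram ℝ φ with hM
    have hMdef : M = lam⁻¹ • (Matrix.gram ℝ φ + lam • (1 : Matrix (Fin n) (Fin n) ℝ)) := by
      rw [hM, smul_add, smul_smul, inv_mul_cancel₀ hlam.ne', one_smul, add_comm]
    have hMpd : M.PosDef := hMdef ▸ (gram_add_posDef hlam φ).smul (inv_pos.2 hlam)
    have : Invertible M := M.invertibleOfIsUnitDet hMpd.det_pos.ne'.isUnit
    let k : Fin n → ℝ := fun i => ⟪ψ i, ψ n⟫_ℝ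
    rw [← Matrix.det_submatrix_equiv_self (finSumFinEquiv (m := n) (n := 1))]
    have hblock : (1 + lam⁻¹ • Matrix.gram ℝ (fun i : Fin (n + 1) => ψ i)).submatrix
        (finSumFinEquiv (m := n) (n := 1)) (finSumFinEquiv (m := n) (n := 1))
        = Matrix.fromBlocks M (Matrix.of fun i _ => lam⁻¹ * k i)
          (Matrix.of fun _ j => lam⁻¹ * k j)
          (Matrix.of fun _ _ => 1 + lam⁻¹ * ⟪ψ n, ψ n⟫_ℝ) := by
      ext i j
      rcases i with i | i <;> rcases j with j | j
      · simp [hM, Matrix.gram, Matrix.one_apply, φ]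
      · simp [Matrix.gram, Matrix.one_apply, k, Subsingleton.elim j 0]
        intro h
        have := congrArg Fin.val h
        simp at this
        omega
      · simp [Matrix.gram, Matrix.one_apply, k, Subsingleton.elim i 0, real_inner_comm]
        intro h
        have := congrArg Fin.val h
        simp at this
        omega
      · simp [Matrix.gram, Subsingleton.elim i 0, Subsingleton.elim j 0]
    rw [hblock, Matrix.det_fromBlocks₁₁, Matrix.det_fin_one]
    congr 1
    have hsol : M⁻¹.mulVec (fun i => lam⁻¹ * k i) = (ridgeInv lam φ).mulVec k := by
      have : M.mulVec ((ridgeInv lam φ).mulVec k) = fun i => lam⁻¹ * k i := by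
        rw [hMdef, Matrix.smul_mulVec, ridgeInv, Matrix.mulVec_mulVec,
          Matrix.mul_nonsing_inv _ (gram_add_posDef hlam φ).det_pos.ne'.isUnit, Matrix.one_mulVec]
        rfl
      rw [← this, Matrix.mulVec_mulVec, Matrix.nonsing_inv_mul _ hMpd.det_pos.ne'.isUnit,
        Matrix.one_mulVec]
    have hc := lam_mul_covSq ψ n hlam (ψ n)
    have hw : covSq lam ψ n (ψ n) = lam⁻¹ * (⟪ψ n, ψ n⟫_ℝ - k ⬝ᵥ (ridgeInv lam φ).mulVec k) := by
      rw [← hc, inv_mul_cancel_left₀ hlam.ne']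
    rw [hw, ← hsol, Matrix.mul_assoc, Matrix.invOf_eq_nonsing_inv]
    simp only [Matrix.sub_apply, Matrix.of_apply, Matrix.mul_apply, Matrix.mulVec, dotProduct,
      mul_sub, Finset.mul_sum]
    rw [add_sub_assoc]
    congr 2
    refine Finset.sum_congr rfl fun i _ => ?_
    exact Finset.sum_congr rfl fun j _ => by ring

/-- The elliptical potential lemma: the leverages add up to at most `log det (1 + K / lam)`. -/
theorem sum_leverage_le (hlam : 0 < lam) :
    ∑ i ∈ Finset.range n, leverage lam ψ i
      ≤ Real.log (1 + lam⁻¹ • Matrix.gram ℝ (fun i : Fin n => ψ i)).det := by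
  have hpos : ∀ i, 0 < 1 + covSq lam ψ i (ψ i) := fun i => by
    linarith [covSq_nonneg ψ hlam i (ψ i)]
  rw [det_one_add_gram ψ n hlam, Real.log_prod fun i _ => (hpos i).ne']
  refine Finset.sum_le_sum fun i _ => ?_
  have h1 := Real.log_le_sub_one_of_pos (inv_pos.2 (hpos i))
  rw [Real.log_inv] at h1
  have h2 : leverage lam ψ i = 1 - (1 + covSq lam ψ i (ψ i))⁻¹ := by
    have := (hpos i).ne'
    rw [leverage]
    field_simp
    ring
  linarith

end Covariance

/-! ### Integration against conditional laws of discrete variables -/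

section Probability

/-- Given `m`, the discrete variable `X` has the conditional law `p`. -/
def HasCondLaw {Ω α : Type*} (m : MeasurableSpace Ω) {mΩ : MeasurableSpace Ω} (μ : Measure Ω)
    [MeasurableSpace α] (X : Ω → α)
    (p : Ω → PMF α) : Prop :=
  ∀ s, μ[(X ⁻¹' {s}).indicator (fun _ => (1 : ℝ)) | m] =ᵐ[μ] fun ω => (p ω s).toReal

variable {Ω α : Type*} {m : MeasurableSpace Ω} [mΩ : MeasurableSpace Ω] {μ : Measure Ω}

theorem HasCondLaw.aemeasurable [MeasurableSpace α] {X : Ω → α}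
    {p : Ω → PMF α} (h : HasCondLaw m μ X p) (hm : m ≤ mΩ) (s : α) :
    AEMeasurable (fun ω => p ω s) μ := by
  have h1 : AEMeasurable (fun ω => (p ω s).toReal) μ :=
    ⟨_, (stronglyMeasurable_condExp.mono hm).measurable, (h s).symm⟩
  have h2 : (fun ω => p ω s) = fun ω => ENNReal.ofReal (p ω s).toReal := by
    funext ω
    rw [ENNReal.ofReal_toReal ((p ω).apply_ne_top s)]
  rw [h2]
  exact h1.ennreal_ofReal

theorem HasCondLaw.lintegral_singleton [IsProbabilityMeasure μ] [MeasurableSpace α]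
    [MeasurableSingletonClass α] {X : Ω → α} {p : Ω → PMF α}
    (h : HasCondLaw m μ X p) (hm : m ≤ mΩ) (hX : Measurable X) (s : α)
    {g : Ω → ENNReal} (hg : Measurable[m] g) :
    ∫⁻ ω in X ⁻¹' {s}, g ω ∂μ = ∫⁻ ω, p ω s * g ω ∂μ := by
  have hE : MeasurableSet (X ⁻¹' {s}) := hX (measurableSet_singleton s)
  have key : (μ.restrict (X ⁻¹' {s})).trim hm = (μ.withDensity fun ω => p ω s).trim hm := by
    refine @Measure.ext _ m _ _ fun A hA => ?_
    rw [trim_measurableSet_eq hm hA, trim_measurableSet_eq hm hA, Measure.restrict_apply (hm A hA),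
      withDensity_apply _ (hm A hA)]
    have hint : Integrable ((X ⁻¹' {s}).indicator (fun _ => (1 : ℝ))) μ :=
      (integrable_const 1).indicator hE
    have h1 := setIntegral_condExp hm hint hA
    rw [setIntegral_indicator hE, setIntegral_const, smul_eq_mul, mul_one] at h1
    have h2 : ∫⁻ ω in A, p ω s ∂μ = ∫⁻ ω in A,
        ENNReal.ofReal ((μ[(X ⁻¹' {s}).indicator (fun _ => (1 : ℝ)) | m]) ω) ∂μ := by
      refine lintegral_congr_ae (ae_restrict_of_ae ?_)
      filter_upwards [h s] with ω hω
      rw [hω, ENNReal.ofReal_toReal ((p ω).apply_ne_top s)]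
    rw [h2, ← ofReal_integral_eq_lintegral_ofReal integrable_condExp.integrableOn, h1,
      ofReal_measureReal]
    refine ae_restrict_of_ae ?_
    filter_upwards [h s] with ω hω
    rw [hω]
    exact ENNReal.toReal_nonneg
  have h1 := lintegral_trim (μ := μ.restrict (X ⁻¹' {s})) hm hg
  have h2 := lintegral_trim (μ := μ.withDensity fun ω => p ω s) hm hg
  rw [← h1, key, h2, lintegral_withDensity_eq_lintegral_mul₀ (h.aemeasurable hm s)
    (hg.mono hm le_rfl).aemeasurable]
  rfl

/-- The tower property for a variable with a discrete conditional law. -/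
theorem HasCondLaw.lintegral_eq [IsProbabilityMeasure μ] [Countable α] [MeasurableSpace α]
    [MeasurableSingletonClass α] {X : Ω → α} {p : Ω → PMF α}
    (h : HasCondLaw m μ X p) (hm : m ≤ mΩ) (hX : Measurable X)
    {f : Ω → α → ENNReal} (hf : ∀ s, Measurable[m] fun ω => f ω s) :
    ∫⁻ ω, f ω (X ω) ∂μ = ∫⁻ ω, ∑' s, p ω s * f ω s ∂μ := by
  have hf' : ∀ s, Measurable fun ω => f ω s := fun s => (hf s).mono hm le_rfl
  have hE : ∀ s, MeasurableSet (X ⁻¹' {s}) := fun s => hX (measurableSet_singleton s)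
  rw [lintegral_tsum (f := fun s ω => p ω s * f ω s)
    fun s => (h.aemeasurable hm s).mul (hf' s).aemeasurable]
  have e : ∀ ω, f ω (X ω) = ∑' s, (X ⁻¹' {s}).indicator (fun ω => f ω s) ω := by
    intro ω
    rw [tsum_eq_single (X ω)]
    · simp
    · intro s hs
      simp [Set.indicator, hs.symm]
  simp only [e]
  rw [lintegral_tsum fun s => ((hf' s).indicator (hE s)).aemeasurable]
  refine tsum_congr fun s => ?_
  rw [lintegral_indicator (hE s), h.lintegral_singleton hm hX s (hf s)]

/-! ### Exponential supermartingales along a discrete history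

Histories are described by relations `r` on the outcomes: `r ω ω'` says that `ω` and `ω'` show the
same observations so far. As the observations are discrete, every function that depends on the
history only is measurable. -/

/-- `f` depends only on what the relation `r` sees. -/
def Respects {Ω : Type*} {β : Sort*} (r : Ω → Ω → Prop) (f : Ω → β) : Prop := ∀ ω ω', r ω ω' → f ω = f ω'

/-- All functions that depend only on what `r` sees are measurable with respect to `m`. -/
def IsDiscreteHist {Ω : Type*} (m : MeasurableSpace Ω) (r : Ω → Ω → Prop) : Prop :=
  ∀ f : Ω → ENNReal, Respects r f → Measurable[m] f

theorem IsDiscreteHist.measurable_real {Ω : Type*} {m : MeasurableSpace Ω} {r : Ω → Ω → Prop}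
    (hr : IsDiscreteHist m r) {Z : Ω → ℝ} (hZ : Respects r Z) : Measurable[m] Z := by
  have h3 : Z = fun ω => (ENNReal.ofReal (Z ω)).toReal - (ENNReal.ofReal (-Z ω)).toReal := by
    funext ω
    rw [ENNReal.toReal_ofReal', ENNReal.toReal_ofReal']
    exact (max_zero_sub_max_neg_zero_eq_self (Z ω)).symm
  rw [h3]
  have h1 : Measurable[m] fun ω => ENNReal.ofReal (Z ω) := hr _ fun ω ω' h => by rw [hZ ω ω' h]
  have h2 : Measurable[m] fun ω => ENNReal.ofReal (-Z ω) := hr _ fun ω ω' h => by rw [hZ ω ω' h]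
  exact h1.ennreal_toReal.sub h2.ennreal_toReal

/-- Multiplying by `U` does not increase expectations of functions of the history `r`. -/
def IsSuperFactor (μ : Measure Ω) (r : Ω → Ω → Prop) (U : Ω → ENNReal) : Prop :=
  ∀ g : Ω → ENNReal, Respects r g → ∫⁻ ω, g ω * U ω ∂μ ≤ ∫⁻ ω, g ω ∂μ

theorem isSuperFactor_of_condLaw [IsProbabilityMeasure μ] [Countable α] [MeasurableSpace α]
    [MeasurableSingletonClass α] {X : Ω → α} {p : Ω → PMF α}
    (h : HasCondLaw m μ X p) (hm : m ≤ mΩ) (hX : Measurable X)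
    {r : Ω → Ω → Prop} (hr : IsDiscreteHist m r) {u : Ω → α → ENNReal} (hu : Respects r u)
    (hle : ∀ ω, ∑' s, p ω s * u ω s ≤ 1) : IsSuperFactor μ r fun ω => u ω (X ω) := by
  intro g hg
  have hmeas : ∀ s, Measurable[m] fun ω => g ω * u ω s := fun s =>
    hr _ fun ω ω' hω => by rw [hg ω ω' hω, hu ω ω' hω]
  rw [h.lintegral_eq hm hX hmeas]
  refine lintegral_mono fun ω => ?_
  calc ∑' s, p ω s * (g ω * u ω s) = g ω * ∑' s, p ω s * u ω s := by
        rw [← ENNReal.tsum_mul_left]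
        exact tsum_congr fun s => by ring
    _ ≤ g ω * 1 := by gcongr; exact hle ω
    _ = g ω := mul_one _

theorem IsSuperFactor.prod {r : ℕ → Ω → Ω → Prop} {U : ℕ → Ω → ENNReal} {n : ℕ}
    (hU : ∀ k < n, IsSuperFactor μ (r k) (U k))
    (hmono : ∀ k < n, ∀ ω ω', r k ω ω' → r 0 ω ω')
    (hresp : ∀ k < n, ∀ j < k, Respects (r k) (U j)) :
    IsSuperFactor μ (r 0) fun ω => ∏ k ∈ Finset.range n, U k ω := by
  intro g hg
  induction n with
  | zero => simp
  | succ n ih =>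
    simp only [Finset.prod_range_succ, ← mul_assoc]
    refine (hU n n.lt_succ_self (fun ω => g ω * ∏ k ∈ Finset.range n, U k ω)
      fun ω ω' h => ?_).trans (ih (fun k hk => hU k (by omega)) (fun k hk => hmono k (by omega))
        fun k hk => hresp k (by omega))
    have h1 : g ω = g ω' := hg ω ω' (hmono n n.lt_succ_self ω ω' h)
    have h2 : ∏ k ∈ Finset.range n, U k ω = ∏ k ∈ Finset.range n, U k ω' :=
      Finset.prod_congr rfl fun k hk => hresp n n.lt_succ_self k (Finset.mem_range.1 hk) ω ω' h
    show g ω * _ = g ω' * _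
    rw [h1, h2]

/-- Chernoff's bound. -/
theorem IsSuperFactor.measure_lt_le [IsProbabilityMeasure μ] {r : Ω → Ω → Prop} {Z : Ω → ℝ}
    (h : IsSuperFactor μ r fun ω => ENNReal.ofReal (Real.exp (Z ω))) (hZ : Measurable Z) (a : ℝ) :
    μ {ω | a < Z ω} ≤ ENNReal.ofReal (Real.exp (-a)) := by
  have h1 : ∫⁻ ω, ENNReal.ofReal (Real.exp (Z ω)) ∂μ ≤ 1 := by
    simpa using h (fun _ => 1) fun _ _ _ => rfl
  have h2 := meas_ge_le_lintegral_div (μ := μ)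
    (Real.measurable_exp.comp hZ).ennreal_ofReal.aemeasurable
    (ε := ENNReal.ofReal (Real.exp a)) (by simp [Real.exp_pos]) ENNReal.ofReal_ne_top
  calc μ {ω | a < Z ω} ≤ μ {ω | ENNReal.ofReal (Real.exp a) ≤ ENNReal.ofReal (Real.exp (Z ω))} :=
        measure_mono fun ω hω => ENNReal.ofReal_le_ofReal (Real.exp_le_exp.2 (le_of_lt hω))
    _ ≤ _ := h2
    _ ≤ 1 / ENNReal.ofReal (Real.exp a) := by gcongr; exact h1
    _ = ENNReal.ofReal (Real.exp (-a)) := by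
      rw [Real.exp_neg, ENNReal.ofReal_inv_of_pos (Real.exp_pos a), one_div]

/-! ### Exponential moments of bounded discrete variables -/

theorem tsum_mul_ofReal_eq (p : PMF α) {f : α → ℝ} {C : ℝ} (h0 : ∀ a, 0 ≤ f a)
    (hC : ∀ a, f a ≤ C) : ∑' s, p s * ENNReal.ofReal (f s) = ENNReal.ofReal (expect p f) := by
  have e : ∀ s, p s * ENNReal.ofReal (f s) = ENNReal.ofReal ((p s).toReal * f s) := fun s => by
    rw [ENNReal.ofReal_mul ENNReal.toReal_nonneg, ENNReal.ofReal_toReal (p.apply_ne_top s)]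
  simp only [e]
  rw [expect, ENNReal.ofReal_tsum_of_nonneg
    (fun s => mul_nonneg ENNReal.toReal_nonneg (h0 s))
    (summable_expect' (C := C) fun a => abs_le.2 ⟨by linarith [h0 a, hC a], hC a⟩)]

/-- Hoeffding's lemma for centred variables with values in `[-b, b]`. -/
theorem tsum_mul_exp_hoeffding_le (p : PMF α) {ξ : α → ℝ} {b κ : ℝ} (hb : 0 < b)
    (hξ : ∀ a, |ξ a| ≤ b) (h0 : expect p ξ = 0) :
    ∑' s, p s * ENNReal.ofReal (Real.exp (κ * ξ s - κ ^ 2 * b ^ 2 / 2)) ≤ 1 := by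
  have hconv : ∀ a, Real.exp (κ * ξ a) ≤ Real.cosh (κ * b) + Real.sinh (κ * b) / b * ξ a := by
    intro a
    have h1 := abs_le.1 (hξ a)
    have h := convexOn_exp.2 (Set.mem_univ (κ * b)) (Set.mem_univ (-(κ * b)))
      (show 0 ≤ (1 + ξ a / b) / 2 by
        have : -1 ≤ ξ a / b := by rw [le_div_iff₀ hb]; linarith
        linarith)
      (show 0 ≤ (1 - ξ a / b) / 2 by
        have : ξ a / b ≤ 1 := by rw [div_le_iff₀ hb]; linarith
        linarith) (by ring)
    have e : (1 + ξ a / b) / 2 * (κ * b) + (1 - ξ a / b) / 2 * -(κ * b) = κ * ξ a := by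
      field_simp
      ring
    simp only [smul_eq_mul] at h
    rw [e] at h
    refine h.trans_eq ?_
    rw [Real.cosh_eq, Real.sinh_eq]
    field_simp
    ring
  have hbd : ∀ a, Real.exp (κ * ξ a - κ ^ 2 * b ^ 2 / 2) ≤ Real.exp (|κ| * b) := by
    intro a
    apply Real.exp_le_exp.2
    have h1 : κ * ξ a ≤ |κ| * b := by
      calc κ * ξ a ≤ |κ * ξ a| := le_abs_self _
        _ = |κ| * |ξ a| := abs_mul _ _
        _ ≤ |κ| * b := by gcongr; exact hξ a
    nlinarith [mul_nonneg (sq_nonneg κ) (sq_nonneg b)]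
  rw [tsum_mul_ofReal_eq p (fun a => (Real.exp_pos _).le) hbd]
  rw [← ENNReal.ofReal_one]
  apply ENNReal.ofReal_le_ofReal
  have h1 : expect p (fun a => Real.exp (κ * ξ a - κ ^ 2 * b ^ 2 / 2))
      ≤ expect p (fun a => Real.exp (-(κ ^ 2 * b ^ 2 / 2)) *
        (Real.cosh (κ * b) + Real.sinh (κ * b) / b * ξ a)) := by
    refine expect_mono (C := Real.exp (|κ| * b)) (D := |Real.exp (-(κ ^ 2 * b ^ 2 / 2))| *
      (|Real.cosh (κ * b)| + |Real.sinh (κ * b) / b| * b)) (fun a _ => ?_) (fun a _ => ?_)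
      fun a _ => ?_
    · rw [abs_of_pos (Real.exp_pos _)]; exact hbd a
    · rw [abs_mul]
      gcongr
      refine (abs_add_le _ _).trans ?_
      rw [abs_mul]
      gcongr
      exact hξ a
    · rw [sub_eq_neg_add, Real.exp_add]
      gcongr
      exact hconv a
  have h2 : expect p (fun a => Real.cosh (κ * b) + Real.sinh (κ * b) / b * ξ a)
      = Real.cosh (κ * b) := by
    rw [expect_add (D := |Real.sinh (κ * b) / b| * b) (fun _ _ => le_rfl)
      (fun a _ => by rw [abs_mul]; gcongr; exact hξ a), expect_mul_left, expect_const, h0]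
    ring
  rw [expect_mul_left, h2] at h1
  refine h1.trans ?_
  have h3 := Real.cosh_le_exp_half_sq (κ * b)
  calc _ ≤ Real.exp (-(κ ^ 2 * b ^ 2 / 2)) * Real.exp ((κ * b) ^ 2 / 2) := by gcongr
    _ = 1 := by rw [← Real.exp_add, ← Real.exp_zero]; congr 1; ring

/-- One step of the exponential moment of the self-normalized sum: `e` is the noise, `γ` the linear
coefficient and `v` the leverage. -/
theorem tsum_mul_exp_bernstein_le (p : PMF α) {e : α → ℝ} {M σ γ v c κ : ℝ} (hM : 0 < M)
    (he : ∀ a, |e a| ≤ M) (h0 : expect p e = 0) (h2 : expect p (fun a => e a ^ 2) ≤ σ ^ 2)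
    (hγ : |γ| ≤ 1 / 2) (hγv : γ ^ 2 ≤ v) (hv : v ≤ 1) (hc : M ≤ c) (hκ : 0 < κ)
    (hκM : κ * M ≤ 1) :
    ∑' s, p s * ENNReal.ofReal (Real.exp (κ * (e s * γ + e s ^ 2 * (v / (2 * c)))
      - (κ * σ ^ 2 / (2 * c) + 9 / 4 * κ ^ 2 * σ ^ 2) * v)) ≤ 1 := by
  have hc0 : 0 < c := hM.trans_le hc
  have hv0 : 0 ≤ v := (sq_nonneg γ).trans hγv
  have hsq : ∀ a, |e a ^ 2| ≤ M ^ 2 := fun a => by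
    rw [abs_pow]; exact pow_le_pow_left₀ (abs_nonneg _) (he a) 2
  have hX : ∀ a, |e a * γ + e a ^ 2 * (v / (2 * c))| ≤ M := by
    intro a
    have h1 : |e a * γ| ≤ M * (1 / 2) := by
      rw [abs_mul]; exact mul_le_mul (he a) hγ (abs_nonneg _) hM.le
    have h3 : |e a ^ 2 * (v / (2 * c))| ≤ M * (1 / 2) := by
      rw [abs_mul, abs_of_nonneg (by positivity : 0 ≤ v / (2 * c))]
      calc |e a ^ 2| * (v / (2 * c)) ≤ M ^ 2 * (1 / (2 * M)) := by
            gcongr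
            exact hsq a
        _ = M * (1 / 2) := by field_simp
    linarith [abs_add_le (e a * γ) (e a ^ 2 * (v / (2 * c)))]
  have hκX : ∀ a, |κ * (e a * γ + e a ^ 2 * (v / (2 * c)))| ≤ 1 := by
    intro a
    rw [abs_mul, abs_of_pos hκ]
    exact (mul_le_mul_of_nonneg_left (hX a) hκ.le).trans hκM
  have hXsq : ∀ a, (e a * γ + e a ^ 2 * (v / (2 * c))) ^ 2 ≤ 9 / 4 * v * e a ^ 2 := by
    intro a
    have h1 : |e a * (v / (2 * c))| ≤ v / 2 := by
      rw [abs_mul, abs_of_nonneg (by positivity : 0 ≤ v / (2 * c))]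
      calc |e a| * (v / (2 * c)) ≤ c * (v / (2 * c)) := by
            gcongr
            exact (he a).trans hc
        _ = v / 2 := by field_simp
    have h3 : (e a * (v / (2 * c))) ^ 2 ≤ (v / 2) ^ 2 := by
      rw [← sq_abs]
      exact pow_le_pow_left₀ (abs_nonneg _) h1 2
    have h4 : (γ + e a * (v / (2 * c))) ^ 2 ≤ 9 / 4 * v := by
      nlinarith [sq_nonneg (γ - 2 * (e a * (v / (2 * c))))]
    calc _ = (γ + e a * (v / (2 * c))) ^ 2 * e a ^ 2 := by ring
      _ ≤ _ := by gcongr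
  set A := κ * σ ^ 2 / (2 * c) + 9 / 4 * κ ^ 2 * σ ^ 2
  have hA0 : 0 ≤ A := by positivity
  have hpt : ∀ a, Real.exp (κ * (e a * γ + e a ^ 2 * (v / (2 * c)))) ≤
      1 + (κ * γ * e a + (κ * v / (2 * c) + 9 / 4 * κ ^ 2 * v) * e a ^ 2) := by
    intro a
    have h1 := (abs_le.1 (Real.abs_exp_sub_one_sub_id_le (hκX a))).2
    have h3 : (κ * (e a * γ + e a ^ 2 * (v / (2 * c)))) ^ 2 ≤ κ ^ 2 * (9 / 4 * v * e a ^ 2) := by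
      rw [mul_pow]
      gcongr
      exact hXsq a
    have h4 : κ * (e a * γ + e a ^ 2 * (v / (2 * c))) = κ * γ * e a + κ * v / (2 * c) * e a ^ 2 := by
      ring
    nlinarith
  have hbd : ∀ a, Real.exp (κ * (e a * γ + e a ^ 2 * (v / (2 * c))) - A * v) ≤ Real.exp 1 := by
    intro a
    apply Real.exp_le_exp.2
    have := (abs_le.1 (hκX a)).2
    nlinarith [mul_nonneg hA0 hv0]
  rw [tsum_mul_ofReal_eq p (fun a => (Real.exp_pos _).le) hbd, ← ENNReal.ofReal_one]
  apply ENNReal.ofReal_le_ofReal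
  have b1 : ∀ a ∈ p.support, |κ * γ * e a| ≤ |κ * γ| * M := fun a _ => by
    rw [abs_mul]; gcongr; exact he a
  have b2 : ∀ a ∈ p.support, |(κ * v / (2 * c) + 9 / 4 * κ ^ 2 * v) * e a ^ 2|
      ≤ |κ * v / (2 * c) + 9 / 4 * κ ^ 2 * v| * M ^ 2 := fun a _ => by
    rw [abs_mul]; gcongr; exact hsq a
  have b3 := fun a ha => (abs_add_le _ _).trans (add_le_add (b1 a ha) (b2 a ha))
  have b4 : ∀ a ∈ p.support,
      |1 + (κ * γ * e a + (κ * v / (2 * c) + 9 / 4 * κ ^ 2 * v) * e a ^ 2)| ≤ _ :=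
    fun a ha => (abs_add_le _ _).trans (add_le_add le_rfl (b3 a ha))
  have e1 : expect p (fun a => 1 + (κ * γ * e a + (κ * v / (2 * c) + 9 / 4 * κ ^ 2 * v) * e a ^ 2))
      ≤ 1 + A * v := by
    rw [expect_add (fun _ _ => le_rfl) b3, expect_add b1 b2, expect_mul_left, expect_mul_left,
      expect_const, h0]
    have : (κ * v / (2 * c) + 9 / 4 * κ ^ 2 * v) * expect p (fun a => e a ^ 2)
        ≤ (κ * v / (2 * c) + 9 / 4 * κ ^ 2 * v) * σ ^ 2 := by gcongr
    have e2 : (κ * v / (2 * c) + 9 / 4 * κ ^ 2 * v) * σ ^ 2 = A * v := by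
      simp only [A]; ring
    linarith
  have e2 : expect p (fun a => Real.exp (κ * (e a * γ + e a ^ 2 * (v / (2 * c))) - A * v))
      ≤ expect p (fun a => Real.exp (-(A * v)) *
        (1 + (κ * γ * e a + (κ * v / (2 * c) + 9 / 4 * κ ^ 2 * v) * e a ^ 2))) := by
    refine expect_mono (C := Real.exp 1) (fun a _ => ?_)
      (fun a ha => (abs_mul _ _).trans_le (mul_le_mul_of_nonneg_left (b4 a ha) (abs_nonneg _)))
      fun a _ => ?_
    · rw [abs_of_pos (Real.exp_pos _)]; exact hbd a
    · rw [sub_eq_neg_add, Real.exp_add]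
      gcongr
      exact hpt a
  rw [expect_mul_left] at e2
  refine e2.trans ?_
  calc _ ≤ Real.exp (-(A * v)) * (1 + A * v) := by gcongr
    _ ≤ Real.exp (-(A * v)) * Real.exp (A * v) := by
      gcongr
      linarith [Real.add_one_le_exp (A * v)]
    _ = 1 := by rw [← Real.exp_add]; simp

end Probability

/-! ### Concentration inequalities -/

section Concentration

variable {Ω α : Type*} [mΩ : MeasurableSpace Ω] {μ : Measure Ω} [IsProbabilityMeasure μ]
  [Countable α] [MeasurableSpace α] [MeasurableSingletonClass α]

/-- The Azuma–Hoeffding inequality for `T` episodes of `n` steps, traversed in lexicographic order. -/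
theorem measure_azuma_le {r : ℕ → ℕ → Ω → Ω → Prop} {m : ℕ → ℕ → MeasurableSpace Ω}
    {X : ℕ → ℕ → Ω → α} {p : ℕ → ℕ → Ω → PMF α} {ξ : ℕ → ℕ → Ω → α → ℝ} {T n : ℕ} {b L : ℝ}
    (hT : 0 < T) (hn : 0 < n) (hb : 0 < b) (hL : 0 < L)
    (hm : ∀ t < T, ∀ h < n, m t h ≤ mΩ)
    (hr : ∀ t < T, ∀ h < n, IsDiscreteHist (m t h) (r t h))
    (hX : ∀ t h, Measurable (X t h))
    (hp : ∀ t < T, ∀ h < n, HasCondLaw (m t h) μ (X t h) (p t h))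
    (hξ : ∀ t < T, ∀ h < n, ∀ ω s, |ξ t h ω s| ≤ b)
    (h0 : ∀ t < T, ∀ h < n, ∀ ω, expect (p t h ω) (ξ t h ω) = 0)
    (hmono : ∀ t < T, ∀ h < n, ∀ t' h', (t' < t ∨ t' = t ∧ h' ≤ h) → h' < n →
      ∀ ω ω', r t h ω ω' → r t' h' ω ω')
    (hrξ : ∀ t < T, ∀ h < n, Respects (r t h) (ξ t h))
    (hrX : ∀ t < T, ∀ h < n, ∀ t' h', (t' < t ∨ t' = t ∧ h' < h) → h' < n →
      Respects (r t h) (X t' h'))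
    (hmeas : Measurable fun ω => ∑ t ∈ Finset.range T, ∑ h ∈ Finset.range n, ξ t h ω (X t h ω)) :
    μ {ω | b * √(6 * (T * n) * L)
        < ∑ t ∈ Finset.range T, ∑ h ∈ Finset.range n, ξ t h ω (X t h ω)}
      ≤ ENNReal.ofReal (Real.exp (-(3 * L))) := by
  have hN : (0 : ℝ) < T * n := by positivity
  set κ := √(6 * L / (T * n)) / b with hκ
  have hκ0 : 0 < κ := by positivity
  let U : ℕ → ℕ → Ω → ENNReal := fun t h ω =>
    ENNReal.ofReal (Real.exp (κ * ξ t h ω (X t h ω) - κ ^ 2 * b ^ 2 / 2))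
  have hUresp : ∀ t < T, ∀ h < n, ∀ t' h', (t' < t ∨ t' = t ∧ h' < h) → h' < n →
      Respects (r t h) (U t' h') := by
    intro t ht h hh t' h' hlt hh' ω ω' hω
    have h1 : X t' h' ω = X t' h' ω' := hrX t ht h hh t' h' hlt hh' ω ω' hω
    have h2 : ξ t' h' ω = ξ t' h' ω' := hrξ t' (by omega) h' hh' ω ω'
      (hmono t ht h hh t' h' (by omega) hh' ω ω' hω)
    simp only [U, h1, h2]
  have hU : ∀ t < T, ∀ h < n, IsSuperFactor μ (r t h) (U t h) := by
    intro t ht h hh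
    refine isSuperFactor_of_condLaw (hp t ht h hh) (hm t ht h hh) (hX t h) (hr t ht h hh)
      (u := fun ω s => ENNReal.ofReal (Real.exp (κ * ξ t h ω s - κ ^ 2 * b ^ 2 / 2))) ?_ ?_
    · intro ω ω' hω
      have h2 : ξ t h ω = ξ t h ω' := hrξ t ht h hh ω ω' hω
      simp only [h2]
    · exact fun ω => tsum_mul_exp_hoeffding_le _ hb (hξ t ht h hh ω) (h0 t ht h hh ω)
  have hV : ∀ t < T, IsSuperFactor μ (r t 0) fun ω => ∏ h ∈ Finset.range n, U t h ω := by
    intro t ht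
    exact IsSuperFactor.prod (fun k hk => hU t ht k hk)
      (fun k hk ω ω' => hmono t ht k hk t 0 (by omega) hn ω ω')
      fun k hk j hj => hUresp t ht k hk t j (by omega) (by omega)
  have hW := IsSuperFactor.prod (r := fun t => r t 0) hV
    (fun k hk ω ω' => hmono k hk 0 hn 0 0 (by omega) hn ω ω')
    (fun k hk j hj ω ω' hω => Finset.prod_congr rfl fun h hh =>
      hUresp k hk 0 hn j h (by omega) (Finset.mem_range.1 hh) ω ω' hω)
  set Z : Ω → ℝ := fun ω => ∑ t ∈ Finset.range T, ∑ h ∈ Finset.range n, ξ t h ω (X t h ω) with hZ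
  have e : (fun ω => ∏ t ∈ Finset.range T, ∏ h ∈ Finset.range n, U t h ω)
      = fun ω => ENNReal.ofReal (Real.exp (κ * Z ω - T * n * (κ ^ 2 * b ^ 2 / 2))) := by
    funext ω
    simp only [U]
    have h1 : κ * Z ω - T * n * (κ ^ 2 * b ^ 2 / 2) = ∑ t ∈ Finset.range T, ∑ h ∈ Finset.range n,
        (κ * ξ t h ω (X t h ω) - κ ^ 2 * b ^ 2 / 2) := by
      simp only [Z, Finset.mul_sum, Finset.sum_sub_distrib, Finset.sum_const, Finset.card_range,
        nsmul_eq_mul]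
      ring
    rw [h1, Real.exp_sum, ENNReal.ofReal_prod_of_nonneg]
    · refine Finset.prod_congr rfl fun t _ => ?_
      rw [Real.exp_sum, ENNReal.ofReal_prod_of_nonneg]
      exact fun _ _ => (Real.exp_pos _).le
    · exact fun _ _ => (Real.exp_pos _).le
  rw [e] at hW
  refine le_trans (measure_mono fun ω hω => ?_)
    (hW.measure_lt_le ((hmeas.const_mul κ).sub_const _) (3 * L))
  simp only [Set.mem_ofPred_eq] at hω ⊢
  -- the choice of `κ` balances the two terms of the exponent
  have h1 : κ ^ 2 * b ^ 2 = 6 * L / (T * n) := by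
    rw [hκ, div_pow, Real.sq_sqrt (by positivity)]
    field_simp
  have h2 : κ * (b * √(6 * (T * n) * L)) = 6 * L := by
    rw [hκ]
    calc _ = √(6 * L / (T * n)) * √(6 * (T * n) * L) := by field_simp
      _ = √((6 * L) ^ 2) := by
        rw [← Real.sqrt_mul (by positivity)]
        congr 1
        field_simp
      _ = 6 * L := Real.sqrt_sq (by positivity)
  have h3 : T * n * (κ ^ 2 * b ^ 2 / 2) = 3 * L := by
    rw [h1]; field_simp; ring
  have h4 := mul_lt_mul_of_pos_left hω hκ0
  rw [h3]
  linarith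

variable {F : Type*} [NormedAddCommGroup F] [InnerProductSpace ℝ F]

/-- The numerical choice of the centre `c = max M s` and of the exponent `1 / q`, where
`q = max M (s / √L)`, in the Bernstein inequality below. -/
theorem bernstein_tuning {M s σ Γ L : ℝ} (hM : 0 < M) (hs0 : 0 < s) (hs2 : s ^ 2 = σ ^ 2 * Γ)
    (hL : 1 ≤ L) :
    max M s + max M (s / √L) * (3 * L + ((max M (s / √L))⁻¹ * σ ^ 2 / (2 * max M s)
      + 9 / 4 * (max M (s / √L))⁻¹ ^ 2 * σ ^ 2) * (2 * Γ)) ≤ 16 * (√L * s) + 4 * M * L := by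
  have hc0 : 0 < max M s := lt_max_of_lt_left hM
  have hq0 : 0 < max M (s / √L) := lt_max_of_lt_left hM
  have hcs : s ≤ max M s := le_max_right _ _
  have hqs : s / √L ≤ max M (s / √L) := le_max_right _ _
  have hqle : max M (s / √L) ≤ M + s / √L :=
    max_le (by linarith [div_nonneg hs0.le (Real.sqrt_nonneg L)]) (by linarith)
  have hcle : max M s ≤ M + s := max_le (by linarith) (by linarith)
  generalize max M s = c at *
  generalize max M (s / √L) = q at *
  have hLs : 1 ≤ √L := Real.one_le_sqrt.2 hL
  have hLsq : √L ^ 2 = L := Real.sq_sqrt (by linarith)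
  have e1 : q * (3 * L + (q⁻¹ * σ ^ 2 / (2 * c) + 9 / 4 * q⁻¹ ^ 2 * σ ^ 2) * (2 * Γ))
      = q * (3 * L) + s * (s / c) + 9 / 2 * ((s / q) * s) := by
    field_simp
    linear_combination -(4 * (2 * q + 9 * c)) * hs2
  have e2 : s * (s / c) ≤ s * 1 := by
    gcongr
    exact div_le_one_of_le₀ hcs hc0.le
  have e3 : s / q * s ≤ √L * s := by
    gcongr
    rwa [div_le_iff₀ hq0, mul_comm, ← div_le_iff₀ (by positivity)]
  have e4 : q * (3 * L) ≤ 3 * L * M + 3 * (√L * s) := by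
    calc q * (3 * L) ≤ (M + s / √L) * (3 * √L ^ 2) := by rw [hLsq]; gcongr
      _ = 3 * √L ^ 2 * M + 3 * (√L * s) := by field_simp
      _ = _ := by rw [hLsq]
  have e5 : s ≤ √L * s := le_mul_of_one_le_left hs0.le hLs
  have e6 : M ≤ L * M := le_mul_of_one_le_left hM.le hL
  rw [e1]
  linarith

/-- A Bernstein inequality for self-normalized sums in a Hilbert space: with probability at least
`1 - exp (-3 L)`, the noise `∑ η_k ψ_k` has norm at most `16 σ √Γ √L + 4 M L` in the geometry of the
inverse covariance, where `M` bounds the noise, `σ²` its conditional variances, and `2 Γ` the sum of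
the leverages. The increments of `√(c² + ‖∑ η_k ψ_k‖²)` are at most `η γ + η² v / (2 c)` with
predictable `γ`, `v` such that `γ² ≤ v`, so that this process, compensated by a multiple of the sum
of the leverages `v`, has an exponential supermartingale. -/
theorem measure_selfNormalized_le {r : ℕ → Ω → Ω → Prop} {m : ℕ → MeasurableSpace Ω}
    {X : ℕ → Ω → α} {p : ℕ → Ω → PMF α} {e : ℕ → Ω → α → ℝ} {ψ : ℕ → Ω → F} {n : ℕ}
    {lam M σ Γ L : ℝ} (hlam : 0 < lam) (hM : 0 < M) (hσ : 0 < σ) (hΓ : 0 < Γ) (hL : 1 ≤ L)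
    (hm : ∀ k ≤ n, m k ≤ mΩ)
    (hr : ∀ k ≤ n, IsDiscreteHist (m k) (r k))
    (hX : ∀ k < n, Measurable (X k))
    (hp : ∀ k < n, HasCondLaw (m k) μ (X k) (p k))
    (he : ∀ k < n, ∀ ω s, |e k ω s| ≤ M)
    (h0 : ∀ k < n, ∀ ω, expect (p k ω) (e k ω) = 0)
    (h2 : ∀ k < n, ∀ ω, expect (p k ω) (fun s => e k ω s ^ 2) ≤ σ ^ 2)
    (hmono : ∀ k ≤ n, ∀ j ≤ k, ∀ ω ω', r k ω ω' → r j ω ω')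
    (hre : ∀ k ≤ n, Respects (r k) (e k)) (hrψ : ∀ k ≤ n, Respects (r k) (ψ k))
    (hrX : ∀ k ≤ n, ∀ j < k, Respects (r k) (X j))
    (hpot : ∀ ω, ∑ k ∈ Finset.range n, leverage lam (fun i => ψ i ω) k ≤ 2 * Γ) :
    μ {ω | 16 * σ * √Γ * √L + 4 * M * L < √(covSq lam (fun i => ψ i ω) n
        (∑ k ∈ Finset.range n, e k ω (X k ω) • ψ k ω))}
      ≤ ENNReal.ofReal (Real.exp (-(3 * L))) := by
  set s := σ * √Γ with hs
  have hs0 : 0 < s := by positivity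
  set c := max M s with hc
  have hc0 : 0 < c := lt_max_of_lt_left hM
  set q := max M (s / √L) with hq
  have hq0 : 0 < q := lt_max_of_lt_left hM
  set κ := q⁻¹ with hκ
  have hκ0 : 0 < κ := inv_pos.2 hq0
  have hκM : κ * M ≤ 1 := by
    rw [hκ, inv_mul_le_iff₀ hq0, mul_one]; exact le_max_left _ _
  set A := κ * σ ^ 2 / (2 * c) + 9 / 4 * κ ^ 2 * σ ^ 2 with hA
  let b : ℕ → Ω → F := fun k ω => ∑ j ∈ Finset.range k, e j ω (X j ω) • ψ j ω
  let Y : ℕ → Ω → ℝ := fun k ω => covSq lam (fun i => ψ i ω) k (b k ω)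
  let N : ℕ → Ω → ℝ := fun k ω => √(c ^ 2 + Y k ω)
  let w : ℕ → Ω → ℝ := fun k ω => covSq lam (fun i => ψ i ω) k (ψ k ω)
  let g : ℕ → Ω → ℝ := fun k ω =>
    ⟪ψ k ω, covInv lam (fun i => ψ i ω) k (b k ω)⟫_ℝ / (1 + w k ω)
  let γ : ℕ → Ω → ℝ := fun k ω => g k ω / N k ω
  let v : ℕ → Ω → ℝ := fun k ω => leverage lam (fun i => ψ i ω) k
  have hY0 : ∀ k ω, 0 ≤ Y k ω := fun k ω => covSq_nonneg _ hlam _ _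
  have hw0 : ∀ k ω, 0 ≤ w k ω := fun k ω => covSq_nonneg _ hlam _ _
  have hN2 : ∀ k ω, N k ω ^ 2 = c ^ 2 + Y k ω := fun k ω =>
    Real.sq_sqrt (add_nonneg (sq_nonneg c) (hY0 k ω))
  have hNc : ∀ k ω, c ≤ N k ω := fun k ω => by
    rw [← Real.sqrt_sq hc0.le]
    exact Real.sqrt_le_sqrt (by linarith [hY0 k ω, Real.sqrt_sq hc0.le, sq_nonneg c])
  have hN0 : ∀ k ω, 0 < N k ω := fun k ω => hc0.trans_le (hNc k ω)
  have hYN : ∀ k ω, √(Y k ω) ≤ N k ω := fun k ω =>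
    Real.sqrt_le_sqrt (by linarith [sq_nonneg c])
  have hg : ∀ k ω, |g k ω| ≤ √(w k ω) / (1 + w k ω) * N k ω := by
    intro k ω
    have h1 := abs_inner_covInv_le (fun i => ψ i ω) hlam k (ψ k ω) (b k ω)
    have hw1 : 0 < 1 + w k ω := by linarith [hw0 k ω]
    rw [abs_div, abs_of_pos hw1, div_mul_eq_mul_div]
    gcongr
    exact h1.trans (mul_le_mul_of_nonneg_left (hYN k ω) (Real.sqrt_nonneg _))
  have hγ : ∀ k ω, |γ k ω| ≤ √(w k ω) / (1 + w k ω) := by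
    intro k ω
    rw [abs_div, abs_of_pos (hN0 k ω), div_le_iff₀ (hN0 k ω)]
    exact hg k ω
  have hγ1 : ∀ k ω, |γ k ω| ≤ 1 / 2 := by
    intro k ω
    refine (hγ k ω).trans ?_
    rw [div_le_iff₀ (by linarith [hw0 k ω])]
    nlinarith [sq_nonneg (√(w k ω) - 1), Real.sq_sqrt (hw0 k ω)]
  have hγ2 : ∀ k ω, γ k ω ^ 2 ≤ v k ω := by
    intro k ω
    have hw1 : 0 < 1 + w k ω := by linarith [hw0 k ω]
    rw [← sq_abs]
    refine (pow_le_pow_left₀ (abs_nonneg _) (hγ k ω) 2).trans ?_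
    rw [div_pow, Real.sq_sqrt (hw0 k ω)]
    change w k ω / (1 + w k ω) ^ 2 ≤ w k ω / (1 + w k ω)
    refine div_le_div_of_nonneg_left (hw0 k ω) hw1 ?_
    nlinarith [hw0 k ω]
  -- the history determines all the coefficients
  have hψr : ∀ k ≤ n, ∀ ω ω', r k ω ω' → ∀ j ≤ k, ψ j ω = ψ j ω' := fun k hk ω ω' h j hj =>
    hrψ j (hj.trans hk) ω ω' (hmono k hk j hj ω ω' h)
  have hcov : ∀ {f f' : ℕ → F} (k : ℕ), (∀ j < k, f j = f' j) → covInv lam f k = covInv lam f' k := by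
    intro f f' k
    induction k with
    | zero => intro _; rfl
    | succ k ih =>
      intro hj
      simp only [covInv, ih fun j hjk => hj j (by omega), hj k (by omega)]
  have hbr : ∀ k ≤ n, Respects (r k) (b k) := by
    intro k hk ω ω' h
    refine Finset.sum_congr rfl fun j hj => ?_
    have hj := Finset.mem_range.1 hj
    rw [hψr k hk ω ω' h j hj.le, hrX k hk j hj ω ω' h,
      hre j (hj.le.trans hk) ω ω' (hmono k hk j hj.le ω ω' h)]
  have hcr : ∀ k ≤ n, ∀ ω ω', r k ω ω' →
      covInv lam (fun i => ψ i ω) k = covInv lam (fun i => ψ i ω') k := fun k hk ω ω' h =>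
    hcov k fun j hj => hψr k hk ω ω' h j hj.le
  have hYr : ∀ k ≤ n, Respects (r k) (Y k) := fun k hk ω ω' h => by
    simp only [Y, covSq, hcr k hk ω ω' h, hbr k hk ω ω' h]
  have hwr : ∀ k ≤ n, Respects (r k) (w k) := fun k hk ω ω' h => by
    simp only [w, covSq, hcr k hk ω ω' h, hψr k hk ω ω' h k le_rfl]
  have hγr : ∀ k ≤ n, Respects (r k) (γ k) := fun k hk ω ω' h => by
    simp only [γ, g, N, hYr k hk ω ω' h, hwr k hk ω ω' h, hcr k hk ω ω' h, hbr k hk ω ω' h,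
      hψr k hk ω ω' h k le_rfl]
  have hvr : ∀ k ≤ n, Respects (r k) (v k) := fun k hk ω ω' h => by
    have := hwr k hk ω ω' h
    change w k ω / (1 + w k ω) = w k ω' / (1 + w k ω')
    rw [this]
  let x : ℕ → Ω → α → ℝ := fun k ω s =>
    κ * (e k ω s * γ k ω + e k ω s ^ 2 * (v k ω / (2 * c))) - A * v k ω
  have hxr : ∀ k ≤ n, Respects (r k) (x k) := fun k hk ω ω' h => by
    simp only [x, hre k hk ω ω' h, hγr k hk ω ω' h, hvr k hk ω ω' h]
  have hU : ∀ k < n, IsSuperFactor μ (r k) fun ω => ENNReal.ofReal (Real.exp (x k ω (X k ω))) := by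
    intro k hk
    refine isSuperFactor_of_condLaw (hp k hk) (hm k hk.le) (hX k hk) (hr k hk.le)
      (u := fun ω s => ENNReal.ofReal (Real.exp (x k ω s))) ?_ ?_
    · intro ω ω' hω
      simp only [hxr k hk.le ω ω' hω]
    · exact fun ω => tsum_mul_exp_bernstein_le _ hM (he k hk ω) (h0 k hk ω) (h2 k hk ω)
        (hγ1 k ω) (hγ2 k ω) (leverage_le_one _ hlam k) (le_max_left _ _) hκ0 hκM
  have hxX : ∀ k ≤ n, ∀ j < k, Respects (r k) fun ω => x j ω (X j ω) := by
    intro k hk j hj ω ω' h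
    show x j ω (X j ω) = x j ω' (X j ω')
    rw [hrX k hk j hj ω ω' h, hxr j (hj.le.trans hk) ω ω' (hmono k hk j hj.le ω ω' h)]
  have hW := IsSuperFactor.prod hU (fun k hk => hmono k hk.le 0 (Nat.zero_le k))
    (fun k hk j hj ω ω' h => by
      have := hxX k hk.le j hj ω ω' h
      simp only at this
      rw [this])
  set Z : Ω → ℝ := fun ω => ∑ k ∈ Finset.range n, x k ω (X k ω) with hZ
  have hprod : (fun ω => ∏ k ∈ Finset.range n, ENNReal.ofReal (Real.exp (x k ω (X k ω))))
      = fun ω => ENNReal.ofReal (Real.exp (Z ω)) := by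
    funext ω
    rw [Real.exp_sum, ENNReal.ofReal_prod_of_nonneg]
    exact fun _ _ => (Real.exp_pos _).le
  rw [hprod] at hW
  have hZr : Respects (r n) Z := fun ω ω' h =>
    Finset.sum_congr rfl fun k hk => hxX n le_rfl k (Finset.mem_range.1 hk) ω ω' h
  have hZm : Measurable Z := ((hr n le_rfl).measurable_real hZr).mono (hm n le_rfl) le_rfl
  refine le_trans (measure_mono fun ω hω => ?_) (hW.measure_lt_le hZm (3 * L))
  simp only [Set.mem_ofPred_eq] at hω ⊢
  -- the recursion for `N`
  have hstep : ∀ k, N (k + 1) ω ≤ N k ω +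
      (e k ω (X k ω) * γ k ω + e k ω (X k ω) ^ 2 * (v k ω / (2 * c))) := by
    intro k
    have hv0 : 0 ≤ v k ω := leverage_nonneg _ hlam k
    have h1 : Y (k + 1) ω ≤ Y k ω + 2 * e k ω (X k ω) * g k ω + e k ω (X k ω) ^ 2 * v k ω := by
      have := covSq_succ_add (fun i => ψ i ω) hlam k (b k ω) (e k ω (X k ω))
      have hb : b (k + 1) ω = b k ω + e k ω (X k ω) • ψ k ω := Finset.sum_range_succ _ _
      simp only [Y, hb]
      exact this
    have hNk := hN0 k ω
    set η := e k ω (X k ω)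
    set z := η * γ k ω + η ^ 2 * (v k ω / (2 * N k ω)) with hz
    have h3 : 2 * N k ω * z = 2 * η * g k ω + η ^ 2 * v k ω := by
      simp only [hz, γ]
      field_simp
    have h4 : c ^ 2 + Y (k + 1) ω ≤ N k ω ^ 2 + 2 * N k ω * z := by
      rw [hN2, h3]; linarith
    have h5 : 0 ≤ N k ω + z := by
      have : 0 ≤ N k ω * (N k ω + 2 * z) := by
        have := hY0 (k + 1) ω
        nlinarith [sq_nonneg c]
      have := nonneg_of_mul_nonneg_right this hNk
      linarith
    have h6 : N (k + 1) ω ≤ N k ω + z := by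
      refine Real.sqrt_le_iff.2 ⟨h5, h4.trans ?_⟩
      nlinarith [sq_nonneg z]
    have h7 : η ^ 2 * (v k ω / (2 * N k ω)) ≤ η ^ 2 * (v k ω / (2 * c)) := by
      have := hNc k ω
      gcongr
    linarith
  have htel : ∀ k, N k ω ≤ c + ∑ j ∈ Finset.range k,
      (e j ω (X j ω) * γ j ω + e j ω (X j ω) ^ 2 * (v j ω / (2 * c))) := by
    intro k
    induction k with
    | zero =>
      have : N 0 ω = c := by simp [N, Y, b, covSq, Real.sqrt_sq hc0.le]
      simp [this]
    | succ k ih =>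
      rw [Finset.sum_range_succ]
      linarith [hstep k]
  have hZω : Z ω = κ * (∑ j ∈ Finset.range n,
      (e j ω (X j ω) * γ j ω + e j ω (X j ω) ^ 2 * (v j ω / (2 * c))))
        - A * ∑ j ∈ Finset.range n, v j ω := by
    simp only [hZ, x, Finset.sum_sub_distrib, Finset.mul_sum]
  have hA0 : 0 ≤ A := by positivity
  have h8 : A * ∑ j ∈ Finset.range n, v j ω ≤ A * (2 * Γ) :=
    mul_le_mul_of_nonneg_left (hpot ω) hA0
  have h9 := bernstein_tuning hM hs0 (hs2 := by rw [hs, mul_pow, Real.sq_sqrt hΓ.le]) hL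
    (σ := σ) (Γ := Γ)
  by_contra! hcon
  have h12 : κ * (∑ j ∈ Finset.range n,
      (e j ω (X j ω) * γ j ω + e j ω (X j ω) ^ 2 * (v j ω / (2 * c)))) ≤ 3 * L + A * (2 * Γ) := by
    linarith
  have h13 : (∑ j ∈ Finset.range n,
      (e j ω (X j ω) * γ j ω + e j ω (X j ω) ^ 2 * (v j ω / (2 * c)))) ≤ q * (3 * L + A * (2 * Γ)) := by
    rwa [hκ, inv_mul_le_iff₀ hq0] at h12
  have h14 := (hYN n ω).trans (htel n)
  have h15 : 16 * σ * √Γ * √L = 16 * (√L * s) := by rw [hs]; ring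
  rw [h15] at hω
  change c + q * (3 * L + A * (2 * Γ)) ≤ _ at h9
  change _ < √(Y n ω) at hω
  linarith

end Concentration

/-! ### Features and the effective dimension -/

section Features

variable {S A F : Type*} [NormedAddCommGroup F] [InnerProductSpace ℝ F] {H : ℕ}
  (G : Game S A F H)

theorem Game.feat_smul (c : ℝ) (V : S → ℝ) (z : S × A × A) :
    G.feat (fun s => c * V s) z = c • G.feat V z := by
  simp only [Game.feat, mul_smul]
  exact tsum_const_smul'' c

theorem Game.summable_feat {V : S → ℝ} {C : ℝ} (hC : 0 < C) (hV : ∀ s, |V s| ≤ C)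
    (z : S × A × A) : Summable fun s => V s • G.phi s z := by
  have h := (G.phi_bound (fun s => C⁻¹ * V s) (fun s => abs_le.1 (by
    rw [abs_mul, abs_of_pos (inv_pos.2 hC), inv_mul_le_iff₀ hC, mul_one]; exact hV s)) z).1
  refine (h.const_smul C).congr fun s => ?_
  rw [smul_smul, mul_inv_cancel_left₀ hC.ne']

theorem Game.norm_feat_le {V : S → ℝ} {C : ℝ} (hC : 0 < C) (hV : ∀ s, |V s| ≤ C)
    (z : S × A × A) : ‖G.feat V z‖ ≤ C := by
  have h := (G.phi_bound (fun s => C⁻¹ * V s) (fun s => abs_le.1 (by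
    rw [abs_mul, abs_of_pos (inv_pos.2 hC), inv_mul_le_iff₀ hC, mul_one]; exact hV s)) z).2
  change ‖G.feat (fun s => C⁻¹ * V s) z‖ ≤ 1 at h
  rwa [G.feat_smul, norm_smul, Real.norm_of_nonneg (inv_pos.2 hC).le, inv_mul_le_iff₀ hC,
    mul_one] at h

/-- The features turn transition expectations into inner products: `P_h V(z) = ⟪φ_V(z), θ_h⟫`. -/
theorem Game.inner_feat_theta {V : S → ℝ} {C : ℝ} (hC : 0 < C) (hV : ∀ s, |V s| ≤ C) {h : ℕ}
    (hh : h ∈ Finset.Icc 1 H) (z : S × A × A) :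
    ⟪G.feat V z, G.theta h⟫_ℝ = expect (G.trans h z) V := by
  have h1 := (innerSL ℝ (G.theta h)).map_tsum (G.summable_feat hC hV z)
  rw [real_inner_comm]
  change (innerSL ℝ (G.theta h)) (∑' s, V s • G.phi s z) = _
  rw [h1, expect]
  refine tsum_congr fun s => ?_
  rw [G.trans_eq h hh z s, map_smul, smul_eq_mul, innerSL_apply_apply, real_inner_comm, mul_comm]

theorem Game.one_le_norm_mul {h : ℕ} (hh : h ∈ Finset.Icc 1 H) (z : S × A × A) :
    1 ≤ ‖G.feat (fun _ => 1) z‖ * ‖G.theta h‖ := by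
  have := G.inner_feat_theta (V := fun _ => 1) one_pos (fun _ => by simp) hh z
  rw [expect_const] at this
  exact this.symm.le.trans (real_inner_le_norm _ _)

theorem Game.one_le_bound {h : ℕ} (hh : h ∈ Finset.Icc 1 H) (z : S × A × A) {B : ℝ}
    (hB : ‖G.theta h‖ ≤ B) : 1 ≤ B := by
  have h1 := G.one_le_norm_mul hh z
  have h2 := G.norm_feat_le (V := fun _ => 1) one_pos (fun _ => by simp) z
  have h3 := mul_le_mul_of_nonneg_right h2 (norm_nonneg (G.theta h))
  linarith

theorem Game.effDim_bddAbove (hH : 1 ≤ H) (T : ℕ) {lam : ℝ} (hlam : 0 < lam) :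
    BddAbove (Set.range fun p : (Fin T → S → Set.Icc (-(H : ℝ)) H) × (Fin T → S × A × A) =>
      1 / 2 * Real.log (1 + lam⁻¹ • Matrix.of fun i j =>
        G.kernel (fun s => p.1 i s) (fun s => p.1 j s) (p.2 i) (p.2 j)).det) := by
  have hH0 : (0 : ℝ) < H := by exact_mod_cast hH
  refine ⟨1 / 2 * Real.log ((1 + (H : ℝ) ^ 2 / lam) ^ T), ?_⟩
  rintro _ ⟨p, rfl⟩
  let ψ : ℕ → F := fun k => if hk : k < T then G.feat (fun s => p.1 ⟨k, hk⟩ s) (p.2 ⟨k, hk⟩) else 0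
  have e : (Matrix.of fun i j => G.kernel (fun s => p.1 i s) (fun s => p.1 j s) (p.2 i) (p.2 j))
      = Matrix.gram ℝ (fun i : Fin T => ψ i) := by
    ext i j
    simp [Matrix.gram, Game.kernel, ψ]
  simp only [e]
  rw [det_one_add_gram ψ T hlam]
  have hpos : ∀ i, 0 ≤ covSq lam ψ i (ψ i) := fun i => covSq_nonneg ψ hlam _ _
  gcongr
  · exact Finset.prod_pos fun i _ => by linarith [hpos i]
  · calc ∏ i ∈ Finset.range T, (1 + covSq lam ψ i (ψ i))
        ≤ ∏ _i ∈ Finset.range T, (1 + (H : ℝ) ^ 2 / lam) := by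
          refine Finset.prod_le_prod (fun i _ => by linarith [hpos i]) fun i hi => ?_
          have hi := Finset.mem_range.1 hi
          have hn : ‖ψ i‖ ≤ H := by
            simp only [ψ, hi, dif_pos]
            exact G.norm_feat_le hH0 (fun s => abs_le.2 (p.1 ⟨i, hi⟩ s).2) _
          have := covSq_le ψ hlam i (ψ i)
          have h2 : ‖ψ i‖ ^ 2 / lam ≤ (H : ℝ) ^ 2 / lam := by gcongr
          linarith
      _ = _ := by simp

theorem Game.log_det_le_effDim (hH : 1 ≤ H) (T : ℕ) {lam : ℝ} (hlam : 0 < lam) (V : ℕ → S → ℝ)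
    (hV : ∀ k s, |V k s| ≤ H) (z : ℕ → S × A × A) :
    Real.log (1 + lam⁻¹ • Matrix.gram ℝ (fun i : Fin T => G.feat (V i) (z i))).det
      ≤ 2 * G.effDim T lam := by
  have := le_ciSup (G.effDim_bddAbove hH T hlam)
    (fun i s => ⟨V i s, abs_le.1 (hV i s)⟩, fun i => z i)
  change 1 / 2 * Real.log (1 + lam⁻¹ • Matrix.gram ℝ (fun i : Fin T => G.feat (V i) (z i))).det
    ≤ G.effDim T lam at this
  linarith

/-- The leverages of inputs that are multiples of weighted features add up to at most twice the
effective dimension. -/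
theorem Game.sum_leverage_le_effDim (hH : 1 ≤ H) {n T : ℕ} (hn : n ≤ T) {lam a : ℝ}
    (hlam : 0 < lam) (ha : 0 < a) (V : ℕ → S → ℝ) (hV : ∀ k s, |V k s| ≤ H) (z : ℕ → S × A × A)
    {ψ : ℕ → F} (hψ : ∀ k, ψ k = a • G.feat (V k) (z k)) :
    ∑ k ∈ Finset.range n, leverage lam ψ k ≤ 2 * G.effDim T (lam / a ^ 2) := by
  refine (Finset.sum_le_sum_of_subset_of_nonneg (Finset.range_mono hn)
    fun i _ _ => leverage_nonneg ψ hlam i).trans ((sum_leverage_le ψ T hlam).trans ?_)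
  have e : lam⁻¹ • Matrix.gram ℝ (fun i : Fin T => ψ i)
      = (lam / a ^ 2)⁻¹ • Matrix.gram ℝ (fun i : Fin T => G.feat (V i) (z i)) := by
    ext i j
    simp only [Matrix.smul_apply, Matrix.gram, Matrix.of_apply, hψ, real_inner_smul_left,
      real_inner_smul_right, smul_eq_mul]
    field_simp
  rw [e]
  exact G.log_det_le_effDim hH T (by positivity) V hV z

/-- The effective dimension is bounded away from `0`, as constant functions have nonzero features. -/
theorem Game.one_third_le_effDim (hH : 1 ≤ H) {T : ℕ} (hT : 1 ≤ T) (z : S × A × A) {B : ℝ}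
    (hB : ‖G.theta 1‖ ≤ B) : 1 / 3 ≤ G.effDim T (1 / B ^ 2) := by
  have hh : 1 ∈ Finset.Icc 1 H := Finset.mem_Icc.2 ⟨le_rfl, hH⟩
  have hB1 : 1 ≤ B := G.one_le_bound hh z hB
  have hH1 : (1 : ℝ) ≤ H := by exact_mod_cast hH
  have hlam : 0 < 1 / B ^ 2 := by positivity
  have h1 := G.log_det_le_effDim hH T hlam (fun _ _ => (H : ℝ)) (fun _ _ => by simp) fun _ => z
  let ψ : ℕ → F := fun _ => G.feat (fun _ => (H : ℝ)) z
  rw [det_one_add_gram ψ T hlam] at h1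
  have h2 : 2 ≤ 1 + covSq (1 / B ^ 2) ψ 0 (ψ 0) := by
    have e : ψ 0 = (H : ℝ) • G.feat (fun _ => 1) z := by
      rw [← G.feat_smul]; simp [ψ]
    have e2 : covSq (1 / B ^ 2) ψ 0 (ψ 0) = (B * ‖ψ 0‖) ^ 2 := by
      simp [covSq, covInv, real_inner_smul_right, mul_pow]
    rw [e2, e, norm_smul, Real.norm_of_nonneg (by positivity)]
    have h3 := G.one_le_norm_mul hh z
    have h4 : ‖G.feat (fun _ => 1) z‖ * ‖G.theta 1‖ ≤ ‖G.feat (fun _ => 1) z‖ * B := by gcongr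
    have h5 : 1 ≤ B * (H * ‖G.feat (fun _ => 1) z‖) := by nlinarith
    nlinarith
  have h3 : 2 ≤ ∏ i ∈ Finset.range T, (1 + covSq (1 / B ^ 2) ψ i (ψ i)) := by
    obtain ⟨T, rfl⟩ : ∃ T', T = T' + 1 := ⟨T - 1, by omega⟩
    rw [Finset.prod_range_succ']
    have : 1 ≤ ∏ i ∈ Finset.range T, (1 + covSq (1 / B ^ 2) ψ (i + 1) (ψ (i + 1))) :=
      Finset.prod_const_one.symm.le.trans (Finset.prod_le_prod (fun _ _ => zero_le_one) fun i _ => by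
        linarith [covSq_nonneg ψ hlam (i + 1) (ψ (i + 1))])
    nlinarith
  have h4 := Real.log_le_log two_pos h3
  linarith [Real.log_two_gt_d9]

end Features

/-! ### The parameters -/

section Parameters

/-- The assumptions on the numerical parameters under which the algorithm is analysed, with `d` the
effective dimension and `L T = log (4 T² H / δ)`. -/
structure Params.Good (P : Params) (H T : ℕ) (B d : ℝ) (L : ℕ → ℝ) : Prop where
  d_ge : 1 / 3 ≤ d
  L_ge : ∀ t, 1 ≤ t → 1 ≤ L t
  L_mono : ∀ t, 1 ≤ t → t ≤ T → L t ≤ L T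
  lam₁_pos : 0 < P.lam₁
  lam₂_pos : 0 < P.lam₂
  alpha_pos : 0 < P.alpha
  alpha_sq : P.alpha ^ 2 = (H : ℝ) ^ 2 / d
  lam₁_mul : P.lam₁ * P.alpha ^ 2 = 1 / B ^ 2
  lam₂_div : P.lam₂ / (H : ℝ) ^ 2 = 1 / B ^ 2
  beta_eq : ∀ t, P.beta t = 16 * 1 * √d * √(L t) + 4 * (2 * H / P.alpha) * L t + √P.lam₁ * B
  beta₁_eq : ∀ t, P.beta₁ t = 16 * (H / P.alpha) * √d * √(L t) + 4 * (2 * H / P.alpha) * L t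
    + √P.lam₁ * B
  beta₂_eq : ∀ t, P.beta₂ t = 16 * (H : ℝ) ^ 2 * √d * √(L t) + 4 * (2 * (H : ℝ) ^ 2) * L t
    + √P.lam₂ * B
  bias₁ : √P.lam₁ * B ≤ √d
  bias₂ : √P.lam₂ * B = H

theorem tuned_good {S A F : Type*} [NormedAddCommGroup F] [InnerProductSpace ℝ F] {H T : ℕ}
    (G : Game S A F H) {B δ : ℝ} (hH : 1 ≤ H) (hB : 1 ≤ B) (hδ : 0 < δ) (hδ1 : δ < 1)
    (hd : 1 / 3 ≤ G.effDim T (1 / B ^ 2)) :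
    (tuned G B T δ).Good H T B (G.effDim T (1 / B ^ 2))
      fun t => Real.log (4 * (t : ℝ) ^ 2 * H / δ) := by
  have hH1 : (1 : ℝ) ≤ H := by exact_mod_cast hH
  have hB0 : 0 < B := by linarith
  set d := G.effDim T (1 / B ^ 2) with hdef
  have hd0 : 0 < d := by linarith
  have hsd : 0 < √d := Real.sqrt_pos.2 hd0
  have hsq : √d ^ 2 = d := Real.sq_sqrt hd0.le
  have hl1 : (tuned G B T δ).lam₁ = d / (B ^ 2 * (H : ℝ) ^ 2) := rfl
  have hl2 : (tuned G B T δ).lam₂ = (H : ℝ) ^ 2 / B ^ 2 := rfl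
  have hal : (tuned G B T δ).alpha = (H : ℝ) / √d := rfl
  have hla : d / (B ^ 2 * (H : ℝ) ^ 2) * ((H : ℝ) / √d) ^ 2 = 1 / B ^ 2 := by
    rw [div_pow, hsq]; field_simp
  have hll : (H : ℝ) ^ 2 / B ^ 2 / (H : ℝ) ^ 2 = 1 / B ^ 2 := by field_simp
  have hs1 : √(d / (B ^ 2 * (H : ℝ) ^ 2)) * B = √d / H := by
    rw [Real.sqrt_div hd0.le, ← mul_pow, Real.sqrt_sq (by positivity)]
    field_simp
  refine ⟨hd, fun t ht => ?_, fun t ht htT => ?_, ?_, ?_, ?_, ?_, ?_, ?_, fun t => ?_, fun t => ?_,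
    fun t => ?_, ?_, ?_⟩
  · have ht1 : (1 : ℝ) ≤ t := by exact_mod_cast ht
    rw [Real.le_log_iff_exp_le (by positivity), le_div_iff₀ hδ]
    have h1 := Real.exp_one_lt_d9
    have h2 : 1 ≤ (t : ℝ) ^ 2 * H := by nlinarith
    nlinarith [Real.exp_pos 1]
  · have ht1 : (1 : ℝ) ≤ t := by exact_mod_cast ht
    have hT1 : (t : ℝ) ≤ T := by exact_mod_cast htT
    refine Real.log_le_log (by positivity) ?_
    gcongr
  · rw [hl1]; positivity
  · rw [hl2]; positivity
  · rw [hal]; positivity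
  · rw [hal, div_pow, hsq]
  · rw [hl1, hal, hla]
  · rw [hl2, hll]
  · change 16 * √(G.effDim T (d / (B ^ 2 * (H : ℝ) ^ 2) * ((H : ℝ) / √d) ^ 2)) * _ + _ + _ = _
    rw [hla, hal, hl1]
    simp only [← hdef]
    ring
  · change 16 * H / ((H : ℝ) / √d) * √(G.effDim T (d / (B ^ 2 * (H : ℝ) ^ 2) *
      ((H : ℝ) / √d) ^ 2)) * _ + _ + _ = _
    rw [hla, hal, hl1]
    simp only [← hdef]
    ring
  · change 16 * (H : ℝ) ^ 2 * √(G.effDim T ((H : ℝ) ^ 2 / B ^ 2 / (H : ℝ) ^ 2)) * _ + _ + _ = _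
    rw [hll, hl2]
    simp only [← hdef]
    ring
  · rw [hl1, hs1]
    exact div_le_self hsd.le hH1
  · rw [hl2, Real.sqrt_div (by positivity), Real.sqrt_sq (by positivity), Real.sqrt_sq hB0.le]
    field_simp

end Parameters

/-! ### The two sides of the algorithm -/

section Sides

variable {S A F : Type*} [NormedAddCommGroup F] [InnerProductSpace ℝ F] {H : ℕ}
  (G : Game S A F H) (P : Params) (fc : CCEFinder S A) (D : Obs S A)

/-- The component of a pair that belongs to the optimistic (`true`) or pessimistic (`false`) side. -/
def pick {β : Type*} (b : Bool) (p : β × β) : β := match b with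
  | true => p.1
  | false => p.2

/-- The sign of the exploration bonus. -/
def sgn (b : Bool) : ℝ := match b with
  | true => 1
  | false => -1

/-- The records of one side from the episodes before `t`. -/
def pastOf (b : Bool) (t : ℕ) : Fin (t - 1) → Side S := fun i => pick b (record G P fc D (i.val + 1))

/-- The value estimate `V_h^t` of one side. -/
def vEst (b : Bool) (t h : ℕ) : S → ℝ :=
  pick b (plan G P fc D (fun i : Fin (t - 1) => record G P fc D (i.val + 1)) t (H + 1 - h))

/-- The action value estimate `Q_h^t` of one side. -/
def qVal (b : Bool) (t h : ℕ) : S × A × A → ℝ :=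
  qEst G P D (pastOf G P fc D b t) (sgn b) t h (vEst G P fc D b t (h + 1))

/-- The normalization `R_h^t` of one side. -/
def rVal (b : Bool) (t h : ℕ) : ℝ :=
  rEst G P D (pastOf G P fc D b t) t h (vEst G P fc D b t (h + 1)) (D.z t h)

theorem pastOf_true (t : ℕ) : pastOf G P fc D true t =
    fun i : Fin (t - 1) => (record G P fc D (i.val + 1)).1 := rfl

theorem pastOf_false (t : ℕ) : pastOf G P fc D false t =
    fun i : Fin (t - 1) => (record G P fc D (i.val + 1)).2 := rfl

theorem record_V (b : Bool) (t h : ℕ) :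
    (pick b (record G P fc D t)).V h = vEst G P fc D b t h := by
  rw [record]; cases b <;> rfl

theorem record_R (b : Bool) (t h : ℕ) :
    (pick b (record G P fc D t)).R h = rVal G P fc D b t h := by
  rw [record]
  cases b <;> simp only [rVal, vEst, pick] <;> rfl

theorem joint_eq (t h : ℕ) (x : S) : joint G P fc D t h x =
    fc.find (qVal G P fc D true t h) (qVal G P fc D false t h) x := by
  have e : H + 1 - (h + 1) = H - h := by omega
  simp only [joint, jointLaw, qVal, vEst, pick, sgn, e]
  rfl

theorem vEst_eq_expect (b : Bool) (t h : ℕ) (h1 : 1 ≤ h) (hH : h ≤ H) (x : S) :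
    vEst G P fc D b t h x
      = expect (joint G P fc D t h x) fun c => qVal G P fc D b t h (x, c) := by
  obtain ⟨m, hm⟩ : ∃ m, H + 1 - h = m + 1 := ⟨H - h, by omega⟩
  have e1 : H - m = h := by omega
  have e2 : H + 1 - (h + 1) = m := by omega
  rw [joint_eq]
  cases b <;> simp only [qVal, vEst, pick, sgn, e2, hm, plan, e1] <;> rfl

theorem vEst_last (b : Bool) (t : ℕ) : vEst G P fc D b t (H + 1) = 0 := by
  cases b <;> simp [vEst, plan, pick]

theorem abs_qVal_le (b : Bool) (t h : ℕ) (z : S × A × A) : |qVal G P fc D b t h z| ≤ H :=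
  abs_clip_le (Nat.cast_nonneg H) _

theorem abs_vEst_le (b : Bool) (t h : ℕ) (h1 : 1 ≤ h) (x : S) : |vEst G P fc D b t h x| ≤ H := by
  rcases le_or_gt h H with hH | hH
  · rw [vEst_eq_expect G P fc D b t h h1 hH]
    exact abs_expect_le fun c _ => abs_qVal_le G P fc D b t h (x, c)
  · have e : H + 1 - h = 0 := by omega
    cases b <;> simp [vEst, pick, e, plan]

end Sides

/-! ### Dependence on the history -/

section History

variable {S A F : Type*} [NormedAddCommGroup F] [InnerProductSpace ℝ F] {H : ℕ}
  (G : Game S A F H) (P : Params) (fc : CCEFinder S A)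

/-- Two observation records agree on what precedes the actions of step `h` of episode `t`. -/
def StateAgree (H t h : ℕ) (D D' : Obs S A) : Prop :=
  (∀ τ k, 1 ≤ τ ∧ 1 ≤ k ∧ ((τ < t ∧ k ≤ H + 1) ∨ (τ = t ∧ k ≤ h)) → D.x τ k = D'.x τ k) ∧
  (∀ τ k, 1 ≤ τ ∧ 1 ≤ k ∧ ((τ < t ∧ k ≤ H) ∨ (τ = t ∧ k < h)) → D.act τ k = D'.act τ k)

/-- As `StateAgree`, including the actions of step `h` of episode `t`. -/
def ActAgree (H t h : ℕ) (D D' : Obs S A) : Prop :=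
  StateAgree H t h D D' ∧ D.act t h = D'.act t h

variable {D D' : Obs S A}

theorem StateAgree.mono {t h t' h' : ℕ} (hD : StateAgree H t h D D') (hh : h' ≤ H + 1)
    (hlt : t' < t ∨ t' = t ∧ h' ≤ h) : StateAgree H t' h' D D' :=
  ⟨fun τ k hk => hD.1 τ k (by omega), fun τ k hk => hD.2 τ k (by omega)⟩

theorem StateAgree.actAgree {t h t' h' : ℕ} (hD : StateAgree H t h D D') (ht : 1 ≤ t')
    (h1 : 1 ≤ h') (hh : h' ≤ H) (hlt : t' < t ∨ t' = t ∧ h' < h) : ActAgree H t' h' D D' :=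
  ⟨hD.mono (by omega) (by omega), hD.2 t' h' (by omega)⟩

theorem ActAgree.mono {t h t' h' : ℕ} (hD : ActAgree H t h D D') (ht : 1 ≤ t')
    (h1 : 1 ≤ h') (hh : h' ≤ H) (hlt : t' < t ∨ t' = t ∧ h' ≤ h) : ActAgree H t' h' D D' := by
  rcases Classical.em (t' = t ∧ h' = h) with h | h
  · rw [h.1, h.2]; exact hD
  · exact hD.1.actAgree ht h1 hh (by omega)

theorem ActAgree.z_eq {t h : ℕ} (hD : ActAgree H t h D D') (ht : 1 ≤ t) (h1 : 1 ≤ h) :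
    D.z t h = D'.z t h := by
  rw [Obs.z, Obs.z, hD.1.1 t h (by omega), hD.2]

/-- The regression data of the episodes before `t` coincide for `D` and `D'`. -/
def SameData (b : Bool) (t h : ℕ) (D D' : Obs S A) : Prop :=
  psi₁ G D (pastOf G P fc D b t) h = psi₁ G D' (pastOf G P fc D' b t) h ∧
  out₁ D (pastOf G P fc D b t) h = out₁ D' (pastOf G P fc D' b t) h ∧
  psi₂ G D (pastOf G P fc D b t) h = psi₂ G D' (pastOf G P fc D' b t) h ∧
  out₂ D (pastOf G P fc D b t) h = out₂ D' (pastOf G P fc D' b t) h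

theorem SameData.qEst_eq {b : Bool} {t h : ℕ} (h' : SameData G P fc b t h D D') (s : ℝ) :
    qEst G P D (pastOf G P fc D b t) s t h = qEst G P D' (pastOf G P fc D' b t) s t h := by
  funext V z
  simp only [qEst, theta₁, h'.1, h'.2.1]

theorem SameData.rEst_eq {b : Bool} {t h : ℕ} (h' : SameData G P fc b t h D D') :
    rEst G P D (pastOf G P fc D b t) t h = rEst G P D' (pastOf G P fc D' b t) t h := by
  funext V z
  simp only [rEst, varEst, errEst, theta₁, theta₂, h'.1, h'.2.1, h'.2.2.1, h'.2.2.2]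

/-- Equal records of the earlier episodes give equal regression data. -/
theorem sameData_of_eq {b : Bool} {t h : ℕ} (hD : StateAgree H t 0 D D') (h1 : 1 ≤ h) (hH : h ≤ H)
    (hV : ∀ τ, 1 ≤ τ → τ < t → vEst G P fc D b τ (h + 1) = vEst G P fc D' b τ (h + 1))
    (hR : ∀ τ, 1 ≤ τ → τ < t → rVal G P fc D b τ h = rVal G P fc D' b τ h) :
    SameData G P fc b t h D D' := by
  have hV : ∀ i : Fin (t - 1), (pastOf G P fc D b t i).V (h + 1)
      = (pastOf G P fc D' b t i).V (h + 1) := fun i => by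
    have hi := i.isLt
    rw [pastOf, pastOf, record_V, record_V]
    exact hV (i + 1) (by omega) (by omega)
  have hR : ∀ i : Fin (t - 1), (pastOf G P fc D b t i).R h
      = (pastOf G P fc D' b t i).R h := fun i => by
    have hi := i.isLt
    rw [pastOf, pastOf, record_R, record_R]
    exact hR (i + 1) (by omega) (by omega)
  have hz : ∀ i : Fin (t - 1), D.z (i + 1) h = D'.z (i + 1) h := fun i => by
    have hi := i.isLt
    exact (hD.actAgree (by omega) h1 hH (by omega)).z_eq (by omega) h1
  have hx : ∀ i : Fin (t - 1), D.x (i + 1) (h + 1) = D'.x (i + 1) (h + 1) := fun i => by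
    have hi := i.isLt
    exact hD.1 _ _ (by omega)
  refine ⟨?_, ?_, ?_, ?_⟩
  · funext i; rw [psi₁, psi₁, hR i, hV i, hz i]
  · funext i; rw [out₁, out₁, hR i, hV i, hx i]
  · funext i; rw [psi₂, psi₂, hV i, hz i]
  · funext i; rw [out₂, out₂, hV i, hx i]

/-- Equal regression data give equal value estimates. -/
theorem plan_eq_of_sameData {t : ℕ} (hdata : ∀ b h, 1 ≤ h → h ≤ H → SameData G P fc b t h D D')
    (m : ℕ) (hm : m ≤ H) :
    plan G P fc D (fun i : Fin (t - 1) => record G P fc D (i.val + 1)) t m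
      = plan G P fc D' (fun i : Fin (t - 1) => record G P fc D' (i.val + 1)) t m := by
  induction m with
  | zero => simp only [plan]
  | succ m ihm =>
    have e1 := (hdata true (H - m) (by omega) (by omega)).qEst_eq
    have e2 := (hdata false (H - m) (by omega) (by omega)).qEst_eq
    rw [pastOf_true, pastOf_true] at e1
    rw [pastOf_false, pastOf_false] at e2
    simp only [plan, ihm (by omega), e1, e2]

theorem sameData_and_vEst_eq (t : ℕ) (hD : StateAgree H t 0 D D') :
    (∀ b h, 1 ≤ h → h ≤ H → SameData G P fc b t h D D') ∧
    (∀ b h, 1 ≤ h → vEst G P fc D b t h = vEst G P fc D' b t h) := by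
  induction t using Nat.strong_induction_on with
  | _ t ih =>
    have hdata : ∀ b h, 1 ≤ h → h ≤ H → SameData G P fc b t h D D' := by
      intro b h h1 hH
      refine sameData_of_eq G P fc hD h1 hH (fun τ _ hτ => ?_) fun τ hτ1 hτ => ?_
      · exact (ih τ hτ (hD.mono (by omega) (by omega))).2 b (h + 1) (by omega)
      · have h2 := ih τ hτ (hD.mono (by omega) (by omega))
        have hz : D.z τ h = D'.z τ h := (hD.actAgree hτ1 h1 hH (by omega)).z_eq hτ1 h1
        rw [rVal, rVal, (h2.1 b h h1 hH).rEst_eq, h2.2 b (h + 1) (by omega), hz]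
    refine ⟨hdata, fun b h h1 => ?_⟩
    rw [vEst, vEst, plan_eq_of_sameData G P fc hdata _ (by omega)]

theorem vEst_congr {t h : ℕ} (b : Bool) (hD : StateAgree H t 0 D D') (h1 : 1 ≤ h) :
    vEst G P fc D b t h = vEst G P fc D' b t h := (sameData_and_vEst_eq G P fc t hD).2 b h h1

theorem qVal_congr {t h : ℕ} (b : Bool) (hD : StateAgree H t 0 D D') (h1 : 1 ≤ h) (hH : h ≤ H) :
    qVal G P fc D b t h = qVal G P fc D' b t h := by
  have h2 := sameData_and_vEst_eq G P fc t hD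
  rw [qVal, qVal, (h2.1 b h h1 hH).qEst_eq, h2.2 b (h + 1) (by omega)]

theorem joint_congr {t h : ℕ} (hD : StateAgree H t 0 D D') (h1 : 1 ≤ h) (hH : h ≤ H) (x : S) :
    joint G P fc D t h x = joint G P fc D' t h x := by
  rw [joint_eq, joint_eq, qVal_congr G P fc true hD h1 hH, qVal_congr G P fc false hD h1 hH]

theorem rVal_congr {t h : ℕ} (b : Bool) (hD : ActAgree H t h D D') (ht : 1 ≤ t) (h1 : 1 ≤ h)
    (hH : h ≤ H) : rVal G P fc D b t h = rVal G P fc D' b t h := by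
  have h2 := sameData_and_vEst_eq G P fc t (hD.1.mono (h' := 0) (by omega) (by omega))
  rw [rVal, rVal, (h2.1 b h h1 hH).rEst_eq, h2.2 b (h + 1) (by omega), hD.z_eq ht h1]

end History

/-! ### Histories are discrete -/

section Measurability

/-- A function of finitely many discrete variables is measurable with respect to any `σ`-algebra for
which these are. -/
theorem isDiscreteHist_of_finite {Ω ι₁ ι₂ β₁ β₂ : Type*} [Finite ι₁] [Finite ι₂] [Countable β₁]
    [Countable β₂] {m : MeasurableSpace Ω} (f₁ : ι₁ → Ω → β₁) (f₂ : ι₂ → Ω → β₂)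
    (h₁ : ∀ i c, MeasurableSet[m] (f₁ i ⁻¹' {c})) (h₂ : ∀ i c, MeasurableSet[m] (f₂ i ⁻¹' {c}))
    {r : Ω → Ω → Prop}
    (hr : ∀ ω ω', (∀ i, f₁ i ω = f₁ i ω') → (∀ i, f₂ i ω = f₂ i ω') → r ω ω') :
    IsDiscreteHist m r := by
  intro g hg s _
  let Φ : Ω → (ι₁ → β₁) × (ι₂ → β₂) := fun ω => (fun i => f₁ i ω, fun i => f₂ i ω)
  have hΦ : ∀ c, MeasurableSet[m] (Φ ⁻¹' {c}) := by
    intro c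
    have e : Φ ⁻¹' {c} = (⋂ i, f₁ i ⁻¹' {c.1 i}) ∩ ⋂ i, f₂ i ⁻¹' {c.2 i} := by
      ext ω
      simp only [Set.mem_preimage, Set.mem_singleton_iff, Φ, Prod.ext_iff, funext_iff,
        Set.mem_inter_iff, Set.mem_iInter]
    rw [e]
    exact (MeasurableSet.iInter fun i => h₁ i _).inter (MeasurableSet.iInter fun i => h₂ i _)
  have e : g ⁻¹' s = ⋃ c ∈ Φ '' (g ⁻¹' s), Φ ⁻¹' {c} := by
    ext ω
    simp only [Set.mem_iUnion, Set.mem_preimage, Set.mem_singleton_iff, exists_prop]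
    constructor
    · exact fun h => ⟨Φ ω, ⟨ω, h, rfl⟩, rfl⟩
    · rintro ⟨c, ⟨ω', h', rfl⟩, hc⟩
      have h3 := Prod.ext_iff.1 hc
      have : g ω = g ω' := hg ω ω' (hr ω ω' (fun i => congrFun h3.1 i) fun i => congrFun h3.2 i)
      rw [this]; exact h'
  rw [e]
  exact MeasurableSet.biUnion (Set.to_countable _) fun c _ => hΦ c

variable {S A Ω : Type*} [MeasurableSpace S] [MeasurableSpace A] (H : ℕ) (X : ℕ → ℕ → Ω → S)
  (Y : ℕ → ℕ → Ω → A × A)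

theorem stateHist_le [mΩ : MeasurableSpace Ω] (hX : ∀ t h, Measurable (X t h))
    (hY : ∀ t h, Measurable (Y t h)) (t h : ℕ) : stateHist H X Y t h ≤ mΩ :=
  sup_le (iSup_le fun τ => iSup_le fun k => iSup_le fun _ => (hX τ k).comap_le)
    (iSup_le fun τ => iSup_le fun k => iSup_le fun _ => (hY τ k).comap_le)

theorem actHist_le [mΩ : MeasurableSpace Ω] (hX : ∀ t h, Measurable (X t h))
    (hY : ∀ t h, Measurable (Y t h)) (t h : ℕ) : actHist H X Y t h ≤ mΩ :=
  sup_le (stateHist_le H X Y hX hY t h) (hY t h).comap_le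

variable [Countable S] [DiscreteMeasurableSpace S] [Finite A] [DiscreteMeasurableSpace A]

theorem stateHist_discrete (t h : ℕ) : IsDiscreteHist (stateHist H X Y t h)
    fun ω ω' => StateAgree H t h (obs X Y ω) (obs X Y ω') := by
  let c₁ : ℕ × ℕ → Prop := fun q => 1 ≤ q.1 ∧ 1 ≤ q.2 ∧
    ((q.1 < t ∧ q.2 ≤ H + 1) ∨ (q.1 = t ∧ q.2 ≤ h))
  let c₂ : ℕ × ℕ → Prop := fun q => 1 ≤ q.1 ∧ 1 ≤ q.2 ∧
    ((q.1 < t ∧ q.2 ≤ H) ∨ (q.1 = t ∧ q.2 < h))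
  have hf : ∀ c : ℕ × ℕ → Prop, (∀ q, c q → q.1 ≤ t ∧ q.2 ≤ H + 1 + h) → Finite {q // c q} :=
    fun c hc => Set.Finite.subset (Set.finite_Iic (t, H + 1 + h)) fun q hq => hc q hq
  have := hf c₁ fun q hq => by simp only [c₁] at hq; omega
  have := hf c₂ fun q hq => by simp only [c₂] at hq; omega
  refine isDiscreteHist_of_finite (ι₁ := {q // c₁ q}) (ι₂ := {q // c₂ q})
    (fun q => X q.1.1 q.1.2) (fun q => Y q.1.1 q.1.2) (fun q c => ?_) (fun q c => ?_) ?_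
  · have : MeasurableSpace.comap (X q.1.1 q.1.2) inferInstance ≤ stateHist H X Y t h :=
      le_sup_of_le_left (le_iSup_of_le q.1.1 (le_iSup_of_le q.1.2 (le_iSup_of_le q.2 le_rfl)))
    exact this _ ⟨{c}, measurableSet_singleton c, rfl⟩
  · have : MeasurableSpace.comap (Y q.1.1 q.1.2) inferInstance ≤ stateHist H X Y t h :=
      le_sup_of_le_right (le_iSup_of_le q.1.1 (le_iSup_of_le q.1.2 (le_iSup_of_le q.2 le_rfl)))
    exact this _ ⟨{c}, measurableSet_singleton c, rfl⟩
  · exact fun ω ω' h1 h2 => ⟨fun τ k hk => h1 ⟨(τ, k), hk⟩, fun τ k hk => h2 ⟨(τ, k), hk⟩⟩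

theorem actHist_discrete (t h : ℕ) : IsDiscreteHist (actHist H X Y t h)
    fun ω ω' => ActAgree H t h (obs X Y ω) (obs X Y ω') := by
  let c₁ : ℕ × ℕ → Prop := fun q => 1 ≤ q.1 ∧ 1 ≤ q.2 ∧
    ((q.1 < t ∧ q.2 ≤ H + 1) ∨ (q.1 = t ∧ q.2 ≤ h))
  let c₂ : ℕ × ℕ → Prop := fun q => 1 ≤ q.1 ∧ 1 ≤ q.2 ∧
    ((q.1 < t ∧ q.2 ≤ H) ∨ (q.1 = t ∧ q.2 < h))
  have hf : ∀ c : ℕ × ℕ → Prop, (∀ q, c q → q.1 ≤ t ∧ q.2 ≤ H + 1 + h) → Finite {q // c q} :=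
    fun c hc => Set.Finite.subset (Set.finite_Iic (t, H + 1 + h)) fun q hq => hc q hq
  have := hf c₁ fun q hq => by simp only [c₁] at hq; omega
  have := hf c₂ fun q hq => by simp only [c₂] at hq; omega
  refine isDiscreteHist_of_finite (ι₁ := {q // c₁ q}) (ι₂ := Option {q // c₂ q})
    (fun q => X q.1.1 q.1.2) (fun q => q.elim (Y t h) fun q => Y q.1.1 q.1.2)
    (fun q c => ?_) (fun q c => ?_) ?_
  · have : MeasurableSpace.comap (X q.1.1 q.1.2) inferInstance ≤ actHist H X Y t h :=
      le_sup_of_le_left (le_sup_of_le_left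
        (le_iSup_of_le q.1.1 (le_iSup_of_le q.1.2 (le_iSup_of_le q.2 le_rfl))))
    exact this _ ⟨{c}, measurableSet_singleton c, rfl⟩
  · have : MeasurableSpace.comap (q.elim (Y t h) fun q => Y q.1.1 q.1.2) inferInstance
        ≤ actHist H X Y t h := by
      rcases q with _ | q
      · exact le_sup_right
      · exact le_sup_of_le_left (le_sup_of_le_right
          (le_iSup_of_le q.1.1 (le_iSup_of_le q.1.2 (le_iSup_of_le q.2 le_rfl))))
    exact this _ ⟨{c}, measurableSet_singleton c, rfl⟩
  · exact fun ω ω' h1 h2 => ⟨⟨fun τ k hk => h1 ⟨(τ, k), hk⟩, fun τ k hk => h2 (some ⟨(τ, k), hk⟩)⟩,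
      h2 none⟩

end Measurability

/-! ### Martingale bounds along a run -/

section Run

variable {S A F Ω : Type*} [NormedAddCommGroup F] [InnerProductSpace ℝ F] {H T : ℕ}
  [Countable S] [MeasurableSpace S] [DiscreteMeasurableSpace S] [Finite A]
  [MeasurableSpace A] [DiscreteMeasurableSpace A] [mΩ : MeasurableSpace Ω] {μ : Measure Ω}
  [IsProbabilityMeasure μ] {G : Game S A F H} {P : Params} {fc : CCEFinder S A}
  {X : ℕ → ℕ → Ω → S} {Y : ℕ → ℕ → Ω → A × A}

theorem abs_expect_sub_le {α : Type*} {p : PMF α} {f : α → ℝ} {c : ℝ} (hf : ∀ a, |f a| ≤ c)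
    (a : α) : |expect p f - f a| ≤ 2 * c :=
  (abs_sub _ _).trans (by linarith [abs_expect_le (p := p) fun a _ => hf a, hf a])

theorem expect_expect_sub {α : Type*} {p : PMF α} {f : α → ℝ} {c : ℝ} (hf : ∀ a, |f a| ≤ c) :
    expect p (fun a => expect p f - f a) = 0 := by
  rw [expect_sub (fun _ _ => le_rfl) (fun a _ => hf a), expect_const, sub_self]

/-- Azuma's inequality for the deviations of functions of the next state. -/
theorem IsRun.measure_state_le (hrun : IsRun μ G P fc T X Y) (hT : 1 ≤ T) (hH : 1 ≤ H)
    (f : Obs S A → ℕ → ℕ → S → ℝ) {c L : ℝ} (hc : 0 < c) (hL : 0 < L)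
    (hfc : ∀ D t h, 1 ≤ h → ∀ s, |f D t h s| ≤ c)
    (hf : ∀ D D' t h, 1 ≤ t → 1 ≤ h → h ≤ H → ActAgree H t h D D' → f D t h = f D' t h) :
    μ {ω | 2 * c * √(6 * (T * H) * L) < ∑ t ∈ Finset.range T, ∑ h ∈ Finset.range H,
        (expect (G.trans (h + 1) ((obs X Y ω).z (t + 1) (h + 1))) (f (obs X Y ω) (t + 1) (h + 1))
          - f (obs X Y ω) (t + 1) (h + 1) (X (t + 1) (h + 2) ω))}
      ≤ ENNReal.ofReal (Real.exp (-(3 * L))) := by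
  have hξ : ∀ t h, h < H → ∀ ω ω',
      ActAgree H (t + 1) (h + 1) (obs X Y ω) (obs X Y ω') →
      (fun s => expect (G.trans (h + 1) ((obs X Y ω).z (t + 1) (h + 1)))
        (f (obs X Y ω) (t + 1) (h + 1)) - f (obs X Y ω) (t + 1) (h + 1) s)
      = fun s => expect (G.trans (h + 1) ((obs X Y ω').z (t + 1) (h + 1)))
        (f (obs X Y ω') (t + 1) (h + 1)) - f (obs X Y ω') (t + 1) (h + 1) s := by
    intro t h hh ω ω' hω
    rw [hω.z_eq (by omega) (by omega), hf _ _ _ _ (by omega) (by omega) (by omega) hω]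
  refine measure_azuma_le (r := fun t h ω ω' => ActAgree H (t + 1) (h + 1) (obs X Y ω) (obs X Y ω'))
    (m := fun t h => actHist H X Y (t + 1) (h + 1)) (X := fun t h => X (t + 1) (h + 2))
    (p := fun t h ω => G.trans (h + 1) ((obs X Y ω).z (t + 1) (h + 1)))
    (ξ := fun t h ω s => expect (G.trans (h + 1) ((obs X Y ω).z (t + 1) (h + 1)))
        (f (obs X Y ω) (t + 1) (h + 1)) - f (obs X Y ω) (t + 1) (h + 1) s)
    hT hH (by positivity) hL
    (fun t _ h _ => actHist_le H X Y hrun.measurable_state hrun.measurable_act _ _)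
    (fun t _ h _ => actHist_discrete H X Y _ _) (fun t h => hrun.measurable_state _ _)
    (fun t ht h hh s => hrun.state_law (t + 1) (by simp; omega) (h + 1) (by simp; omega) s)
    (fun t _ h _ ω s => abs_expect_sub_le (hfc _ _ _ (by omega)) s)
    (fun t _ h _ ω => expect_expect_sub (hfc _ _ _ (by omega)))
    (fun t _ h _ t' h' hlt hh' ω ω' hω => hω.mono (by omega) (by omega) (by omega) (by omega))
    (fun t _ h hh ω ω' hω => hξ t h hh ω ω' hω)
    (fun t _ h hh t' h' hlt hh' ω ω' hω => hω.1.1 _ _ (by omega)) ?_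
  refine ((stateHist_discrete H X Y (T + 1) 1).measurable_real fun ω ω' hω => ?_).mono
    (stateHist_le H X Y hrun.measurable_state hrun.measurable_act _ _) le_rfl
  refine Finset.sum_congr rfl fun t ht => Finset.sum_congr rfl fun h hh => ?_
  have ht := Finset.mem_range.1 ht
  have hh := Finset.mem_range.1 hh
  have h1 := hξ t h hh ω ω' (hω.actAgree (by omega) (by omega) (by omega) (by omega))
  have h2 : X (t + 1) (h + 2) ω = X (t + 1) (h + 2) ω' := hω.1 _ _ (by omega)
  rw [h2]
  exact congrFun h1 _

/-- Azuma's inequality for the deviations of functions of the pair of actions. -/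
theorem IsRun.measure_act_le (hrun : IsRun μ G P fc T X Y) (hT : 1 ≤ T) (hH : 1 ≤ H)
    (f : Obs S A → ℕ → ℕ → A × A → ℝ) {c L : ℝ} (hc : 0 < c) (hL : 0 < L)
    (hfc : ∀ D t h s, |f D t h s| ≤ c)
    (hf : ∀ D D' t h, 1 ≤ t → 1 ≤ h → h ≤ H → StateAgree H t h D D' → f D t h = f D' t h) :
    μ {ω | 2 * c * √(6 * (T * H) * L) < ∑ t ∈ Finset.range T, ∑ h ∈ Finset.range H,
        (expect (joint G P fc (obs X Y ω) (t + 1) (h + 1) (X (t + 1) (h + 1) ω))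
          (f (obs X Y ω) (t + 1) (h + 1))
          - f (obs X Y ω) (t + 1) (h + 1) (Y (t + 1) (h + 1) ω))}
      ≤ ENNReal.ofReal (Real.exp (-(3 * L))) := by
  have hξ : ∀ t h, h < H → ∀ ω ω',
      StateAgree H (t + 1) (h + 1) (obs X Y ω) (obs X Y ω') →
      (fun s => expect (joint G P fc (obs X Y ω) (t + 1) (h + 1) (X (t + 1) (h + 1) ω))
        (f (obs X Y ω) (t + 1) (h + 1)) - f (obs X Y ω) (t + 1) (h + 1) s)
      = fun s => expect (joint G P fc (obs X Y ω') (t + 1) (h + 1) (X (t + 1) (h + 1) ω'))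
        (f (obs X Y ω') (t + 1) (h + 1)) - f (obs X Y ω') (t + 1) (h + 1) s := by
    intro t h hh ω ω' hω
    have h2 : X (t + 1) (h + 1) ω = X (t + 1) (h + 1) ω' := hω.1 _ _ (by omega)
    rw [h2, hf _ _ _ _ (by omega) (by omega) (by omega) hω,
      joint_congr G P fc (hω.mono (h' := 0) (by omega) (by omega)) (by omega) (by omega)]
  refine measure_azuma_le
    (r := fun t h ω ω' => StateAgree H (t + 1) (h + 1) (obs X Y ω) (obs X Y ω'))
    (m := fun t h => stateHist H X Y (t + 1) (h + 1)) (X := fun t h => Y (t + 1) (h + 1))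
    (p := fun t h ω => joint G P fc (obs X Y ω) (t + 1) (h + 1) (X (t + 1) (h + 1) ω))
    (ξ := fun t h ω s => expect (joint G P fc (obs X Y ω) (t + 1) (h + 1) (X (t + 1) (h + 1) ω))
        (f (obs X Y ω) (t + 1) (h + 1)) - f (obs X Y ω) (t + 1) (h + 1) s)
    hT hH (by positivity) hL
    (fun t _ h _ => stateHist_le H X Y hrun.measurable_state hrun.measurable_act _ _)
    (fun t _ h _ => stateHist_discrete H X Y _ _) (fun t h => hrun.measurable_act _ _)
    (fun t ht h hh s => hrun.act_law (t + 1) (by simp; omega) (h + 1) (by simp; omega) s)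
    (fun t _ h _ ω s => abs_expect_sub_le (hfc _ _ _) s)
    (fun t _ h _ ω => expect_expect_sub (hfc _ _ _))
    (fun t _ h _ t' h' hlt hh' ω ω' hω => hω.mono (by omega) (by omega))
    (fun t _ h hh ω ω' hω => hξ t h hh ω ω' hω)
    (fun t _ h hh t' h' hlt hh' ω ω' hω => hω.2 _ _ (by omega)) ?_
  refine ((stateHist_discrete H X Y (T + 1) 1).measurable_real fun ω ω' hω => ?_).mono
    (stateHist_le H X Y hrun.measurable_state hrun.measurable_act _ _) le_rfl
  refine Finset.sum_congr rfl fun t ht => Finset.sum_congr rfl fun h hh => ?_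
  have ht := Finset.mem_range.1 ht
  have hh := Finset.mem_range.1 hh
  have h1 := hξ t h hh ω ω' (hω.mono (by omega) (by omega))
  have h2 : Y (t + 1) (h + 1) ω = Y (t + 1) (h + 1) ω' := hω.2 _ _ (by omega)
  rw [h2]
  exact congrFun h1 _

/-- The norm of the accumulated noise `∑ η_k ψ_k` in the geometry of the inverse covariance. -/
def noiseNorm (lam : ℝ) (ψ : ℕ → F) (η : ℕ → ℝ) (n : ℕ) : ℝ :=
  √(covSq lam ψ n (∑ k ∈ Finset.range n, η k • ψ k))

/-- The self-normalized Bernstein inequality for the regressions at a fixed step `h`. -/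
theorem IsRun.measure_noiseNorm_le (hrun : IsRun μ G P fc T X Y) {h : ℕ} (h1 : 1 ≤ h) (hH : h ≤ H)
    {n : ℕ} (hn : n ≤ T) (e : Obs S A → ℕ → S → ℝ) (ψ : Obs S A → ℕ → F) {lam M σ Γ L : ℝ}
    (hlam : 0 < lam) (hM : 0 < M) (hσ : 0 < σ) (hΓ : 0 < Γ) (hL : 1 ≤ L)
    (he : ∀ D k s, |e D k s| ≤ M)
    (h0 : ∀ D k, expect (G.trans h (D.z (k + 1) h)) (e D k) = 0)
    (h2 : ∀ D k, expect (G.trans h (D.z (k + 1) h)) (fun s => e D k s ^ 2) ≤ σ ^ 2)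
    (hre : ∀ D D' k, ActAgree H (k + 1) h D D' → e D k = e D' k)
    (hrψ : ∀ D D' k, ActAgree H (k + 1) h D D' → ψ D k = ψ D' k)
    (hpot : ∀ D, ∑ k ∈ Finset.range n, leverage lam (ψ D) k ≤ 2 * Γ) :
    μ {ω | 16 * σ * √Γ * √L + 4 * M * L < noiseNorm lam (ψ (obs X Y ω))
        (fun k => e (obs X Y ω) k (X (k + 1) (h + 1) ω)) n}
      ≤ ENNReal.ofReal (Real.exp (-(3 * L))) :=
  measure_selfNormalized_le (r := fun k ω ω' => ActAgree H (k + 1) h (obs X Y ω) (obs X Y ω'))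
    (m := fun k => actHist H X Y (k + 1) h) (X := fun k => X (k + 1) (h + 1))
    (p := fun k ω => G.trans h ((obs X Y ω).z (k + 1) h)) (e := fun k ω => e (obs X Y ω) k)
    (ψ := fun k ω => ψ (obs X Y ω) k) hlam hM hσ hΓ hL
    (fun k _ => actHist_le H X Y hrun.measurable_state hrun.measurable_act _ _)
    (fun k _ => actHist_discrete H X Y _ _) (fun k _ => hrun.measurable_state _ _)
    (fun k hk s => hrun.state_law (k + 1) (by simp; omega) h (by simp; omega) s)
    (fun k _ ω => he _ k) (fun k _ ω => h0 _ k) (fun k _ ω => h2 _ k)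
    (fun k _ j hj ω ω' hω => hω.mono (by omega) h1 hH (by omega))
    (fun k _ ω ω' hω => hre _ _ k hω) (fun k _ ω ω' hω => hrψ _ _ k hω)
    (fun k _ j hj ω ω' hω => hω.1.1 _ _ (by omega)) (fun ω => hpot _)

end Run

/-! ### The good event -/

section GoodEvent

variable {S A F : Type*} [NormedAddCommGroup F] [InnerProductSpace ℝ F] {H : ℕ}
  (G : Game S A F H) (P : Params) (fc : CCEFinder S A) (D : Obs S A)

/-- The expectation of the next value estimate `V_{h+1}^t` after the triplet `z`. -/
def nextMean (b : Bool) (t h : ℕ) (z : S × A × A) : ℝ :=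
  expect (G.trans h z) (vEst G P fc D b t (h + 1))

/-- The second moment of the next value estimate after the triplet `z`. -/
def nextSq (b : Bool) (t h : ℕ) (z : S × A × A) : ℝ :=
  expect (G.trans h z) fun s => vEst G P fc D b t (h + 1) s ^ 2

/-- The conditional variance of the next value estimate along the observed trajectory. -/
def nextVar (b : Bool) (t h : ℕ) : ℝ :=
  nextSq G P fc D b t h (D.z t h) - nextMean G P fc D b t h (D.z t h) ^ 2

/-- Input of the weighted regression from episode `k + 1`. -/
def input₁ (b : Bool) (h k : ℕ) : F :=
  (rVal G P fc D b (k + 1) h)⁻¹ • G.feat (vEst G P fc D b (k + 1) (h + 1)) (D.z (k + 1) h)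

/-- Input of the second moment regression from episode `k + 1`. -/
def input₂ (b : Bool) (h k : ℕ) : F :=
  G.feat (fun s => vEst G P fc D b (k + 1) (h + 1) s ^ 2) (D.z (k + 1) h)

/-- Noise of the weighted regression from episode `k + 1`, if the next state is `s`. -/
def noise₁ (b : Bool) (h k : ℕ) (s : S) : ℝ :=
  (rVal G P fc D b (k + 1) h)⁻¹ *
    (vEst G P fc D b (k + 1) (h + 1) s - nextMean G P fc D b (k + 1) h (D.z (k + 1) h))

/-- The noise of the weighted regression, suppressed where the normalization fails to dominate the
variance. Whether this happens is known before the next state is drawn. -/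
def noise₁' (b : Bool) (h k : ℕ) (s : S) : ℝ :=
  if nextVar G P fc D b (k + 1) h ≤ rVal G P fc D b (k + 1) h ^ 2
  then noise₁ G P fc D b h k s else 0

/-- Noise of the second moment regression from episode `k + 1`, if the next state is `s`. -/
def noise₂ (b : Bool) (h k : ℕ) (s : S) : ℝ :=
  vEst G P fc D b (k + 1) (h + 1) s ^ 2 - nextSq G P fc D b (k + 1) h (D.z (k + 1) h)

/-- The event on which the regret bound holds: the confidence sets are valid, and the martingales
that enter the regret decomposition are of the order of their standard deviations. -/
structure GoodEvent (T : ℕ) (d : ℝ) (L : ℕ → ℝ) : Prop where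
  conf₁' : ∀ b, ∀ t ∈ Finset.Icc 1 T, ∀ h ∈ Finset.Icc 1 H,
    noiseNorm P.lam₁ (input₁ G P fc D b h) (fun k => noise₁' G P fc D b h k (D.x (k + 1) (h + 1)))
      (t - 1) ≤ 16 * 1 * √d * √(L t) + 4 * (2 * H / P.alpha) * L t
  conf₁ : ∀ b, ∀ t ∈ Finset.Icc 1 T, ∀ h ∈ Finset.Icc 1 H,
    noiseNorm P.lam₁ (input₁ G P fc D b h) (fun k => noise₁ G P fc D b h k (D.x (k + 1) (h + 1)))
      (t - 1) ≤ 16 * (H / P.alpha) * √d * √(L t) + 4 * (2 * H / P.alpha) * L t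
  conf₂ : ∀ b, ∀ t ∈ Finset.Icc 1 T, ∀ h ∈ Finset.Icc 1 H,
    noiseNorm P.lam₂ (input₂ G P fc D b h) (fun k => noise₂ G P fc D b h k (D.x (k + 1) (h + 1)))
      (t - 1) ≤ 16 * (H : ℝ) ^ 2 * √d * √(L t) + 4 * (2 * (H : ℝ) ^ 2) * L t
  gap_state : ∑ t ∈ Finset.range T, ∑ h ∈ Finset.range H,
    (expect (G.trans (h + 1) (D.z (t + 1) (h + 1)))
      (fun s => vEst G P fc D true (t + 1) (h + 2) s - vEst G P fc D false (t + 1) (h + 2) s)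
      - (vEst G P fc D true (t + 1) (h + 2) (D.x (t + 1) (h + 2))
        - vEst G P fc D false (t + 1) (h + 2) (D.x (t + 1) (h + 2))))
    ≤ 2 * (2 * H) * √(6 * (T * H) * L T)
  gap_act : ∑ t ∈ Finset.range T, ∑ h ∈ Finset.range H,
    (expect (joint G P fc D (t + 1) (h + 1) (D.x (t + 1) (h + 1)))
      (fun c => qVal G P fc D true (t + 1) (h + 1) (D.x (t + 1) (h + 1), c)
        - qVal G P fc D false (t + 1) (h + 1) (D.x (t + 1) (h + 1), c))
      - (qVal G P fc D true (t + 1) (h + 1) (D.z (t + 1) (h + 1))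
        - qVal G P fc D false (t + 1) (h + 1) (D.z (t + 1) (h + 1))))
    ≤ 2 * (2 * H) * √(6 * (T * H) * L T)
  sq_state : ∀ b, ∑ t ∈ Finset.range T, ∑ h ∈ Finset.range H,
    (nextSq G P fc D b (t + 1) (h + 1) (D.z (t + 1) (h + 1))
      - vEst G P fc D b (t + 1) (h + 2) (D.x (t + 1) (h + 2)) ^ 2)
    ≤ 2 * (H : ℝ) ^ 2 * √(6 * (T * H) * L T)
  sq_act : ∀ b, ∑ t ∈ Finset.range T, ∑ h ∈ Finset.range H,
    (expect (joint G P fc D (t + 1) (h + 1) (D.x (t + 1) (h + 1)))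
      (fun c => qVal G P fc D b (t + 1) (h + 1) (D.x (t + 1) (h + 1), c) ^ 2)
      - qVal G P fc D b (t + 1) (h + 1) (D.z (t + 1) (h + 1)) ^ 2)
    ≤ 2 * (H : ℝ) ^ 2 * √(6 * (T * H) * L T)

theorem alpha_le_rVal (b : Bool) (t h : ℕ) : P.alpha ≤ rVal G P fc D b t h := by
  rw [rVal, rEst]
  exact Real.le_sqrt_of_sq_le (le_max_right _ _)

theorem abs_sq_vEst_le (b : Bool) (t h : ℕ) (h1 : 1 ≤ h) (s : S) :
    |vEst G P fc D b t h s ^ 2| ≤ (H : ℝ) ^ 2 := by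
  rw [abs_pow]
  exact pow_le_pow_left₀ (abs_nonneg _) (abs_vEst_le G P fc D b t h h1 s) 2

variable {T : ℕ} {B d : ℝ} {L : ℕ → ℝ}

theorem sum_leverage_input₁_le (hH : 1 ≤ H) (hP : P.Good H T B d L)
    (hd : d = G.effDim T (1 / B ^ 2)) (b : Bool) (h n : ℕ) (hn : n ≤ T) :
    ∑ k ∈ Finset.range n, leverage P.lam₁ (input₁ G P fc D b h) k ≤ 2 * d := by
  have hα := hP.alpha_pos
  have hR : ∀ k, P.alpha ≤ rVal G P fc D b (k + 1) h := fun k => alpha_le_rVal G P fc D b _ h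
  have key := G.sum_leverage_le_effDim hH hn hP.lam₁_pos (inv_pos.2 hα)
    (fun k s => P.alpha * (rVal G P fc D b (k + 1) h)⁻¹ * vEst G P fc D b (k + 1) (h + 1) s)
    (fun k s => ?_) (fun k => D.z (k + 1) h) (ψ := input₁ G P fc D b h) (fun k => ?_)
  · have e : P.lam₁ / P.alpha⁻¹ ^ 2 = 1 / B ^ 2 := by
      rw [← hP.lam₁_mul, inv_pow, div_inv_eq_mul]
    rwa [e, ← hd] at key
  · have hRk := hα.trans_le (hR k)
    have h1 : |P.alpha * (rVal G P fc D b (k + 1) h)⁻¹| ≤ 1 := by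
      rw [abs_of_pos (by positivity), ← div_eq_mul_inv]
      exact div_le_one_of_le₀ (hR k) hRk.le
    rw [abs_mul]
    calc _ ≤ 1 * (H : ℝ) := mul_le_mul h1 (abs_vEst_le G P fc D b _ _ (by omega) s)
          (abs_nonneg _) zero_le_one
      _ = H := one_mul _
  · rw [G.feat_smul, smul_smul, inv_mul_cancel_left₀ hα.ne']
    rfl

theorem sum_leverage_input₂_le (hH : 1 ≤ H) (hP : P.Good H T B d L)
    (hd : d = G.effDim T (1 / B ^ 2)) (b : Bool) (h n : ℕ) (hn : n ≤ T) :
    ∑ k ∈ Finset.range n, leverage P.lam₂ (input₂ G P fc D b h) k ≤ 2 * d := by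
  have hH0 : (0 : ℝ) < H := by exact_mod_cast hH
  have key := G.sum_leverage_le_effDim hH hn hP.lam₂_pos hH0
    (fun k s => (H : ℝ)⁻¹ * vEst G P fc D b (k + 1) (h + 1) s ^ 2)
    (fun k s => ?_) (fun k => D.z (k + 1) h) (ψ := input₂ G P fc D b h) (fun k => ?_)
  · rwa [hP.lam₂_div, ← hd] at key
  · rw [abs_mul, abs_of_pos (inv_pos.2 hH0), inv_mul_le_iff₀ hH0, ← sq]
    exact abs_sq_vEst_le G P fc D b _ _ (by omega) s
  · rw [G.feat_smul, smul_smul, mul_inv_cancel₀ hH0.ne', one_smul]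
    rfl

theorem abs_noise₁_le (hα : 0 < P.alpha) (b : Bool) (h k : ℕ) (s : S) :
    |noise₁ G P fc D b h k s| ≤ 2 * H / P.alpha := by
  have hR := alpha_le_rVal G P fc D b (k + 1) h
  rw [noise₁, abs_mul, abs_of_pos (inv_pos.2 (hα.trans_le hR)), inv_mul_eq_div]
  have h1 : |vEst G P fc D b (k + 1) (h + 1) s - nextMean G P fc D b (k + 1) h (D.z (k + 1) h)|
      ≤ 2 * H := by
    rw [abs_sub_comm]
    exact abs_expect_sub_le (abs_vEst_le G P fc D b (k + 1) (h + 1) (by omega)) s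
  gcongr

theorem expect_noise₁ (b : Bool) (h k : ℕ) :
    expect (G.trans h (D.z (k + 1) h)) (noise₁ G P fc D b h k) = 0 := by
  have hV := abs_vEst_le G P fc D b (k + 1) (h + 1) (by omega)
  change expect _ (fun s => noise₁ G P fc D b h k s) = 0
  simp only [noise₁]
  rw [expect_mul_left, expect_sub (fun s _ => hV s) (fun _ _ => le_rfl), expect_const, nextMean,
    sub_self, mul_zero]

theorem expect_noise₁_sq (b : Bool) (h k : ℕ) :
    expect (G.trans h (D.z (k + 1) h)) (fun s => noise₁ G P fc D b h k s ^ 2)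
      = (rVal G P fc D b (k + 1) h ^ 2)⁻¹ * nextVar G P fc D b (k + 1) h := by
  have hV := abs_vEst_le G P fc D b (k + 1) (h + 1) (by omega)
  simp only [noise₁, mul_pow, inv_pow]
  rw [expect_mul_left, nextMean, expect_sub_sq hV]
  rfl

theorem nextVar_le (b : Bool) (t h : ℕ) : nextVar G P fc D b t h ≤ (H : ℝ) ^ 2 := by
  have : nextSq G P fc D b t h (D.z t h) ≤ (H : ℝ) ^ 2 :=
    (abs_le.1 (abs_expect_le fun s _ => abs_sq_vEst_le G P fc D b t (h + 1) (by omega) s)).2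
  rw [nextVar]
  linarith [sq_nonneg (nextMean G P fc D b t h (D.z t h))]

theorem nextVar_nonneg (b : Bool) (t h : ℕ) : 0 ≤ nextVar G P fc D b t h := by
  have := sq_expect_le (p := G.trans h (D.z t h)) (abs_vEst_le G P fc D b t (h + 1) (by omega))
  rw [nextVar, nextSq, nextMean]
  linarith

section Congr

variable {D} {D' : Obs S A} {b : Bool} {h k : ℕ}

theorem data_congr (h1 : 1 ≤ h) (hH : h ≤ H) (hD : ActAgree H (k + 1) h D D') :
    D.z (k + 1) h = D'.z (k + 1) h ∧
      vEst G P fc D b (k + 1) (h + 1) = vEst G P fc D' b (k + 1) (h + 1) ∧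
      rVal G P fc D b (k + 1) h = rVal G P fc D' b (k + 1) h :=
  ⟨hD.z_eq (by omega) h1, vEst_congr G P fc b (hD.1.mono (by omega) (by omega)) (by omega),
    rVal_congr G P fc b hD (by omega) h1 hH⟩

theorem input₁_congr (h1 : 1 ≤ h) (hH : h ≤ H) (hD : ActAgree H (k + 1) h D D') :
    input₁ G P fc D b h k = input₁ G P fc D' b h k := by
  obtain ⟨e1, e2, e3⟩ := data_congr G P fc (b := b) h1 hH hD
  rw [input₁, input₁, e1, e2, e3]

theorem input₂_congr (h1 : 1 ≤ h) (hH : h ≤ H) (hD : ActAgree H (k + 1) h D D') :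
    input₂ G P fc D b h k = input₂ G P fc D' b h k := by
  obtain ⟨e1, e2, e3⟩ := data_congr G P fc (b := b) h1 hH hD
  rw [input₂, input₂, e1, e2]

theorem noise₁_congr (h1 : 1 ≤ h) (hH : h ≤ H) (hD : ActAgree H (k + 1) h D D') :
    noise₁ G P fc D b h k = noise₁ G P fc D' b h k := by
  obtain ⟨e1, e2, e3⟩ := data_congr G P fc (b := b) h1 hH hD
  funext s
  rw [noise₁, noise₁, nextMean, nextMean, e1, e2, e3]

theorem noise₁'_congr (h1 : 1 ≤ h) (hH : h ≤ H) (hD : ActAgree H (k + 1) h D D') :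
    noise₁' G P fc D b h k = noise₁' G P fc D' b h k := by
  obtain ⟨e1, e2, e3⟩ := data_congr G P fc (b := b) h1 hH hD
  funext s
  rw [noise₁', noise₁', noise₁_congr G P fc h1 hH hD, nextVar, nextVar, nextSq, nextSq, nextMean,
    nextMean, e1, e2, e3]

theorem noise₂_congr (h1 : 1 ≤ h) (hH : h ≤ H) (hD : ActAgree H (k + 1) h D D') :
    noise₂ G P fc D b h k = noise₂ G P fc D' b h k := by
  obtain ⟨e1, e2, e3⟩ := data_congr G P fc (b := b) h1 hH hD
  funext s
  rw [noise₂, noise₂, nextSq, nextSq, e1, e2]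

end Congr

end GoodEvent

/-! ### The probability of the good event -/

section Likely

variable {Ω : Type*} [MeasurableSpace Ω] {μ : Measure Ω}

/-- `p` fails with probability at most `c`. -/
def Likely (μ : Measure Ω) (c : ℝ) (p : Ω → Prop) : Prop := μ {ω | ¬ p ω} ≤ ENNReal.ofReal c

theorem Likely.and {c c' : ℝ} {p q : Ω → Prop} (hp : Likely μ c p) (hq : Likely μ c' q)
    (hc : 0 ≤ c) (hc' : 0 ≤ c') : Likely μ (c + c') fun ω => p ω ∧ q ω := by
  rw [Likely, ENNReal.ofReal_add hc hc']
  refine (measure_mono fun ω hω => ?_).trans ((measure_union_le _ _).trans (add_le_add hp hq))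
  by_contra h
  simp only [Set.mem_union, Set.mem_ofPred_eq, not_or, not_not] at h
  exact hω h

theorem Likely.forall_bool {c : ℝ} {p : Bool → Ω → Prop} (hp : ∀ b, Likely μ c (p b))
    (hc : 0 ≤ c) : Likely μ (c + c) fun ω => ∀ b, p b ω := by
  have := (hp false).and (hp true) hc hc
  simpa only [Bool.forall_bool] using this

theorem sum_inv_sq_le (T : ℕ) : ∑ t ∈ Finset.Icc 1 T, 1 / (t : ℝ) ^ 2 ≤ 2 := by
  suffices h : ∀ n : ℕ, ∑ t ∈ Finset.Icc 1 (n + 1), 1 / (t : ℝ) ^ 2 ≤ 2 - 1 / ((n : ℝ) + 1) by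
    rcases T with _ | n
    · simp
    · have : (0 : ℝ) < 1 / ((n : ℝ) + 1) := by positivity
      linarith [h n]
  intro n
  induction n with
  | zero => norm_num
  | succ n ih =>
    rw [Finset.sum_Icc_succ_top (by omega)]
    push_cast
    have h1 : (1 : ℝ) / ((n : ℝ) + 1 + 1) ^ 2 ≤ 1 / ((n : ℝ) + 1) - 1 / ((n : ℝ) + 1 + 1) := by
      have e : 1 / ((n : ℝ) + 1) - 1 / ((n : ℝ) + 1 + 1) = 1 / (((n : ℝ) + 1) * ((n : ℝ) + 1 + 1)) := by
        field_simp
        ring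
      rw [e]
      apply one_div_le_one_div_of_le (by positivity)
      nlinarith [(Nat.cast_nonneg n : (0 : ℝ) ≤ n)]
    linarith

theorem exp_neg_three_log_le {t H : ℕ} {δ : ℝ} (ht : 1 ≤ t) (hH : 1 ≤ H) (hδ : 0 < δ)
    (hδ1 : δ < 1) : Real.exp (-(3 * Real.log (4 * (t : ℝ) ^ 2 * H / δ)))
      ≤ δ / (64 * (t : ℝ) ^ 2 * H) := by
  have ht1 : (1 : ℝ) ≤ t := by exact_mod_cast ht
  have hH1 : (1 : ℝ) ≤ H := by exact_mod_cast hH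
  have hx : 0 < 4 * (t : ℝ) ^ 2 * H / δ := by positivity
  have e : Real.exp (-(3 * Real.log (4 * (t : ℝ) ^ 2 * H / δ)))
      = (δ / (4 * (t : ℝ) ^ 2 * H)) ^ 3 := by
    rw [← mul_neg, ← Real.log_inv, inv_div]
    have : (3 : ℝ) = ((3 : ℕ) : ℝ) := by norm_num
    rw [this, ← Real.log_pow, Real.exp_log (by positivity)]
  rw [e, div_pow, div_le_div_iff₀ (by positivity) (by positivity)]
  have h1 : δ ^ 3 ≤ δ := by nlinarith [mul_pos hδ hδ]
  have h2 : (1 : ℝ) ≤ t ^ 2 * H := by nlinarith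
  have h3 : (t : ℝ) ^ 2 * H ≤ (t ^ 2 * H) ^ 3 := le_self_pow₀ h2 (by norm_num)
  calc δ ^ 3 * (64 * (t : ℝ) ^ 2 * H) ≤ δ * (64 * (t : ℝ) ^ 2 * H) := by gcongr
    _ = δ * 64 * (t ^ 2 * H) := by ring
    _ ≤ δ * 64 * (t ^ 2 * H) ^ 3 := by gcongr
    _ = _ := by ring

/-- A union bound over all episodes and steps. -/
theorem Likely.forall_mem {T H : ℕ} {δ : ℝ} (hH : 1 ≤ H) (hδ : 0 < δ) (hδ1 : δ < 1)
    {p : ℕ → ℕ → Ω → Prop} (hp : ∀ t ∈ Finset.Icc 1 T, ∀ h ∈ Finset.Icc 1 H,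
      Likely μ (Real.exp (-(3 * Real.log (4 * (t : ℝ) ^ 2 * H / δ)))) (p t h)) :
    Likely μ (δ / 32) fun ω => ∀ t ∈ Finset.Icc 1 T, ∀ h ∈ Finset.Icc 1 H, p t h ω := by
  have hH0 : (0 : ℝ) < H := by exact_mod_cast hH
  have hsub : {ω | ¬ ∀ t ∈ Finset.Icc 1 T, ∀ h ∈ Finset.Icc 1 H, p t h ω}
      ⊆ ⋃ t ∈ Finset.Icc 1 T, ⋃ h ∈ Finset.Icc 1 H, {ω | ¬ p t h ω} := by
    intro ω hω
    simp only [Set.mem_ofPred_eq, not_forall] at hω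
    obtain ⟨t, ht, h, hh, hp⟩ := hω
    simp only [Set.mem_iUnion]
    exact ⟨t, ht, h, hh, hp⟩
  refine (measure_mono hsub).trans ((measure_biUnion_finset_le _ _).trans ?_)
  have h1 : ∀ t ∈ Finset.Icc 1 T, μ (⋃ h ∈ Finset.Icc 1 H, {ω | ¬ p t h ω})
      ≤ ENNReal.ofReal (δ / 64 * (1 / (t : ℝ) ^ 2)) := by
    intro t ht
    have ht1 := (Finset.mem_Icc.1 ht).1
    have ht0 : (0 : ℝ) < t := by exact_mod_cast ht1
    calc _ ≤ ∑ h ∈ Finset.Icc 1 H, μ {ω | ¬ p t h ω} := measure_biUnion_finset_le _ _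
      _ ≤ ∑ _h ∈ Finset.Icc 1 H, ENNReal.ofReal (δ / (64 * (t : ℝ) ^ 2 * H)) :=
        Finset.sum_le_sum fun h hh => (hp t ht h hh).trans
          (ENNReal.ofReal_le_ofReal (exp_neg_three_log_le ht1 hH hδ hδ1))
      _ = ENNReal.ofReal (δ / 64 * (1 / (t : ℝ) ^ 2)) := by
        rw [← ENNReal.ofReal_sum_of_nonneg fun _ _ => by positivity]
        congr 1
        simp only [Finset.sum_const, Nat.card_Icc, nsmul_eq_mul, Nat.add_sub_cancel]
        field_simp
  refine (Finset.sum_le_sum h1).trans ?_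
  rw [← ENNReal.ofReal_sum_of_nonneg fun t _ => by positivity, ← Finset.mul_sum]
  apply ENNReal.ofReal_le_ofReal
  have := sum_inv_sq_le T
  nlinarith

theorem Likely.mono {c c' : ℝ} {p q : Ω → Prop} (hp : Likely μ c p) (hc : c ≤ c')
    (h : ∀ ω, p ω → q ω) : Likely μ c' q :=
  (measure_mono fun ω (hω : ¬ q ω) hpω => hω (h ω hpω)).trans (hp.trans (ENNReal.ofReal_le_ofReal hc))

theorem Likely.le_measure [IsProbabilityMeasure μ] {c : ℝ} {p : Ω → Prop} (hp : Likely μ c p)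
    (hc : 0 ≤ c) : ENNReal.ofReal (1 - c) ≤ μ {ω | p ω} := by
  have h1 : (1 : ENNReal) ≤ μ {ω | p ω} + ENNReal.ofReal c := by
    calc (1 : ENNReal) = μ Set.univ := measure_univ.symm
      _ ≤ μ ({ω | p ω} ∪ {ω | ¬ p ω}) := measure_mono fun ω _ => Classical.em (p ω)
      _ ≤ _ := (measure_union_le _ _).trans (add_le_add le_rfl hp)
  rw [ENNReal.ofReal_sub _ hc, ENNReal.ofReal_one]
  exact tsub_le_iff_right.2 h1

end Likely

section Run

variable {S A F Ω : Type*} [NormedAddCommGroup F] [InnerProductSpace ℝ F] {H T : ℕ}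
  [Countable S] [MeasurableSpace S] [DiscreteMeasurableSpace S] [Finite A]
  [MeasurableSpace A] [DiscreteMeasurableSpace A] [mΩ : MeasurableSpace Ω] {μ : Measure Ω}
  [IsProbabilityMeasure μ] {G : Game S A F H} {P : Params} {fc : CCEFinder S A}
  {X : ℕ → ℕ → Ω → S} {Y : ℕ → ℕ → Ω → A × A}

theorem IsRun.likely_goodEvent (hrun : IsRun μ G P fc T X Y) (hT : 1 ≤ T) (hH : 1 ≤ H) {B d δ : ℝ}
    (hδ : 0 < δ) (hδ1 : δ < 1) (hd : d = G.effDim T (1 / B ^ 2))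
    (hP : P.Good H T B d fun t => Real.log (4 * (t : ℝ) ^ 2 * H / δ)) :
    Likely μ δ fun ω => GoodEvent G P fc (obs X Y ω) T d
      fun t => Real.log (4 * (t : ℝ) ^ 2 * H / δ) := by
  have hH0 : (0 : ℝ) < H := by exact_mod_cast hH
  have hd0 : 0 < d := by linarith [hP.d_ge]
  have hα := hP.alpha_pos
  have hLT : 0 < Real.log (4 * (T : ℝ) ^ 2 * H / δ) := by linarith [hP.L_ge T hT]
  have hAz : ENNReal.ofReal (Real.exp (-(3 * Real.log (4 * (T : ℝ) ^ 2 * H / δ))))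
      ≤ ENNReal.ofReal (δ / 32) := by
    refine ENNReal.ofReal_le_ofReal ((exp_neg_three_log_le hT hH hδ hδ1).trans ?_)
    have hT1 : (1 : ℝ) ≤ T := by exact_mod_cast hT
    have hH1 : (1 : ℝ) ≤ H := by exact_mod_cast hH
    have : (1 : ℝ) ≤ T ^ 2 * H := by nlinarith
    apply div_le_div_of_nonneg_left hδ.le (by norm_num)
    nlinarith
  have c1' := fun b => Likely.forall_mem (μ := μ) (T := T) hH hδ hδ1
    (p := fun t h ω => noiseNorm P.lam₁ (input₁ G P fc (obs X Y ω) b h)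
      (fun k => noise₁' G P fc (obs X Y ω) b h k (X (k + 1) (h + 1) ω)) (t - 1)
      ≤ 16 * 1 * √d * √(Real.log (4 * (t : ℝ) ^ 2 * H / δ))
        + 4 * (2 * H / P.alpha) * Real.log (4 * (t : ℝ) ^ 2 * H / δ)) fun t ht h hh => by
    obtain ⟨ht1, htT⟩ := Finset.mem_Icc.1 ht
    obtain ⟨hh1, hhH⟩ := Finset.mem_Icc.1 hh
    simp only [Likely, not_le]
    refine hrun.measure_noiseNorm_le hh1 hhH (n := t - 1) (by omega)
      (fun D k => noise₁' G P fc D b h k) (fun D => input₁ G P fc D b h) hP.lam₁_pos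
      (by positivity) one_pos hd0 (hP.L_ge t ht1) (fun D k s => ?_) (fun D k => ?_)
      (fun D k => ?_) (fun D D' k hD => noise₁'_congr G P fc hh1 hhH hD)
      (fun D D' k hD => input₁_congr G P fc hh1 hhH hD)
      (fun D => sum_leverage_input₁_le G P fc D hH hP hd b h _ (by omega))
    · rw [noise₁']
      split_ifs
      · exact abs_noise₁_le G P fc D hα b h k s
      · rw [abs_zero]; positivity
    · change expect _ (fun s => noise₁' G P fc D b h k s) = 0
      simp only [noise₁']
      split_ifs
      · exact expect_noise₁ G P fc D b h k
      · exact expect_const 0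
    · simp only [noise₁']
      split_ifs with hv
      · rw [expect_noise₁_sq, one_pow, inv_mul_le_iff₀ ?_, mul_one]
        · exact hv
        · have := hα.trans_le (alpha_le_rVal G P fc D b (k + 1) h)
          positivity
      · rw [expect_const]; norm_num
  have c1 := fun b => Likely.forall_mem (μ := μ) (T := T) hH hδ hδ1
    (p := fun t h ω => noiseNorm P.lam₁ (input₁ G P fc (obs X Y ω) b h)
      (fun k => noise₁ G P fc (obs X Y ω) b h k (X (k + 1) (h + 1) ω)) (t - 1)
      ≤ 16 * (H / P.alpha) * √d * √(Real.log (4 * (t : ℝ) ^ 2 * H / δ))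
        + 4 * (2 * H / P.alpha) * Real.log (4 * (t : ℝ) ^ 2 * H / δ)) fun t ht h hh => by
    obtain ⟨ht1, htT⟩ := Finset.mem_Icc.1 ht
    obtain ⟨hh1, hhH⟩ := Finset.mem_Icc.1 hh
    simp only [Likely, not_le]
    refine hrun.measure_noiseNorm_le hh1 hhH (n := t - 1) (by omega)
      (fun D k => noise₁ G P fc D b h k) (fun D => input₁ G P fc D b h) hP.lam₁_pos
      (by positivity) (by positivity) hd0 (hP.L_ge t ht1)
      (fun D k s => abs_noise₁_le G P fc D hα b h k s) (fun D k => expect_noise₁ G P fc D b h k)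
      (fun D k => ?_) (fun D D' k hD => noise₁_congr G P fc hh1 hhH hD)
      (fun D D' k hD => input₁_congr G P fc hh1 hhH hD)
      (fun D => sum_leverage_input₁_le G P fc D hH hP hd b h _ (by omega))
    have hR := alpha_le_rVal G P fc D b (k + 1) h
    rw [expect_noise₁_sq, div_pow, inv_mul_eq_div]
    exact div_le_div₀ (by positivity) (nextVar_le G P fc D b _ h) (by positivity)
      (pow_le_pow_left₀ hα.le hR 2)
  have c2 := fun b => Likely.forall_mem (μ := μ) (T := T) hH hδ hδ1
    (p := fun t h ω => noiseNorm P.lam₂ (input₂ G P fc (obs X Y ω) b h)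
      (fun k => noise₂ G P fc (obs X Y ω) b h k (X (k + 1) (h + 1) ω)) (t - 1)
      ≤ 16 * (H : ℝ) ^ 2 * √d * √(Real.log (4 * (t : ℝ) ^ 2 * H / δ))
        + 4 * (2 * (H : ℝ) ^ 2) * Real.log (4 * (t : ℝ) ^ 2 * H / δ)) fun t ht h hh => by
    obtain ⟨ht1, htT⟩ := Finset.mem_Icc.1 ht
    obtain ⟨hh1, hhH⟩ := Finset.mem_Icc.1 hh
    simp only [Likely, not_le]
    have hb := fun D k => abs_sq_vEst_le G P fc D b (k + 1) (h + 1) (by omega)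
    refine hrun.measure_noiseNorm_le hh1 hhH (n := t - 1) (by omega)
      (fun D k => noise₂ G P fc D b h k) (fun D => input₂ G P fc D b h) hP.lam₂_pos
      (by positivity) (by positivity) hd0 (hP.L_ge t ht1) (fun D k s => ?_) (fun D k => ?_)
      (fun D k => ?_) (fun D D' k hD => noise₂_congr G P fc hh1 hhH hD)
      (fun D D' k hD => input₂_congr G P fc hh1 hhH hD)
      (fun D => sum_leverage_input₂_le G P fc D hH hP hd b h _ (by omega))
    · rw [noise₂, abs_sub_comm]
      exact abs_expect_sub_le (hb D k) s
    · change expect _ (fun s => noise₂ G P fc D b h k s) = 0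
      simp only [noise₂]
      rw [expect_sub (fun s _ => hb D k s) (fun _ _ => le_rfl), expect_const, nextSq, sub_self]
    · simp only [noise₂, nextSq]
      rw [expect_sub_sq (hb D k)]
      have h4 : expect (G.trans h (D.z (k + 1) h))
          (fun s => (vEst G P fc D b (k + 1) (h + 1) s ^ 2) ^ 2) ≤ ((H : ℝ) ^ 2) ^ 2 :=
        expect_le (C := ((H : ℝ) ^ 2) ^ 2)
          (fun s _ => by rw [abs_pow]; exact pow_le_pow_left₀ (abs_nonneg _) (hb D k s) 2)
          (fun s _ => pow_le_pow_left₀ (sq_nonneg _) (abs_le.1 (hb D k s)).2 2)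
      linarith [sq_nonneg (expect (G.trans h (D.z (k + 1) h))
        fun s => vEst G P fc D b (k + 1) (h + 1) s ^ 2)]
  have hstate : ∀ (f : Obs S A → ℕ → ℕ → S → ℝ) (c : ℝ), 0 < c →
      (∀ D t h, 1 ≤ h → ∀ s, |f D t h s| ≤ c) →
      (∀ D D' t h, 1 ≤ t → 1 ≤ h → h ≤ H → ActAgree H t h D D' → f D t h = f D' t h) →
      Likely μ (δ / 32) fun ω => ∑ t ∈ Finset.range T, ∑ h ∈ Finset.range H,
        (expect (G.trans (h + 1) ((obs X Y ω).z (t + 1) (h + 1))) (f (obs X Y ω) (t + 1) (h + 1))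
          - f (obs X Y ω) (t + 1) (h + 1) (X (t + 1) (h + 2) ω))
        ≤ 2 * c * √(6 * (T * H) * Real.log (4 * (T : ℝ) ^ 2 * H / δ)) := by
    intro f c hc hfc hf
    simp only [Likely, not_le]
    exact (hrun.measure_state_le hT hH f hc hLT hfc hf).trans hAz
  have hact : ∀ (f : Obs S A → ℕ → ℕ → A × A → ℝ) (c : ℝ), 0 < c →
      (∀ D t h s, |f D t h s| ≤ c) →
      (∀ D D' t h, 1 ≤ t → 1 ≤ h → h ≤ H → StateAgree H t h D D' → f D t h = f D' t h) →
      Likely μ (δ / 32) fun ω => ∑ t ∈ Finset.range T, ∑ h ∈ Finset.range H,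
        (expect (joint G P fc (obs X Y ω) (t + 1) (h + 1) (X (t + 1) (h + 1) ω))
          (f (obs X Y ω) (t + 1) (h + 1))
          - f (obs X Y ω) (t + 1) (h + 1) (Y (t + 1) (h + 1) ω))
        ≤ 2 * c * √(6 * (T * H) * Real.log (4 * (T : ℝ) ^ 2 * H / δ)) := by
    intro f c hc hfc hf
    simp only [Likely, not_le]
    exact (hrun.measure_act_le hT hH f hc hLT hfc hf).trans hAz
  have hv : ∀ {D D' : Obs S A} {t h : ℕ} (b : Bool), 1 ≤ h → h ≤ H → ActAgree H t h D D' →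
      vEst G P fc D b t (h + 1) = vEst G P fc D' b t (h + 1) := fun b h1 hH' hD =>
    vEst_congr G P fc b (hD.1.mono (by omega) (by omega)) (by omega)
  have hq : ∀ {D D' : Obs S A} {t h : ℕ} (b : Bool), 1 ≤ t → 1 ≤ h → h ≤ H →
      StateAgree H t h D D' → (fun c => qVal G P fc D b t h (D.x t h, c))
        = fun c => qVal G P fc D' b t h (D'.x t h, c) := fun b ht h1 hH' hD => by
    rw [qVal_congr G P fc b (hD.mono (by omega) (by omega)) h1 hH', hD.1 _ _ (by omega)]
  have g1 := hstate (fun D t h s => vEst G P fc D true t (h + 1) s - vEst G P fc D false t (h + 1) s)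
    (2 * H) (by positivity)
    (fun D t h _ s => (abs_sub _ _).trans (by
      linarith [abs_vEst_le G P fc D true t (h + 1) (by omega) s,
        abs_vEst_le G P fc D false t (h + 1) (by omega) s]))
    (fun D D' t h _ h1 h2 hD => by rw [hv true h1 h2 hD, hv false h1 h2 hD])
  have g2 := hact (fun D t h c => qVal G P fc D true t h (D.x t h, c)
      - qVal G P fc D false t h (D.x t h, c)) (2 * H) (by positivity)
    (fun D t h s => (abs_sub _ _).trans (by
      linarith [abs_qVal_le G P fc D true t h (D.x t h, s),
        abs_qVal_le G P fc D false t h (D.x t h, s)]))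
    (fun D D' t h h0 h1 h2 hD => by
      funext c
      rw [congrFun (hq true h0 h1 h2 hD) c, congrFun (hq false h0 h1 h2 hD) c])
  have g3 := fun b => hstate (fun D t h s => vEst G P fc D b t (h + 1) s ^ 2) ((H : ℝ) ^ 2)
    (by positivity) (fun D t h _ s => abs_sq_vEst_le G P fc D b t (h + 1) (by omega) s)
    (fun D D' t h _ h1 h2 hD => by rw [hv b h1 h2 hD])
  have g4 := fun b => hact (fun D t h c => qVal G P fc D b t h (D.x t h, c) ^ 2) ((H : ℝ) ^ 2)
    (by positivity)
    (fun D t h s => by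
      rw [abs_pow]
      exact pow_le_pow_left₀ (abs_nonneg _) (abs_qVal_le G P fc D b t h _) 2)
    (fun D D' t h h0 h1 h2 hD => by
      funext c
      rw [congrFun (hq b h0 h1 h2 hD) c])
  have h0 : 0 ≤ δ / 32 := by positivity
  have h00 := add_nonneg h0 h0
  have a1 := (Likely.forall_bool c1' h0).and (Likely.forall_bool c1 h0) h00 h00
  have a2 := (Likely.forall_bool c2 h0).and (g1.and g2 h0 h0) h00 h00
  have a3 := (Likely.forall_bool g3 h0).and (Likely.forall_bool g4 h0) h00 h00
  refine (a1.and (a2.and a3 (by positivity) (by positivity)) (by positivity) (by positivity)).mono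
    (by linarith) fun ω h => ?_
  obtain ⟨⟨b1, b2⟩, ⟨b3, b4, b5⟩, b6, b7⟩ := h
  exact ⟨b1, b2, b3, b4, b5, b6, b7⟩

end Run

/-! ### Validity of the estimates on the good event -/

section Estimates

variable {S A F : Type*} [NormedAddCommGroup F] [InnerProductSpace ℝ F] {H : ℕ}
  {G : Game S A F H} {P : Params} {fc : CCEFinder S A} {D : Obs S A}

variable (G P fc D) in
/-- The width of the weighted regression in the direction of the next value estimate. -/
def width₁ (b : Bool) (t h : ℕ) (z : S × A × A) : ℝ :=
  width P.lam₁ (psi₁ G D (pastOf G P fc D b t) h) (G.feat (vEst G P fc D b t (h + 1)) z)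

variable (G P fc D) in
/-- The width of the second moment regression. -/
def width₂ (b : Bool) (t h : ℕ) (z : S × A × A) : ℝ :=
  width P.lam₂ (psi₂ G D (pastOf G P fc D b t) h)
    (G.feat (fun s => vEst G P fc D b t (h + 1) s ^ 2) z)

theorem width_nonneg {n : ℕ} (lam : ℝ) (ψ : Fin n → F) (f : F) : 0 ≤ width lam ψ f :=
  mul_nonneg (inv_nonneg.2 (Real.sqrt_nonneg _)) (Real.sqrt_nonneg _)

theorem psi₁_eq (b : Bool) (t h : ℕ) : psi₁ G D (pastOf G P fc D b t) h
    = fun i : Fin (t - 1) => input₁ G P fc D b h i := by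
  funext i
  rw [psi₁, pastOf, record_R, record_V, input₁]

theorem psi₂_eq (b : Bool) (t h : ℕ) : psi₂ G D (pastOf G P fc D b t) h
    = fun i : Fin (t - 1) => input₂ G P fc D b h i := by
  funext i
  rw [psi₂, pastOf, record_V, input₂]

theorem out₁_eq (hH : 1 ≤ H) (b : Bool) (t h : ℕ) (hh : h ∈ Finset.Icc 1 H) :
    out₁ D (pastOf G P fc D b t) h = fun i : Fin (t - 1) =>
      ⟪input₁ G P fc D b h i, G.theta h⟫_ℝ + noise₁ G P fc D b h i (D.x (i + 1) (h + 1)) := by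
  have hH0 : (0 : ℝ) < H := by exact_mod_cast hH
  funext i
  rw [out₁, pastOf, record_R, record_V, input₁, noise₁, real_inner_smul_left,
    G.inner_feat_theta hH0 (abs_vEst_le G P fc D b _ _ (by omega)) hh, nextMean]
  ring

theorem out₂_eq (hH : 1 ≤ H) (b : Bool) (t h : ℕ) (hh : h ∈ Finset.Icc 1 H) :
    out₂ D (pastOf G P fc D b t) h = fun i : Fin (t - 1) =>
      ⟪input₂ G P fc D b h i, G.theta h⟫_ℝ + noise₂ G P fc D b h i (D.x (i + 1) (h + 1)) := by
  have hH0 : (0 : ℝ) < H := by exact_mod_cast hH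
  funext i
  rw [out₂, pastOf, record_V, input₂, noise₂,
    G.inner_feat_theta (C := (H : ℝ) ^ 2) (by positivity)
      (abs_sq_vEst_le G P fc D b _ _ (by omega)) hh, nextSq]
  ring

variable {T : ℕ} {B d : ℝ} {L : ℕ → ℝ}

/-- The confidence set of the weighted regression, in terms of any noise sequence that coincides with
the actual one before episode `t`. -/
theorem abs_inner_theta₁_sub_le (hH : 1 ≤ H) (hlam : 0 < P.lam₁) (b : Bool) (t h : ℕ)
    (hh : h ∈ Finset.Icc 1 H) (hB : ‖G.theta h‖ ≤ B) (η : ℕ → ℝ)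
    (hη : ∀ k < t - 1, η k = noise₁ G P fc D b h k (D.x (k + 1) (h + 1))) (z : S × A × A) :
    |⟪G.feat (vEst G P fc D b t (h + 1)) z, theta₁ G P D (pastOf G P fc D b t) h⟫_ℝ
      - nextMean G P fc D b t h z|
      ≤ (noiseNorm P.lam₁ (input₁ G P fc D b h) η (t - 1) + √P.lam₁ * B)
        * width₁ G P fc D b t h z := by
  have hH0 : (0 : ℝ) < H := by exact_mod_cast hH
  have e : (fun i : Fin (t - 1) => ⟪input₁ G P fc D b h i, G.theta h⟫_ℝ
      + noise₁ G P fc D b h i (D.x (i + 1) (h + 1)))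
      = fun i : Fin (t - 1) => ⟪input₁ G P fc D b h i, G.theta h⟫_ℝ + η i := by
    funext i
    rw [hη i i.isLt]
  have key := abs_inner_ridge_sub_le (input₁ G P fc D b h) (t - 1) hlam (G.theta h) η
    (G.feat (vEst G P fc D b t (h + 1)) z)
  rw [width₁, theta₁, out₁_eq hH b t h hh, psi₁_eq, e, nextMean,
    ← G.inner_feat_theta hH0 (abs_vEst_le G P fc D b t (h + 1) (by omega)) hh]
  refine key.trans (mul_le_mul_of_nonneg_right ?_ (width_nonneg _ _ _))
  rw [noiseNorm]
  gcongr

theorem abs_inner_theta₂_sub_le (hH : 1 ≤ H) (hlam : 0 < P.lam₂) (b : Bool) (t h : ℕ)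
    (hh : h ∈ Finset.Icc 1 H) (hB : ‖G.theta h‖ ≤ B) (z : S × A × A) :
    |⟪G.feat (fun s => vEst G P fc D b t (h + 1) s ^ 2) z,
        theta₂ G P D (pastOf G P fc D b t) h⟫_ℝ - nextSq G P fc D b t h z|
      ≤ (noiseNorm P.lam₂ (input₂ G P fc D b h)
          (fun k => noise₂ G P fc D b h k (D.x (k + 1) (h + 1))) (t - 1) + √P.lam₂ * B)
        * width₂ G P fc D b t h z := by
  have hH0 : (0 : ℝ) < H := by exact_mod_cast hH
  have key := abs_inner_ridge_sub_le (input₂ G P fc D b h) (t - 1) hlam (G.theta h)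
    (fun k => noise₂ G P fc D b h k (D.x (k + 1) (h + 1)))
    (G.feat (fun s => vEst G P fc D b t (h + 1) s ^ 2) z)
  rw [width₂, theta₂, out₂_eq hH b t h hh, psi₂_eq, nextSq,
    ← G.inner_feat_theta (C := (H : ℝ) ^ 2) (by positivity)
      (abs_sq_vEst_le G P fc D b t (h + 1) (by omega)) hh]
  refine key.trans (mul_le_mul_of_nonneg_right ?_ (width_nonneg _ _ _))
  rw [noiseNorm]
  gcongr

variable (G P fc D) in
/-- The error margin of the variance estimate along the observed trajectory. -/
def margin (b : Bool) (t h : ℕ) : ℝ :=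
  min ((H : ℝ) ^ 2) (P.beta₂ t * width₂ G P fc D b t h (D.z t h))
    + min ((H : ℝ) ^ 2) (2 * H * P.beta₁ t * width₁ G P fc D b t h (D.z t h))

theorem abs_nextMean_le (b : Bool) (t h : ℕ) (z : S × A × A) : |nextMean G P fc D b t h z| ≤ H :=
  abs_expect_le fun s _ => abs_vEst_le G P fc D b t (h + 1) (by omega) s

theorem nextSq_mem (b : Bool) (t h : ℕ) (z : S × A × A) :
    nextSq G P fc D b t h z ∈ Set.Icc 0 ((H : ℝ) ^ 2) :=
  ⟨expect_nonneg fun _ => sq_nonneg _,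
    (abs_le.1 (abs_expect_le fun s _ => abs_sq_vEst_le G P fc D b t (h + 1) (by omega) s)).2⟩

theorem abs_sq_sub_sq_le {x y c : ℝ} (hx : |x| ≤ c) (hy : |y| ≤ c) :
    |x ^ 2 - y ^ 2| ≤ 2 * c * |x - y| := by
  have e : x ^ 2 - y ^ 2 = (x + y) * (x - y) := by ring
  rw [e, abs_mul]
  gcongr
  exact (abs_add_le x y).trans (by linarith)

/-- The variance estimate is accurate up to the margin. -/
theorem abs_varEst_sub_le (hH : 1 ≤ H) (hP : P.Good H T B d L)
    (hE : GoodEvent G P fc D T d L) (b : Bool) (t h : ℕ) (ht : t ∈ Finset.Icc 1 T)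
    (hh : h ∈ Finset.Icc 1 H) (hB : ‖G.theta h‖ ≤ B) :
    |varEst G P D (pastOf G P fc D b t) h (vEst G P fc D b t (h + 1)) (D.z t h)
      - nextVar G P fc D b t h| ≤ margin G P fc D b t h := by
  have hH0 : (0 : ℝ) ≤ H := Nat.cast_nonneg H
  have h1 : |⟪G.feat (vEst G P fc D b t (h + 1)) (D.z t h),
      theta₁ G P D (pastOf G P fc D b t) h⟫_ℝ - nextMean G P fc D b t h (D.z t h)|
      ≤ P.beta₁ t * width₁ G P fc D b t h (D.z t h) := by
    refine (abs_inner_theta₁_sub_le hH hP.lam₁_pos b t h hh hB _ (fun k _ => rfl) _).trans ?_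
    refine mul_le_mul_of_nonneg_right ?_ (width_nonneg _ _ _)
    rw [hP.beta₁_eq]
    linarith [hE.conf₁ b t ht h hh]
  have h2 : |⟪G.feat (fun s => vEst G P fc D b t (h + 1) s ^ 2) (D.z t h),
      theta₂ G P D (pastOf G P fc D b t) h⟫_ℝ - nextSq G P fc D b t h (D.z t h)|
      ≤ P.beta₂ t * width₂ G P fc D b t h (D.z t h) := by
    refine (abs_inner_theta₂_sub_le hH hP.lam₂_pos b t h hh hB _).trans ?_
    refine mul_le_mul_of_nonneg_right ?_ (width_nonneg _ _ _)
    rw [hP.beta₂_eq]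
    linarith [hE.conf₂ b t ht h hh]
  have hm := abs_nextMean_le (G := G) (P := P) (fc := fc) (D := D) b t h (D.z t h)
  have hs := nextSq_mem (G := G) (P := P) (fc := fc) (D := D) b t h (D.z t h)
  rw [varEst, nextVar, margin]
  generalize ⟪G.feat (vEst G P fc D b t (h + 1)) (D.z t h),
    theta₁ G P D (pastOf G P fc D b t) h⟫_ℝ = x at h1
  generalize ⟪G.feat (fun s => vEst G P fc D b t (h + 1) s ^ 2) (D.z t h),
    theta₂ G P D (pastOf G P fc D b t) h⟫_ℝ = y at h2
  generalize nextMean G P fc D b t h (D.z t h) = m at h1 hm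
  generalize nextSq G P fc D b t h (D.z t h) = q at h2 hs
  have hx := abs_clip_le hH0 x
  have hy := clip_mem (sq_nonneg (H : ℝ)) y
  have e1 : |clip 0 ((H : ℝ) ^ 2) y - q|
      ≤ min ((H : ℝ) ^ 2) (P.beta₂ t * width₂ G P fc D b t h (D.z t h)) := by
    refine le_min (abs_le.2 ⟨by linarith [hs.2, hy.1], by linarith [hs.1, hy.2]⟩) ?_
    calc _ = |clip 0 ((H : ℝ) ^ 2) y - clip 0 ((H : ℝ) ^ 2) q| := by rw [clip_of_mem hs]
      _ ≤ _ := (abs_clip_sub_le _ _ _ _).trans h2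
  have e2 : |clip (-H) H x ^ 2 - m ^ 2|
      ≤ min ((H : ℝ) ^ 2) (2 * H * P.beta₁ t * width₁ G P fc D b t h (D.z t h)) := by
    refine le_min ?_ ?_
    · have i1 : clip (-H) H x ^ 2 ≤ (H : ℝ) ^ 2 := by
        rw [← sq_abs]; exact pow_le_pow_left₀ (abs_nonneg _) hx 2
      have i2 : m ^ 2 ≤ (H : ℝ) ^ 2 := by
        rw [← sq_abs]; exact pow_le_pow_left₀ (abs_nonneg _) hm 2
      exact abs_le.2 ⟨by linarith [sq_nonneg (clip (-H) H x)], by linarith [sq_nonneg m]⟩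
    · refine (abs_sq_sub_sq_le hx hm).trans ?_
      have h3 : |clip (-H) H x - m| ≤ P.beta₁ t * width₁ G P fc D b t h (D.z t h) :=
        calc _ = |clip (-H) H x - clip (-H) H m| := by rw [clip_of_mem (x := m) (abs_le.1 hm)]
          _ ≤ _ := (abs_clip_sub_le _ _ _ _).trans h1
      calc 2 * (H : ℝ) * |clip (-H) H x - m|
          ≤ 2 * H * (P.beta₁ t * width₁ G P fc D b t h (D.z t h)) := by gcongr
        _ = _ := by ring
  calc _ = |(clip 0 ((H : ℝ) ^ 2) y - q) - (clip (-H) H x ^ 2 - m ^ 2)| := by congr 1; ring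
    _ ≤ _ := (abs_sub _ _).trans (add_le_add e1 e2)

theorem rVal_sq (b : Bool) (t h : ℕ) : rVal G P fc D b t h ^ 2
    = max (varEst G P D (pastOf G P fc D b t) h (vEst G P fc D b t (h + 1)) (D.z t h)
      + margin G P fc D b t h) (P.alpha ^ 2) :=
  Real.sq_sqrt ((sq_nonneg _).trans (le_max_right _ _))

theorem nextVar_le_rVal_sq (hH : 1 ≤ H) (hP : P.Good H T B d L)
    (hE : GoodEvent G P fc D T d L) (b : Bool) (t h : ℕ) (ht : t ∈ Finset.Icc 1 T)
    (hh : h ∈ Finset.Icc 1 H) (hB : ‖G.theta h‖ ≤ B) :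
    nextVar G P fc D b t h ≤ rVal G P fc D b t h ^ 2 := by
  rw [rVal_sq]
  refine le_max_of_le_left ?_
  linarith [(abs_le.1 (abs_varEst_sub_le hH hP hE b t h ht hh hB)).1]

theorem margin_nonneg (b : Bool) (t h : ℕ) (hβ₁ : 0 ≤ P.beta₁ t)
    (hβ₂ : 0 ≤ P.beta₂ t) : 0 ≤ margin G P fc D b t h := by
  have hw1 := width_nonneg P.lam₁ (psi₁ G D (pastOf G P fc D b t) h)
    (G.feat (vEst G P fc D b t (h + 1)) (D.z t h))
  have hw2 := width_nonneg P.lam₂ (psi₂ G D (pastOf G P fc D b t) h)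
    (G.feat (fun s => vEst G P fc D b t (h + 1) s ^ 2) (D.z t h))
  have hH0 : (0 : ℝ) ≤ H := Nat.cast_nonneg H
  exact add_nonneg (le_min (sq_nonneg _) (mul_nonneg hβ₂ hw2))
    (le_min (sq_nonneg _) (mul_nonneg (by positivity) hw1))

theorem rVal_sq_le (hH : 1 ≤ H) (hP : P.Good H T B d L)
    (hE : GoodEvent G P fc D T d L) (b : Bool) (t h : ℕ) (ht : t ∈ Finset.Icc 1 T)
    (hh : h ∈ Finset.Icc 1 H) (hB : ‖G.theta h‖ ≤ B) (hm : 0 ≤ margin G P fc D b t h) :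
    rVal G P fc D b t h ^ 2
      ≤ nextVar G P fc D b t h + 2 * margin G P fc D b t h + P.alpha ^ 2 := by
  rw [rVal_sq]
  have h1 := (abs_le.1 (abs_varEst_sub_le hH hP hE b t h ht hh hB)).2
  have h2 := nextVar_nonneg G P fc D b t h
  exact max_le (by linarith [sq_nonneg P.alpha]) (by linarith)

theorem rVal_sq_le_const (hP : P.Good H T B d L) (b : Bool) (t h : ℕ) :
    rVal G P fc D b t h ^ 2 ≤ 3 * (H : ℝ) ^ 2 := by
  rw [rVal_sq]
  refine max_le ?_ ?_
  · have h1 : varEst G P D (pastOf G P fc D b t) h (vEst G P fc D b t (h + 1)) (D.z t h)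
        ≤ (H : ℝ) ^ 2 := by
      rw [varEst]
      have := (clip_mem (sq_nonneg (H : ℝ)) ⟪G.feat (fun s => vEst G P fc D b t (h + 1) s ^ 2)
        (D.z t h), theta₂ G P D (pastOf G P fc D b t) h⟫_ℝ).2
      linarith [sq_nonneg (clip (-H) H ⟪G.feat (vEst G P fc D b t (h + 1)) (D.z t h),
        theta₁ G P D (pastOf G P fc D b t) h⟫_ℝ)]
    have h2 : margin G P fc D b t h ≤ (H : ℝ) ^ 2 + (H : ℝ) ^ 2 :=
      add_le_add (min_le_left _ _) (min_le_left _ _)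
    linarith
  · rw [hP.alpha_sq, div_le_iff₀ (by linarith [hP.d_ge])]
    nlinarith [hP.d_ge, sq_nonneg (H : ℝ)]

/-- The Bernstein confidence set: as the normalizations dominate the variances in all earlier
episodes, the truncation of the noise has no effect. -/
theorem abs_inner_theta₁_sub_le_beta (hH : 1 ≤ H) (hP : P.Good H T B d L)
    (hE : GoodEvent G P fc D T d L) (b : Bool) (t h : ℕ) (ht : t ∈ Finset.Icc 1 T)
    (hh : h ∈ Finset.Icc 1 H) (hB : ‖G.theta h‖ ≤ B) (z : S × A × A) :
    |⟪G.feat (vEst G P fc D b t (h + 1)) z, theta₁ G P D (pastOf G P fc D b t) h⟫_ℝ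
      - nextMean G P fc D b t h z| ≤ P.beta t * width₁ G P fc D b t h z := by
  have htT := Finset.mem_Icc.1 ht
  refine (abs_inner_theta₁_sub_le hH hP.lam₁_pos b t h hh hB
    (fun k => noise₁' G P fc D b h k (D.x (k + 1) (h + 1))) (fun k hk => ?_) z).trans ?_
  · exact if_pos (nextVar_le_rVal_sq hH hP hE b (k + 1) h (by simp; omega) hh hB)
  · refine mul_le_mul_of_nonneg_right ?_ (width_nonneg _ _ _)
    rw [hP.beta_eq]
    linarith [hE.conf₁' b t ht h hh]

end Estimates

/-! ### Optimism -/

/-- Finite expectations commute. -/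
theorem expect_comm {α β : Type*} [Finite α] [Finite β] (p : PMF α) (q : PMF β) (f : α → β → ℝ) :
    expect p (fun a => expect q (f a)) = expect q fun b => expect p fun a => f a b := by
  have := Fintype.ofFinite α
  have := Fintype.ofFinite β
  simp only [expect, tsum_fintype, Finset.mul_sum]
  rw [Finset.sum_comm]
  exact Finset.sum_congr rfl fun _ _ => Finset.sum_congr rfl fun _ _ => by ring

section Optimism

variable {S A F : Type*} [NormedAddCommGroup F] [InnerProductSpace ℝ F] {H T : ℕ}
  {G : Game S A F H} {P : Params} {fc : CCEFinder S A} {D : Obs S A} {B d : ℝ} {L : ℕ → ℝ}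

variable (G P fc D) in
/-- Twice the exploration bonus, truncated at the range of the value estimates. It bounds the error
of the action value estimate at a triplet. -/
def bonus (b : Bool) (t h : ℕ) (z : S × A × A) : ℝ :=
  min (2 * H) (2 * P.beta t * width₁ G P fc D b t h z)

variable (G P fc D) in
/-- The action value estimate before clipping. -/
def rawQ (b : Bool) (t h : ℕ) (z : S × A × A) : ℝ :=
  G.reward h z + ⟪G.feat (vEst G P fc D b t (h + 1)) z,
    theta₁ G P D (pastOf G P fc D b t) h⟫_ℝ + sgn b * (P.beta t * width₁ G P fc D b t h z)

theorem qVal_eq_clip (b : Bool) (t h : ℕ) (z : S × A × A) :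
    qVal G P fc D b t h z = clip (-H) H (rawQ G P fc D b t h z) := rfl

section Step

variable (hH : 1 ≤ H) (hP : P.Good H T B d L) (hE : GoodEvent G P fc D T d L)
  (hB : ∀ h ∈ Finset.Icc 1 H, ‖G.theta h‖ ≤ B) {t h : ℕ} (ht : t ∈ Finset.Icc 1 T)
  (hh : h ∈ Finset.Icc 1 H)

include hH hP hE hB ht hh

theorem rawQ_true_mem (z : S × A × A) : rawQ G P fc D true t h z ∈
    Set.Icc (G.reward h z + nextMean G P fc D true t h z)
      (G.reward h z + nextMean G P fc D true t h z + 2 * P.beta t * width₁ G P fc D true t h z) := by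
  have := abs_le.1 (abs_inner_theta₁_sub_le_beta hH hP hE true t h ht hh (hB h hh) z)
  simp only [rawQ, sgn, one_mul]
  exact ⟨by linarith, by linarith⟩

theorem rawQ_false_mem (z : S × A × A) : rawQ G P fc D false t h z ∈
    Set.Icc (G.reward h z + nextMean G P fc D false t h z
        - 2 * P.beta t * width₁ G P fc D false t h z)
      (G.reward h z + nextMean G P fc D false t h z) := by
  have := abs_le.1 (abs_inner_theta₁_sub_le_beta hH hP hE false t h ht hh (hB h hh) z)
  simp only [rawQ, sgn]
  exact ⟨by linarith, by linarith⟩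

theorem reward_add_le_qVal_true {U : S → ℝ} (hU : ∀ y, |U y| ≤ (H : ℝ) - h)
    (hUV : ∀ y, U y ≤ vEst G P fc D true t (h + 1) y) (z : S × A × A) :
    G.reward h z + expect (G.trans h z) U ≤ qVal G P fc D true t h z := by
  have h1 : (1 : ℝ) ≤ h := by exact_mod_cast (Finset.mem_Icc.1 hh).1
  have hr := G.reward_mem h hh z
  have he := abs_le.1 (abs_expect_le (p := G.trans h z) fun y _ => hU y)
  have hmem : G.reward h z + expect (G.trans h z) U ∈ Set.Icc (-(H : ℝ)) H :=
    ⟨by linarith [hr.1, he.1], by linarith [hr.2, he.2]⟩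
  have hm : expect (G.trans h z) U ≤ nextMean G P fc D true t h z :=
    expect_mono (fun y _ => hU y) (fun y _ => abs_vEst_le G P fc D true t (h + 1) (by omega) y)
      fun y _ => hUV y
  rw [qVal_eq_clip, ← clip_of_mem hmem]
  exact clip_mono _ _ (by linarith [(rawQ_true_mem hH hP hE hB ht hh z).1])

theorem qVal_false_le_reward_add {U : S → ℝ} (hU : ∀ y, |U y| ≤ (H : ℝ) - h)
    (hUV : ∀ y, vEst G P fc D false t (h + 1) y ≤ U y) (z : S × A × A) :
    qVal G P fc D false t h z ≤ G.reward h z + expect (G.trans h z) U := by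
  have h1 : (1 : ℝ) ≤ h := by exact_mod_cast (Finset.mem_Icc.1 hh).1
  have hr := G.reward_mem h hh z
  have he := abs_le.1 (abs_expect_le (p := G.trans h z) fun y _ => hU y)
  have hmem : G.reward h z + expect (G.trans h z) U ∈ Set.Icc (-(H : ℝ)) H :=
    ⟨by linarith [hr.1, he.1], by linarith [hr.2, he.2]⟩
  have hm : nextMean G P fc D false t h z ≤ expect (G.trans h z) U :=
    expect_mono (fun y _ => abs_vEst_le G P fc D false t (h + 1) (by omega) y) (fun y _ => hU y)
      fun y _ => hUV y
  rw [qVal_eq_clip, ← clip_of_mem hmem]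
  exact clip_mono _ _ (by linarith [(rawQ_false_mem hH hP hE hB ht hh z).2])

theorem abs_qVal_sub_nextMean_le (b : Bool) (z : S × A × A) :
    |qVal G P fc D b t h z - nextMean G P fc D b t h z| ≤ 1 + bonus G P fc D b t h z := by
  have hr := G.reward_mem h hh z
  have hm := abs_nextMean_le (G := G) (P := P) (fc := fc) (D := D) b t h z
  have hq := abs_qVal_le G P fc D b t h z
  rw [bonus, ← min_add_add_left]
  refine le_min ((abs_sub _ _).trans (by linarith)) ?_
  calc _ = |clip (-H) H (rawQ G P fc D b t h z) - clip (-H) H (nextMean G P fc D b t h z)| := by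
        rw [qVal_eq_clip, clip_of_mem (x := nextMean G P fc D b t h z) (abs_le.1 hm)]
    _ ≤ _ := abs_clip_sub_le _ _ _ _
    _ ≤ _ := by
        cases b
        · have := rawQ_false_mem hH hP hE hB ht hh z
          exact abs_le.2 ⟨by linarith [this.1, hr.1], by linarith [this.1, this.2, hr.2]⟩
        · have := rawQ_true_mem hH hP hE hB ht hh z
          exact abs_le.2 ⟨by linarith [this.1, this.2, hr.1], by linarith [this.2, hr.2]⟩

/-- The gap of the action values is at most the expected gap of the next values, plus the
bonuses. -/
theorem qVal_gap_le (z : S × A × A)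
    (hle : ∀ y, vEst G P fc D false t (h + 1) y ≤ vEst G P fc D true t (h + 1) y) :
    qVal G P fc D true t h z - qVal G P fc D false t h z ≤
      expect (G.trans h z) (fun s => vEst G P fc D true t (h + 1) s
        - vEst G P fc D false t (h + 1) s)
      + bonus G P fc D true t h z + bonus G P fc D false t h z := by
  have hV := fun b => abs_vEst_le G P fc D b t (h + 1) (by omega)
  have h0 : 0 ≤ expect (G.trans h z) (fun s => vEst G P fc D true t (h + 1) s
      - vEst G P fc D false t (h + 1) s) := expect_nonneg fun s => by linarith [hle s]
  have e : expect (G.trans h z) (fun s => vEst G P fc D true t (h + 1) s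
      - vEst G P fc D false t (h + 1) s)
      = nextMean G P fc D true t h z - nextMean G P fc D false t h z :=
    expect_sub (fun s _ => hV true s) fun s _ => hV false s
  have m1 := rawQ_true_mem hH hP hE hB ht hh z
  have m2 := rawQ_false_mem hH hP hE hB ht hh z
  have b1 : 0 ≤ 2 * P.beta t * width₁ G P fc D true t h z := by linarith [m1.1, m1.2]
  have b2 : 0 ≤ 2 * P.beta t * width₁ G P fc D false t h z := by linarith [m2.1, m2.2]
  have q1 := abs_le.1 (abs_qVal_le G P fc D true t h z)
  have q2 := abs_le.1 (abs_qVal_le G P fc D false t h z)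
  have hH0 : (0 : ℝ) ≤ 2 * H := by positivity
  rw [bonus, bonus]
  rcases le_total (2 * (H : ℝ)) (2 * P.beta t * width₁ G P fc D true t h z) with c1 | c1
  · rw [min_eq_left c1]
    linarith [le_min hH0 b2]
  rcases le_total (2 * (H : ℝ)) (2 * P.beta t * width₁ G P fc D false t h z) with c2 | c2
  · rw [min_eq_left c2]
    linarith [le_min hH0 b1]
  rw [min_eq_right c1, min_eq_right c2, e]
  rw [e] at h0
  have hc : qVal G P fc D true t h z - qVal G P fc D false t h z
      ≤ max 0 (rawQ G P fc D true t h z - rawQ G P fc D false t h z) := by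
    rw [qVal_eq_clip, qVal_eq_clip]
    rcases le_total (rawQ G P fc D true t h z) (rawQ G P fc D false t h z) with c | c
    · exact le_max_of_le_left (by linarith [clip_mono (-(H : ℝ)) H c])
    · refine le_max_of_le_right ?_
      have := abs_clip_sub_le (-(H : ℝ)) H (rawQ G P fc D true t h z) (rawQ G P fc D false t h z)
      rw [abs_of_nonneg (sub_nonneg.2 c)] at this
      exact (le_abs_self _).trans this
  refine hc.trans (max_le (by linarith) (by linarith [m1.2, m2.1]))

end Step

section Values

variable (hH : 1 ≤ H) (hP : P.Good H T B d L) (hE : GoodEvent G P fc D T d L)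
  (hB : ∀ h ∈ Finset.Icc 1 H, ‖G.theta h‖ ≤ B) {t : ℕ} (ht : t ∈ Finset.Icc 1 T)

include hH hP hE hB ht

/-- Optimism: no policy of the maximizing player does better against `ν^t` than the optimistic
estimate. -/
theorem value_le_vEst_true (π : Policy S A) (h : ℕ) (h1 : 1 ≤ h) (hh : h ≤ H + 1) (x : S) :
    G.value π (minPolicy G P fc D t) h x ≤ vEst G P fc D true t h x := by
  refine G.value_le π _ (fun h x => vEst G P fc D true t h x) (fun x => by simp [vEst_last])
    (fun h h1 hh U hU hUV x => ?_) h h1 hh x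
  have hh' : h ∈ Finset.Icc 1 H := Finset.mem_Icc.2 ⟨h1, hh⟩
  have hb : ∀ a b, |G.reward h (x, a, b) + expect (G.trans h (x, a, b)) U|
      ≤ 1 + ((H : ℝ) - h) := fun a b =>
    (abs_add_le _ _).trans (add_le_add (abs_le.2 (G.reward_mem h hh' _))
      (abs_expect_le fun y _ => hU y))
  refine expect_le (fun a _ => abs_expect_le fun b _ => hb a b) fun a _ => ?_
  refine (expect_mono (fun b _ => hb a b) (fun b _ => abs_qVal_le G P fc D true t h (x, a, b))
    fun b _ => reward_add_le_qVal_true hH hP hE hB ht hh' hU hUV _).trans ?_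
  rw [vEst_eq_expect G P fc D true t h h1 hh]
  have := (fc.isCCE (qVal G P fc D true t h) (qVal G P fc D false t h) x).1 a
  rwa [← joint_eq] at this

variable [Finite A]

/-- The mirror image of `value_le_vEst_true` for the minimizing player. -/
theorem vEst_false_le_value (ν : Policy S A) (h : ℕ) (h1 : 1 ≤ h) (hh : h ≤ H + 1) (x : S) :
    vEst G P fc D false t h x ≤ G.value (maxPolicy G P fc D t) ν h x := by
  refine G.le_value _ ν (fun h x => vEst G P fc D false t h x) (fun x => by simp [vEst_last])
    (fun h h1 hh U hU hUV x => ?_) h h1 hh x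
  have hh' : h ∈ Finset.Icc 1 H := Finset.mem_Icc.2 ⟨h1, hh⟩
  have hb : ∀ a b, |G.reward h (x, a, b) + expect (G.trans h (x, a, b)) U|
      ≤ 1 + ((H : ℝ) - h) := fun a b =>
    (abs_add_le _ _).trans (add_le_add (abs_le.2 (G.reward_mem h hh' _))
      (abs_expect_le fun y _ => hU y))
  rw [expect_comm]
  refine le_expect (fun b _ => abs_expect_le fun a _ => hb a b) fun b _ => ?_
  refine le_trans ?_ (expect_mono (fun a _ => abs_qVal_le G P fc D false t h (x, a, b))
    (fun a _ => hb a b) fun a _ => qVal_false_le_reward_add hH hP hE hB ht hh' hU hUV _)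
  rw [vEst_eq_expect G P fc D false t h h1 hh]
  have := (fc.isCCE (qVal G P fc D true t h) (qVal G P fc D false t h) x).2 b
  rwa [← joint_eq] at this

theorem vEst_false_le_true (h : ℕ) (h1 : 1 ≤ h) (hh : h ≤ H + 1) (x : S) :
    vEst G P fc D false t h x ≤ vEst G P fc D true t h x :=
  (vEst_false_le_value hH hP hE hB ht (minPolicy G P fc D t) h h1 hh x).trans
    (value_le_vEst_true hH hP hE hB ht (maxPolicy G P fc D t) h h1 hh x)

/-- The duality gap is at most the gap of the value estimates. -/
theorem maxValue_sub_minValue_le (x : S) :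
    G.maxValue (minPolicy G P fc D t) 1 x - G.minValue (maxPolicy G P fc D t) 1 x
      ≤ vEst G P fc D true t 1 x - vEst G P fc D false t 1 x := by
  have : Nonempty (Policy S A) := ⟨maxPolicy G P fc D t⟩
  have h1 : G.maxValue (minPolicy G P fc D t) 1 x ≤ vEst G P fc D true t 1 x :=
    ciSup_le fun π => value_le_vEst_true hH hP hE hB ht π 1 le_rfl (by omega) x
  have h2 : vEst G P fc D false t 1 x ≤ G.minValue (maxPolicy G P fc D t) 1 x :=
    le_ciInf fun ν => vEst_false_le_value hH hP hE hB ht ν 1 le_rfl (by omega) x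
  linarith

end Values

end Optimism

/-! ### The regret decomposition -/

section Regret

variable {S A F : Type*} [NormedAddCommGroup F] [InnerProductSpace ℝ F] {H T : ℕ}
  {G : Game S A F H} {P : Params} {fc : CCEFinder S A} {D : Obs S A} {B d : ℝ} {L : ℕ → ℝ}

theorem sum_Icc_one_eq_range (f : ℕ → ℝ) (T : ℕ) :
    ∑ t ∈ Finset.Icc 1 T, f t = ∑ t ∈ Finset.range T, f (t + 1) := by
  rw [Finset.range_eq_Ico, Finset.sum_Ico_add' f 0 T 1]
  rfl

variable (G P fc D T) in
/-- The sum of the bonuses along the observed trajectories. -/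
def sumBonus (b : Bool) : ℝ := ∑ t ∈ Finset.range T, ∑ h ∈ Finset.range H,
  bonus G P fc D b (t + 1) (h + 1) (D.z (t + 1) (h + 1))

variable (hH : 1 ≤ H) (hP : P.Good H T B d L) (hE : GoodEvent G P fc D T d L)
  (hB : ∀ h ∈ Finset.Icc 1 H, ‖G.theta h‖ ≤ B)

include hH hP hE hB

/-- The regret is at most the sum of the bonuses, up to martingale terms. -/
theorem regret_le_sumBonus [Finite A] :
    regret G P fc D T ≤ sumBonus T G P fc D true + sumBonus T G P fc D false
      + 8 * H * √(6 * (T * H) * L T) := by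
  let gapV : ℕ → ℕ → ℝ := fun t h => vEst G P fc D true (t + 1) (h + 1) (D.x (t + 1) (h + 1))
    - vEst G P fc D false (t + 1) (h + 1) (D.x (t + 1) (h + 1))
  have key : ∀ t ∈ Finset.range T, ∀ h ∈ Finset.range H, gapV t h - gapV t (h + 1) ≤
      (expect (G.trans (h + 1) (D.z (t + 1) (h + 1)))
        (fun s => vEst G P fc D true (t + 1) (h + 2) s - vEst G P fc D false (t + 1) (h + 2) s)
        - (vEst G P fc D true (t + 1) (h + 2) (D.x (t + 1) (h + 2))
          - vEst G P fc D false (t + 1) (h + 2) (D.x (t + 1) (h + 2))))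
      + (expect (joint G P fc D (t + 1) (h + 1) (D.x (t + 1) (h + 1)))
        (fun c => qVal G P fc D true (t + 1) (h + 1) (D.x (t + 1) (h + 1), c)
          - qVal G P fc D false (t + 1) (h + 1) (D.x (t + 1) (h + 1), c))
        - (qVal G P fc D true (t + 1) (h + 1) (D.z (t + 1) (h + 1))
          - qVal G P fc D false (t + 1) (h + 1) (D.z (t + 1) (h + 1))))
      + bonus G P fc D true (t + 1) (h + 1) (D.z (t + 1) (h + 1))
      + bonus G P fc D false (t + 1) (h + 1) (D.z (t + 1) (h + 1)) := by
    intro t ht h hh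
    have ht' : t + 1 ∈ Finset.Icc 1 T := by simp at ht ⊢; omega
    have hh' : h + 1 ∈ Finset.Icc 1 H := by simp at hh ⊢; omega
    have hhH := (Finset.mem_Icc.1 hh').2
    have e1 : gapV t h = expect (joint G P fc D (t + 1) (h + 1) (D.x (t + 1) (h + 1)))
        (fun c => qVal G P fc D true (t + 1) (h + 1) (D.x (t + 1) (h + 1), c)
          - qVal G P fc D false (t + 1) (h + 1) (D.x (t + 1) (h + 1), c)) := by
      rw [expect_sub (fun c _ => abs_qVal_le G P fc D true _ _ _)
        (fun c _ => abs_qVal_le G P fc D false _ _ _)]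
      simp only [gapV]
      rw [vEst_eq_expect G P fc D true _ _ (by omega) hhH,
        vEst_eq_expect G P fc D false _ _ (by omega) hhH]
    have h2 := qVal_gap_le hH hP hE hB ht' hh' (D.z (t + 1) (h + 1))
      fun y => vEst_false_le_true hH hP hE hB ht' (h + 1 + 1) (by omega) (by omega) y
    have e2 : gapV t (h + 1) = vEst G P fc D true (t + 1) (h + 2) (D.x (t + 1) (h + 2))
          - vEst G P fc D false (t + 1) (h + 2) (D.x (t + 1) (h + 2)) := rfl
    rw [e1, e2]
    linarith
  have hlast : ∀ t, gapV t H = 0 := fun t => by simp [gapV, vEst_last]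
  calc regret G P fc D T
      ≤ ∑ t ∈ Finset.Icc 1 T, (vEst G P fc D true t 1 (D.x t 1) - vEst G P fc D false t 1 (D.x t 1)) :=
        Finset.sum_le_sum fun t ht => maxValue_sub_minValue_le hH hP hE hB ht _
    _ = ∑ t ∈ Finset.range T, gapV t 0 := sum_Icc_one_eq_range _ T
    _ = ∑ t ∈ Finset.range T, ∑ h ∈ Finset.range H, (gapV t h - gapV t (h + 1)) := by
        refine Finset.sum_congr rfl fun t _ => ?_
        rw [Finset.sum_range_sub', hlast, sub_zero]
    _ ≤ _ := Finset.sum_le_sum fun t ht => Finset.sum_le_sum fun h hh => key t ht h hh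
    _ ≤ _ := by
        simp only [Finset.sum_add_distrib]
        have g1 := hE.gap_state
        have g2 := hE.gap_act
        rw [sumBonus, sumBonus]
        linarith

/-- The sum of the conditional variances telescopes (the law of total variance), up to martingale
terms and the bonuses. -/
theorem sum_nextVar_le (b : Bool) :
    ∑ t ∈ Finset.range T, ∑ h ∈ Finset.range H, nextVar G P fc D b (t + 1) (h + 1)
      ≤ 4 * (H : ℝ) ^ 2 * √(6 * (T * H) * L T) + 2 * (H : ℝ) ^ 2 * T
        + 2 * H * sumBonus T G P fc D b := by
  let sqV : ℕ → ℕ → ℝ := fun t h => vEst G P fc D b (t + 1) (h + 1) (D.x (t + 1) (h + 1)) ^ 2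
  have key : ∀ t ∈ Finset.range T, ∀ h ∈ Finset.range H, nextVar G P fc D b (t + 1) (h + 1) ≤
      (nextSq G P fc D b (t + 1) (h + 1) (D.z (t + 1) (h + 1))
        - vEst G P fc D b (t + 1) (h + 2) (D.x (t + 1) (h + 2)) ^ 2)
      + (expect (joint G P fc D (t + 1) (h + 1) (D.x (t + 1) (h + 1)))
        (fun c => qVal G P fc D b (t + 1) (h + 1) (D.x (t + 1) (h + 1), c) ^ 2)
        - qVal G P fc D b (t + 1) (h + 1) (D.z (t + 1) (h + 1)) ^ 2)
      + (2 * H * 1 + 2 * H * bonus G P fc D b (t + 1) (h + 1) (D.z (t + 1) (h + 1)))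
      - (sqV t h - sqV t (h + 1)) := by
    intro t ht h hh
    have ht' : t + 1 ∈ Finset.Icc 1 T := by simp at ht ⊢; omega
    have hh' : h + 1 ∈ Finset.Icc 1 H := by simp at hh ⊢; omega
    have h1 : sqV t h ≤ expect (joint G P fc D (t + 1) (h + 1) (D.x (t + 1) (h + 1)))
        (fun c => qVal G P fc D b (t + 1) (h + 1) (D.x (t + 1) (h + 1), c) ^ 2) := by
      simp only [sqV]
      rw [vEst_eq_expect G P fc D b _ _ (by omega) (Finset.mem_Icc.1 hh').2]
      exact sq_expect_le fun c => abs_qVal_le G P fc D b _ _ _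
    have h2 : qVal G P fc D b (t + 1) (h + 1) (D.z (t + 1) (h + 1)) ^ 2
        - nextMean G P fc D b (t + 1) (h + 1) (D.z (t + 1) (h + 1)) ^ 2
        ≤ 2 * H * (1 + bonus G P fc D b (t + 1) (h + 1) (D.z (t + 1) (h + 1))) :=
      (le_abs_self _).trans <| (abs_sq_sub_sq_le (abs_qVal_le G P fc D b _ _ _)
        (abs_nextMean_le b _ _ _)).trans <| mul_le_mul_of_nonneg_left
          (abs_qVal_sub_nextMean_le hH hP hE hB ht' hh' b _) (by positivity)
    have e2 : sqV t (h + 1) = vEst G P fc D b (t + 1) (h + 2) (D.x (t + 1) (h + 2)) ^ 2 := rfl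
    rw [e2, nextVar]
    linarith
  have htel : 0 ≤ ∑ t ∈ Finset.range T, ∑ h ∈ Finset.range H, (sqV t h - sqV t (h + 1)) := by
    refine Finset.sum_nonneg fun t _ => ?_
    rw [Finset.sum_range_sub']
    have hlast : sqV t H = 0 := by simp [sqV, vEst_last]
    rw [hlast, sub_zero]
    exact sq_nonneg _
  refine (Finset.sum_le_sum fun t ht => Finset.sum_le_sum fun h hh => key t ht h hh).trans ?_
  simp only [Finset.sum_add_distrib, Finset.sum_sub_distrib, ← Finset.mul_sum] at htel ⊢
  have g1 := hE.sq_state b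
  have g2 := hE.sq_act b
  simp only [Finset.sum_sub_distrib] at g1 g2
  simp only [Finset.sum_const, Finset.card_range, nsmul_eq_mul, mul_one]
  rw [sumBonus]
  linarith

end Regret

/-! ### Bounds for the sums of the widths -/

/-- The radii of the confidence sets, up to constants and logarithms. The choice of `α` gives
`H / α = √d`, and `1 ≤ 2 √d` absorbs lower powers of `√d`. -/
theorem Params.Good.beta_le {P : Params} {H T : ℕ} {B d : ℝ} {L : ℕ → ℝ} (hP : P.Good H T B d L)
    (hT : 1 ≤ T) : P.beta T ≤ 25 * (√d * L T) ∧ P.beta₁ T ≤ 34 * (d * L T) ∧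
      P.beta₂ T ≤ 34 * ((H : ℝ) ^ 2 * (√d * L T)) := by
  have hd := hP.d_ge
  have hd0 : 0 < √d := Real.sqrt_pos.2 (by linarith)
  have hdd : √d * √d = d := Real.mul_self_sqrt (by linarith)
  have hd1 : 1 ≤ 2 * √d := by nlinarith
  have hα := hP.alpha_pos
  have hHα : (H : ℝ) / P.alpha = √d := by
    have h1 := hP.alpha_sq
    rw [eq_div_iff (by linarith), ← hdd] at h1
    have h2 : P.alpha * √d = H := by
      rw [← Real.sqrt_sq (mul_pos hα hd0).le, ← Real.sqrt_sq (Nat.cast_nonneg H : (0 : ℝ) ≤ H)]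
      congr 1
      linarith
    rw [div_eq_iff hα.ne', ← h2, mul_comm]
  have hL := hP.L_ge T hT
  have hLs : √(L T) ≤ L T := by
    rw [Real.sqrt_le_left (by linarith)]
    nlinarith
  have hs0 := Real.sqrt_nonneg (L T)
  have b1 := hP.bias₁
  have a1 : √d * √(L T) ≤ √d * L T := by gcongr
  have a2 : √d ≤ √d * L T := le_mul_of_one_le_right hd0.le hL
  have a3 : √d * L T ≤ 2 * (d * L T) := by
    have h1 : √d * L T ≤ √d * L T * (2 * √d) := le_mul_of_one_le_right (by positivity) hd1
    have h2 : √d * L T * (2 * √d) = 2 * (√d * √d * L T) := by ring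
    rw [hdd] at h2
    linarith
  have a4 : 2 * (H : ℝ) / P.alpha = 2 * √d := by rw [mul_div_assoc, hHα]
  refine ⟨?_, ?_, ?_⟩
  · rw [hP.beta_eq, a4]
    linarith
  · rw [hP.beta₁_eq, a4, hHα, mul_assoc 16, hdd]
    have : d * √(L T) ≤ d * L T := by gcongr
    linarith
  · rw [hP.beta₂_eq, hP.bias₂]
    have a5 : (H : ℝ) ≤ (H : ℝ) ^ 2 := by exact_mod_cast Nat.le_self_pow two_ne_zero H
    have a6 : (H : ℝ) ^ 2 * (√d * √(L T)) ≤ (H : ℝ) ^ 2 * (√d * L T) := by gcongr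
    have a7 : (H : ℝ) ^ 2 * L T ≤ 2 * ((H : ℝ) ^ 2 * (√d * L T)) := by
      have : 0 ≤ (H : ℝ) ^ 2 * L T := by positivity
      nlinarith
    have a8 : (H : ℝ) ^ 2 ≤ (H : ℝ) ^ 2 * L T := le_mul_of_one_le_right (sq_nonneg _) hL
    linarith

theorem Params.Good.beta_mono {P : Params} {H T : ℕ} {B d : ℝ} {L : ℕ → ℝ} (hP : P.Good H T B d L)
    {t : ℕ} (h1 : 1 ≤ t) (ht : t ≤ T) : P.beta t ≤ P.beta T ∧ P.beta₁ t ≤ P.beta₁ T ∧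
      P.beta₂ t ≤ P.beta₂ T := by
  have hα := hP.alpha_pos
  have hL := hP.L_mono t h1 ht
  simp only [hP.beta_eq, hP.beta₁_eq, hP.beta₂_eq]
  refine ⟨?_, ?_, ?_⟩ <;> gcongr

/-- Lower bounds for the radii, which make the truncations of the widths harmless. -/
theorem Params.Good.le_beta {P : Params} {H T : ℕ} {B d : ℝ} {L : ℕ → ℝ} (hP : P.Good H T B d L)
    (hH : 1 ≤ H) {t : ℕ} (h1 : 1 ≤ t) : H ≤ P.beta t * P.alpha ∧ H ≤ P.beta₁ t * P.alpha ∧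
      (H : ℝ) ^ 2 ≤ P.beta₂ t := by
  have hα := hP.alpha_pos
  have hL := hP.L_ge t h1
  have hH0 : (0 : ℝ) < H := by exact_mod_cast hH
  have hB : 0 < B := by
    have := hP.bias₂
    exact pos_of_mul_pos_right (by rw [this]; exact hH0) (Real.sqrt_nonneg _)
  have key : H ≤ 4 * (2 * H / P.alpha) * L t * P.alpha := by
    have e : 4 * (2 * H / P.alpha) * L t * P.alpha = 8 * (H * L t) := by field_simp; ring
    rw [e]
    nlinarith
  rw [hP.beta_eq, hP.beta₁_eq, hP.beta₂_eq]
  refine ⟨?_, ?_, ?_⟩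
  · have : 0 ≤ (16 * 1 * √d * √(L t) + √P.lam₁ * B) * P.alpha := by positivity
    linarith
  · have : 0 ≤ (16 * (H / P.alpha) * √d * √(L t) + √P.lam₁ * B) * P.alpha := by positivity
    linarith
  · have h2 : 0 ≤ 16 * (H : ℝ) ^ 2 * √d * √(L t) + √P.lam₂ * B := by positivity
    have h3 : (H : ℝ) ^ 2 ≤ (H : ℝ) ^ 2 * L t := le_mul_of_one_le_right (sq_nonneg _) hL
    have h4 := sq_nonneg (H : ℝ)
    linarith

theorem covSq_smul {F : Type*} [NormedAddCommGroup F] [InnerProductSpace ℝ F] (lam : ℝ) (ψ : ℕ → F)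
    (n : ℕ) (c : ℝ) (f : F) : covSq lam ψ n (c • f) = c ^ 2 * covSq lam ψ n f := by
  simp only [covSq, map_smul, real_inner_smul_left, real_inner_smul_right]
  ring

/-- A Cauchy–Schwarz inequality for double sums. -/
theorem sum_sum_mul_sqrt_le {T H : ℕ} {a w : ℕ → ℕ → ℝ} (hw : ∀ t h, 0 ≤ w t h) {x y : ℝ}
    (hx : ∑ t ∈ Finset.range T, ∑ h ∈ Finset.range H, a t h ^ 2 ≤ x)
    (hy : ∑ t ∈ Finset.range T, ∑ h ∈ Finset.range H, w t h ≤ y) :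
    ∑ t ∈ Finset.range T, ∑ h ∈ Finset.range H, a t h * √(w t h) ≤ √x * √y := by
  have h0 : 0 ≤ ∑ t ∈ Finset.range T, ∑ h ∈ Finset.range H, a t h ^ 2 :=
    Finset.sum_nonneg fun _ _ => Finset.sum_nonneg fun _ _ => sq_nonneg _
  rw [← Real.sqrt_mul (h0.trans hx)]
  refine Real.le_sqrt_of_sq_le (le_trans ?_ (mul_le_mul hx hy (Finset.sum_nonneg fun t _ =>
    Finset.sum_nonneg fun h _ => hw t h) (h0.trans hx)))
  simp only [← Finset.sum_product']
  refine (Finset.sum_mul_sq_le_sq_mul_sq _ _ _).trans_eq ?_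
  congr 1
  exact Finset.sum_congr rfl fun p _ => Real.sq_sqrt (hw _ _)

/-- A width `r √ω`, multiplied by `c` and truncated at `m`, is at most `c r √(min 1 ω)`, provided
that `m ≤ c r`. -/
theorem min_mul_sqrt_le {m c r ω : ℝ} (hm : m ≤ c * r) :
    min m (c * (r * √ω)) ≤ c * (r * √(min 1 ω)) := by
  rcases le_total 1 ω with h | h
  · rw [min_eq_left h, Real.sqrt_one, mul_one]
    exact (min_le_left _ _).trans hm
  · rw [min_eq_right h]
    exact min_le_right _ _

section Sums

variable {S A F : Type*} [NormedAddCommGroup F] [InnerProductSpace ℝ F] {H T : ℕ}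
  {G : Game S A F H} {P : Params} {fc : CCEFinder S A} {D : Obs S A} {B d : ℝ} {L : ℕ → ℝ}

variable (T G P fc D) in
/-- The sum of the squared normalizations. -/
def sumSqR (b : Bool) : ℝ := ∑ t ∈ Finset.range T, ∑ h ∈ Finset.range H,
  rVal G P fc D b (t + 1) (h + 1) ^ 2

theorem width₁_eq (hlam : 0 < P.lam₁) (hα : 0 < P.alpha) (b : Bool) (t h : ℕ) :
    width₁ G P fc D b (t + 1) h (D.z (t + 1) h) = rVal G P fc D b (t + 1) h *
      √(covSq P.lam₁ (input₁ G P fc D b h) t (input₁ G P fc D b h t)) := by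
  have hR : 0 < rVal G P fc D b (t + 1) h := hα.trans_le (alpha_le_rVal G P fc D b _ h)
  have e : G.feat (vEst G P fc D b (t + 1) (h + 1)) (D.z (t + 1) h)
      = rVal G P fc D b (t + 1) h • input₁ G P fc D b h t := by
    rw [input₁, smul_smul, mul_inv_cancel₀ hR.ne', one_smul]
  rw [width₁, psi₁_eq, width_eq _ _ hlam, e, covSq_smul, Real.sqrt_mul (sq_nonneg _),
    Real.sqrt_sq hR.le, Nat.add_sub_cancel]

theorem width₂_eq (hlam : 0 < P.lam₂) (b : Bool) (t h : ℕ) :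
    width₂ G P fc D b (t + 1) h (D.z (t + 1) h) =
      1 * √(covSq P.lam₂ (input₂ G P fc D b h) t (input₂ G P fc D b h t)) := by
  rw [width₂, psi₂_eq, width_eq _ _ hlam, Nat.add_sub_cancel, one_mul]
  rfl

variable (hT : 1 ≤ T) (hH : 1 ≤ H) (hP : P.Good H T B d L)

theorem sum_min_covSq_le {ψ : ℕ → ℕ → F} {lam : ℝ} (hlam : 0 < lam)
    (hψ : ∀ h, ∑ k ∈ Finset.range T, leverage lam (ψ h) k ≤ 2 * d) :
    ∑ t ∈ Finset.range T, ∑ h ∈ Finset.range H, min 1 (covSq lam (ψ (h + 1)) t (ψ (h + 1) t))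
      ≤ 4 * (d * H) := by
  rw [Finset.sum_comm]
  calc _ ≤ ∑ h ∈ Finset.range H, 2 * ∑ t ∈ Finset.range T, leverage lam (ψ (h + 1)) t := by
        refine Finset.sum_le_sum fun h _ => ?_
        rw [Finset.mul_sum]
        exact Finset.sum_le_sum fun t _ => min_one_covSq_le _ hlam t
    _ ≤ ∑ h ∈ Finset.range H, 2 * (2 * d) :=
        Finset.sum_le_sum fun h _ => by linarith [hψ (h + 1)]
    _ = _ := by simp; ring

include hH hP

/-- The sum of the squared normalizations is at most the sum of the conditional variances, up to the
margins and the floor `α²`. -/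
theorem sumSqR_le (hE : GoodEvent G P fc D T d L)
    (hB : ∀ h ∈ Finset.Icc 1 H, ‖G.theta h‖ ≤ B) (b : Bool) :
    sumSqR T G P fc D b ≤ ∑ t ∈ Finset.range T, ∑ h ∈ Finset.range H,
        nextVar G P fc D b (t + 1) (h + 1)
      + 2 * ∑ t ∈ Finset.range T, ∑ h ∈ Finset.range H, margin G P fc D b (t + 1) (h + 1)
      + (H : ℝ) ^ 3 * T / d := by
  have hα := hP.alpha_pos
  have hH0 : (0 : ℝ) < H := by exact_mod_cast hH
  have e : (H : ℝ) ^ 3 * T / d = ∑ t ∈ Finset.range T, ∑ h ∈ Finset.range H, P.alpha ^ 2 := by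
    rw [hP.alpha_sq]
    simp
    ring
  rw [e, sumSqR]
  simp only [Finset.mul_sum, ← Finset.sum_add_distrib]
  refine Finset.sum_le_sum fun t ht => Finset.sum_le_sum fun h hh => ?_
  have ht' : t + 1 ∈ Finset.Icc 1 T := by simp at ht ⊢; omega
  have hh' : h + 1 ∈ Finset.Icc 1 H := by simp at hh ⊢; omega
  have hle := hP.le_beta hH (Nat.le_add_left 1 t)
  exact rVal_sq_le hH hP hE b _ _ ht' hh' (hB _ hh') (margin_nonneg b _ _
    (pos_of_mul_pos_left (hH0.trans_le hle.2.1) hα.le).le ((sq_nonneg _).trans hle.2.2))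

include hT

/-- The bonuses add up to at most a multiple of the root of the sum of the squared normalizations:
the Cauchy–Schwarz inequality and the bound for the leverages. -/
theorem sumBonus_le (hd : d = G.effDim T (1 / B ^ 2)) (b : Bool) :
    sumBonus T G P fc D b ≤ 2 * P.beta T * (√(sumSqR T G P fc D b) * √(4 * (d * H))) := by
  have hα := hP.alpha_pos
  have hH0 : (0 : ℝ) < H := by exact_mod_cast hH
  have hs := sum_sum_mul_sqrt_le (a := fun t h => rVal G P fc D b (t + 1) (h + 1))
    (w := fun t h => min 1 (covSq P.lam₁ (input₁ G P fc D b (h + 1)) t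
      (input₁ G P fc D b (h + 1) t))) (fun t h => le_min zero_le_one (covSq_nonneg _ hP.lam₁_pos _ _))
    (le_refl (sumSqR T G P fc D b)) (sum_min_covSq_le hP.lam₁_pos fun h =>
      sum_leverage_input₁_le G P fc D hH hP hd b h T le_rfl)
  have hβT : 0 ≤ 2 * P.beta T := by
    have := (hP.le_beta hH hT).1
    have := pos_of_mul_pos_left (hH0.trans_le this) hα.le
    linarith
  refine le_trans ?_ (mul_le_mul_of_nonneg_left hs hβT)
  rw [sumBonus, Finset.mul_sum]
  refine Finset.sum_le_sum fun t ht => ?_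
  rw [Finset.mul_sum]
  refine Finset.sum_le_sum fun h _ => ?_
  have hR := alpha_le_rVal G P fc D b (t + 1) (h + 1)
  have hβ := (hP.le_beta hH (Nat.le_add_left 1 t)).1
  have hβ0 := (pos_of_mul_pos_left (hH0.trans_le hβ) hα.le).le
  rw [bonus, width₁_eq hP.lam₁_pos hα]
  refine (min_mul_sqrt_le ?_).trans (mul_le_mul_of_nonneg_right ?_
    (mul_nonneg (hα.le.trans hR) (Real.sqrt_nonneg _)))
  · have := mul_le_mul_of_nonneg_left hR hβ0
    linarith
  · linarith [(hP.beta_mono (Nat.le_add_left 1 t) (Finset.mem_range.1 ht)).1]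

theorem sum_margin_le (hd : d = G.effDim T (1 / B ^ 2)) (b : Bool) :
    ∑ t ∈ Finset.range T, ∑ h ∈ Finset.range H, margin G P fc D b (t + 1) (h + 1)
      ≤ P.beta₂ T * (√(T * H) * √(4 * (d * H)))
        + 2 * H * P.beta₁ T * (√(3 * (H : ℝ) ^ 3 * T) * √(4 * (d * H))) := by
  have hα := hP.alpha_pos
  have hH0 : (0 : ℝ) < H := by exact_mod_cast hH
  have hs₁ := sum_sum_mul_sqrt_le (T := T) (H := H)
    (a := fun t h => rVal G P fc D b (t + 1) (h + 1))
    (w := fun t h => min 1 (covSq P.lam₁ (input₁ G P fc D b (h + 1)) t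
      (input₁ G P fc D b (h + 1) t))) (fun t h => le_min zero_le_one (covSq_nonneg _ hP.lam₁_pos _ _))
    (x := 3 * (H : ℝ) ^ 3 * T)
    ((Finset.sum_le_sum fun t _ => Finset.sum_le_sum fun h _ => rVal_sq_le_const hP b _ _).trans_eq
      (by simp; ring)) (sum_min_covSq_le hP.lam₁_pos fun h =>
      sum_leverage_input₁_le G P fc D hH hP hd b h T le_rfl)
  have hs₂ := sum_sum_mul_sqrt_le (T := T) (H := H) (a := fun _ _ => 1)
    (w := fun t h => min 1 (covSq P.lam₂ (input₂ G P fc D b (h + 1)) t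
      (input₂ G P fc D b (h + 1) t))) (fun t h => le_min zero_le_one (covSq_nonneg _ hP.lam₂_pos _ _))
    (x := T * H) (by simp) (sum_min_covSq_le hP.lam₂_pos fun h =>
      sum_leverage_input₂_le G P fc D hH hP hd b h T le_rfl)
  have hβ₁T : 0 ≤ 2 * H * P.beta₁ T := by
    have := pos_of_mul_pos_left (hH0.trans_le (hP.le_beta hH hT).2.1) hα.le
    positivity
  have hβ₂T : 0 ≤ P.beta₂ T := (sq_nonneg _).trans (hP.le_beta hH hT).2.2
  refine le_trans ?_ (add_le_add (mul_le_mul_of_nonneg_left hs₂ hβ₂T)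
    (mul_le_mul_of_nonneg_left hs₁ hβ₁T))
  simp only [Finset.mul_sum, ← Finset.sum_add_distrib]
  refine Finset.sum_le_sum fun t ht => Finset.sum_le_sum fun h _ => ?_
  have hR := alpha_le_rVal G P fc D b (t + 1) (h + 1)
  have hle := hP.le_beta hH (Nat.le_add_left 1 t)
  have hmono := hP.beta_mono (Nat.le_add_left 1 t) (Finset.mem_range.1 ht)
  have hβ0 := (pos_of_mul_pos_left (hH0.trans_le hle.2.1) hα.le).le
  rw [margin, width₁_eq hP.lam₁_pos hα, width₂_eq hP.lam₂_pos]
  refine add_le_add ((min_mul_sqrt_le (by rw [mul_one]; exact hle.2.2)).trans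
    (mul_le_mul_of_nonneg_right hmono.2.2 (by positivity)))
    ((min_mul_sqrt_le ?_).trans (mul_le_mul_of_nonneg_right ?_
      (mul_nonneg (hα.le.trans hR) (Real.sqrt_nonneg _))))
  · have h1 := mul_le_mul_of_nonneg_left hR hβ0
    have h2 : (H : ℝ) * H ≤ H * (P.beta₁ (t + 1) * rVal G P fc D b (t + 1) (h + 1)) :=
      mul_le_mul_of_nonneg_left (hle.2.1.trans h1) hH0.le
    have h3 : 0 ≤ (H : ℝ) * H := by positivity
    linarith
  · have := mul_le_mul_of_nonneg_left hmono.2.1 hH0.le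
    linarith

end Sums

/-! ### Solving the recursive inequality -/

/-- If `W` is bounded by the root of an affine function of `W`, then `W` is bounded. -/
theorem le_of_le_mul_sqrt {W R X c p : ℝ} (hc : 0 ≤ c) (hp : 0 ≤ p) (hX : 0 ≤ X)
    (hR0 : 0 ≤ R) (h1 : W ≤ c * √R) (h2 : R ≤ X + p * W) : W ≤ c ^ 2 * p + c * √X := by
  by_contra! h
  have hs := Real.sqrt_nonneg X
  have hW : 0 < W := lt_of_le_of_lt (by positivity) h
  have h3 : W ^ 2 ≤ c ^ 2 * R := by
    have := pow_le_pow_left₀ hW.le h1 2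
    rwa [mul_pow, Real.sq_sqrt hR0] at this
  have h4 : c ^ 2 * R ≤ c ^ 2 * X + c ^ 2 * p * W := by
    have := mul_le_mul_of_nonneg_left h2 (sq_nonneg c)
    linarith
  have h5 : W * (c ^ 2 * p + c * √X) < W * W := mul_lt_mul_of_pos_left h hW
  have h6 : c * √X * (c * √X) ≤ c * √X * W :=
    mul_le_mul_of_nonneg_left (by have : 0 ≤ c ^ 2 * p := by positivity
                                  linarith) (by positivity)
  have h7 : c * √X * (c * √X) = c ^ 2 * X := by
    rw [mul_mul_mul_comm, Real.mul_self_sqrt hX]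
    ring
  linarith

/-- The bound for the sum `W` of the bonuses, with `d = e²`, `H = g²`, `T = s²`, where `R` is the sum
of the squared normalizations. The terms of the bound for `R` come from the martingales, the total
variance, the margins, the floor `α²` and the contribution of `W` to the variances, in this order.
Multiplied by `(e² g)²`, the first and third of them are at most `y²`, and the second and fourth at
most `Y²`, up to constants and powers of `L`. -/
theorem sumBonus_le_of_recursion {W R L e g s Y y : ℝ} (hL : 1 ≤ L) (he : 0 < e) (hg : 1 ≤ g) (hs : 0 ≤ s)
    (hY0 : 0 ≤ Y) (hy0 : 0 ≤ y)
    (hY : Y ^ 2 = e ^ 2 * g ^ 8 * s ^ 2 + e ^ 4 * g ^ 6 * s ^ 2)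
    (hy : y ^ 4 = (e ^ 14 * g ^ 16 + e ^ 8 * g ^ 18) * s ^ 2)
    (hR0 : 0 ≤ R) (hW : W ≤ 100 * e ^ 2 * L * g * √R)
    (hR : R ≤ 12 * g ^ 5 * s * L + 2 * g ^ 4 * s ^ 2 + 752 * e ^ 3 * L * g ^ 6 * s
      + g ^ 6 * s ^ 2 / e ^ 2 + 2 * g ^ 2 * W) :
    W ≤ 20000 * L ^ 2 * (e ^ 4 * g ^ 6) + 2800 * L ^ 2 * (Y + 2 * y) := by
  have hg0 : 0 < g := by linarith
  have hL0 : 0 < L := by linarith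
  refine (le_of_le_mul_sqrt (by positivity) (by positivity) (by positivity) hR0 hW hR).trans
    (add_le_add ?_ ?_)
  · have : e ^ 4 * g ^ 4 ≤ e ^ 4 * g ^ 6 := by gcongr; norm_num
    have h2 : L ^ 2 * (e ^ 4 * g ^ 4) ≤ L ^ 2 * (e ^ 4 * g ^ 6) := by gcongr
    calc _ = 20000 * (L ^ 2 * (e ^ 4 * g ^ 4)) := by ring
      _ ≤ _ := by linarith
  · have hv : e ^ 7 * g ^ 8 * s + e ^ 4 * g ^ 7 * s ≤ 2 * y ^ 2 := by
      refine le_of_sq_le_sq ?_ (by positivity)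
      have h1 : e ^ 8 * g ^ 14 * s ^ 2 ≤ e ^ 8 * g ^ 18 * s ^ 2 := by gcongr; norm_num
      have h2 := sq_nonneg (e ^ 7 * g ^ 8 * s - e ^ 4 * g ^ 7 * s)
      have h3 : (2 * y ^ 2) ^ 2 = 4 * y ^ 4 := by ring
      rw [h3, hy]
      have : 0 ≤ e ^ 14 * g ^ 16 * s ^ 2 := by positivity
      have : 0 ≤ e ^ 8 * g ^ 18 * s ^ 2 := by positivity
      nlinarith
    have hq : (e ^ 2 * L * g) ^ 2 * (12 * g ^ 5 * s * L + 2 * g ^ 4 * s ^ 2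
        + 752 * e ^ 3 * L * g ^ 6 * s + g ^ 6 * s ^ 2 / e ^ 2) ≤ (28 * L ^ 2 * (Y + 2 * y)) ^ 2 := by
      have e1 : (e ^ 2 * L * g) ^ 2 * (12 * g ^ 5 * s * L + 2 * g ^ 4 * s ^ 2
          + 752 * e ^ 3 * L * g ^ 6 * s + g ^ 6 * s ^ 2 / e ^ 2)
          = L ^ 3 * (12 * (e ^ 4 * g ^ 7 * s) + 752 * (e ^ 7 * g ^ 8 * s))
            + L ^ 2 * (2 * (e ^ 4 * g ^ 6 * s ^ 2) + e ^ 2 * g ^ 8 * s ^ 2) := by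
        field_simp
        ring
      have a1 : 0 ≤ e ^ 4 * g ^ 7 * s := by positivity
      have a2 : 0 ≤ e ^ 7 * g ^ 8 * s := by positivity
      have a3 : 0 ≤ e ^ 4 * g ^ 6 * s ^ 2 := by positivity
      have a4 : 0 ≤ e ^ 2 * g ^ 8 * s ^ 2 := by positivity
      have l1 : L ^ 3 ≤ L ^ 4 := pow_le_pow_right₀ hL (by norm_num)
      have l2 : L ^ 2 ≤ L ^ 4 := pow_le_pow_right₀ hL (by norm_num)
      calc _ = _ := e1
        _ ≤ L ^ 4 * (784 * (2 * y ^ 2)) + L ^ 4 * (784 * Y ^ 2) := by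
            refine add_le_add (mul_le_mul l1 ?_ (by positivity) (by positivity))
              (mul_le_mul l2 ?_ (by positivity) (by positivity))
            · linarith
            · rw [hY]; linarith
        _ ≤ L ^ 4 * 784 * (Y + 2 * y) ^ 2 := by
            have : 2 * y ^ 2 + Y ^ 2 ≤ (Y + 2 * y) ^ 2 := by nlinarith [mul_nonneg hY0 hy0]
            have := mul_le_mul_of_nonneg_left this (show 0 ≤ L ^ 4 * 784 by positivity)
            linarith
        _ = _ := by ring
    have h3 := Real.sqrt_le_sqrt hq
    rw [Real.sqrt_mul (sq_nonneg _), Real.sqrt_sq (by positivity), Real.sqrt_sq (by positivity)] at h3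
    linarith

/-- `C L^k` times this is the regret bound. -/
def rate (d H T : ℝ) : ℝ := d ^ 2 * H ^ 3 + √(d * H ^ 4 + d ^ 2 * H ^ 3) * √T
  + (d ^ 7 * H ^ 8 + d ^ 4 * H ^ 9) ^ (1 / 4 : ℝ) * T ^ (1 / 4 : ℝ)

theorem rpow_quarter_pow {x : ℝ} (hx : 0 ≤ x) : (x ^ (1 / 4 : ℝ)) ^ 4 = x := by
  rw [← Real.rpow_natCast, ← Real.rpow_mul hx]
  norm_num

/-- For a large effective dimension and a larger number of episodes, the `√T` term dominates. -/
theorem rate_le {d H T : ℝ} (hH : 1 ≤ H) (hd : H ≤ d) (hT : d ^ 3 * H ^ 2 + d ^ 2 * H ^ 3 ≤ T) :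
    rate d H T ≤ 4 * (d * H ^ (3 / 2 : ℝ) * √T) := by
  have hH0 : 0 < H := by linarith
  have hd0 : 0 < d := by linarith
  have hT0 : 0 < T := lt_of_lt_of_le (by positivity) hT
  set Z := d * H ^ (3 / 2 : ℝ) * √T with hZ
  have hZ0 : 0 ≤ Z := by positivity
  have hZ2 : Z ^ 2 = d ^ 2 * H ^ 3 * T := by
    rw [hZ, mul_pow, mul_pow, Real.sq_sqrt hT0.le, ← Real.rpow_natCast (H ^ _), ← Real.rpow_mul hH0.le]
    norm_num
  have c1 : d ^ 2 * H ^ 3 ≤ Z := by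
    refine le_of_sq_le_sq ?_ hZ0
    rw [hZ2, sq (d ^ 2 * H ^ 3)]
    refine mul_le_mul_of_nonneg_left ?_ (by positivity)
    linarith [show 0 ≤ d ^ 3 * H ^ 2 by positivity]
  have c2 : √(d * H ^ 4 + d ^ 2 * H ^ 3) * √T ≤ 2 * Z := by
    refine le_of_sq_le_sq ?_ (by positivity)
    rw [mul_pow, Real.sq_sqrt (by positivity), Real.sq_sqrt hT0.le, mul_pow, hZ2]
    have : d * H ^ 4 ≤ d ^ 2 * H ^ 3 := by
      have := mul_le_mul_of_nonneg_left hd (show 0 ≤ d * H ^ 3 by positivity)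
      linarith
    have h2 := mul_le_mul_of_nonneg_right this hT0.le
    have : 0 ≤ d ^ 2 * H ^ 3 * T := by positivity
    linarith
  have c3 : (d ^ 7 * H ^ 8 + d ^ 4 * H ^ 9) ^ (1 / 4 : ℝ) * T ^ (1 / 4 : ℝ) ≤ Z := by
    refine le_of_pow_le_pow_left₀ (n := 4) (by norm_num) hZ0 ?_
    rw [mul_pow, rpow_quarter_pow (by positivity), rpow_quarter_pow hT0.le,
      show Z ^ 4 = (Z ^ 2) ^ 2 by ring, hZ2]
    have h1 : d ^ 3 * H ^ 2 + H ^ 3 ≤ T := by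
      have : H ^ 3 ≤ d ^ 2 * H ^ 3 :=
        le_mul_of_one_le_left (by positivity) (one_le_pow₀ (by linarith))
      linarith
    have h2 := mul_le_mul_of_nonneg_left h1 (show 0 ≤ d ^ 4 * H ^ 6 * T by positivity)
    linarith
  rw [rate]
  linarith

section Final

variable {S A F : Type*} [NormedAddCommGroup F] [InnerProductSpace ℝ F] {H T : ℕ}
  {G : Game S A F H} {P : Params} {fc : CCEFinder S A} {D : Obs S A} {B d : ℝ} {L : ℕ → ℝ}

/-- The regret bound holds for every sequence of observations in the good event. -/
theorem regret_le_rate [Finite A] (hT : 1 ≤ T) (hH : 1 ≤ H) (hP : P.Good H T B d L)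
    (hd : d = G.effDim T (1 / B ^ 2)) (hE : GoodEvent G P fc D T d L)
    (hB : ∀ h ∈ Finset.Icc 1 H, ‖G.theta h‖ ≤ B) :
    regret G P fc D T ≤ 40000 * L T ^ 2 * rate d H T := by
  have hd3 := hP.d_ge
  have hd0 : 0 < d := by linarith
  have hL := hP.L_ge T hT
  set Y := √(d * (H : ℝ) ^ 4 + d ^ 2 * (H : ℝ) ^ 3) * √T with hYdef
  set y := (d ^ 7 * (H : ℝ) ^ 8 + d ^ 4 * (H : ℝ) ^ 9) ^ (1 / 4 : ℝ) * (T : ℝ) ^ (1 / 4 : ℝ) with hydef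
  have hY0 : 0 ≤ Y := by positivity
  have hy0 : 0 ≤ y := by positivity
  have hY : Y ^ 2 = (d * (H : ℝ) ^ 4 + d ^ 2 * (H : ℝ) ^ 3) * T := by
    rw [hYdef, mul_pow, Real.sq_sqrt (by positivity), Real.sq_sqrt (by positivity)]
  have hy : y ^ 4 = (d ^ 7 * (H : ℝ) ^ 8 + d ^ 4 * (H : ℝ) ^ 9) * T := by
    rw [hydef, mul_pow, rpow_quarter_pow (by positivity), rpow_quarter_pow (by positivity)]
  rw [rate, ← hYdef, ← hydef]
  clear_value Y y
  -- with the roots of `d`, `H` and `T` as variables, all terms become monomials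
  obtain ⟨e, he0, he2⟩ : ∃ e : ℝ, 0 < e ∧ d = e ^ 2 :=
    ⟨√d, Real.sqrt_pos.2 hd0, (Real.sq_sqrt hd0.le).symm⟩
  obtain ⟨g, hg1, hg2⟩ : ∃ g : ℝ, 1 ≤ g ∧ (H : ℝ) = g ^ 2 :=
    ⟨√H, Real.one_le_sqrt.2 (by exact_mod_cast hH), (Real.sq_sqrt (Nat.cast_nonneg H)).symm⟩
  obtain ⟨s, hs0, hs2⟩ : ∃ s : ℝ, 0 ≤ s ∧ (T : ℝ) = s ^ 2 :=
    ⟨√T, Real.sqrt_nonneg _, (Real.sq_sqrt (Nat.cast_nonneg T)).symm⟩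
  have hg0 : 0 < g := by linarith
  have he1 : 1 ≤ 2 * e := by
    by_contra! h
    nlinarith
  have hreg := regret_le_sumBonus hH hP hE hB
  obtain ⟨hb, hb₁, hb₂⟩ := hP.beta_le hT
  rw [he2, Real.sqrt_sq he0.le] at hb hb₂
  rw [he2] at hb₁
  rw [hg2] at hb₂
  have hmart : √(6 * (T * H) * L T) ≤ 3 * (s * g * L T) := by
    refine Real.sqrt_le_iff.2 ⟨by positivity, ?_⟩
    rw [hs2, hg2]
    have h1 : L T ≤ L T * L T := le_mul_of_one_le_right (by linarith) hL
    have h2 := mul_le_mul_of_nonneg_left h1 (show 0 ≤ s ^ 2 * g ^ 2 by positivity)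
    have h3 : 0 ≤ s ^ 2 * g ^ 2 * L T := by positivity
    linarith
  have hroot : √(4 * (d * H)) = 2 * e * g := by
    rw [he2, hg2, ← Real.sqrt_sq (show 0 ≤ 2 * e * g by positivity)]
    congr 1
    ring
  have hsum : ∀ b, sumBonus T G P fc D b
      ≤ 20000 * L T ^ 2 * (e ^ 4 * g ^ 6) + 2800 * L T ^ 2 * (Y + 2 * y) := by
    intro b
    have hR0 : 0 ≤ sumSqR T G P fc D b :=
      Finset.sum_nonneg fun _ _ => Finset.sum_nonneg fun _ _ => sq_nonneg _
    have h1 := sumBonus_le (fc := fc) (D := D) hT hH hP hd b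
    have h2 := sum_margin_le (fc := fc) (D := D) hT hH hP hd b
    have h3 := sumSqR_le hH hP hE hB b
    have h4 := sum_nextVar_le hH hP hE hB b
    have m1 : P.beta₂ T * (√(T * H) * √(4 * (d * H))) ≤ 136 * (e ^ 3 * L T * g ^ 6 * s) := by
      have r1 : √((T : ℝ) * H) = s * g := by
        rw [hs2, hg2, ← mul_pow, Real.sqrt_sq (by positivity)]
      rw [r1, hroot]
      have r2 : 0 ≤ e ^ 2 * L T * g ^ 6 * s := by positivity
      calc P.beta₂ T * (s * g * (2 * e * g))
          ≤ 34 * ((g ^ 2) ^ 2 * (e * L T)) * (s * g * (2 * e * g)) :=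
            mul_le_mul_of_nonneg_right hb₂ (by positivity)
        _ = 68 * (e ^ 2 * L T * g ^ 6 * s) := by ring
        _ ≤ 68 * (e ^ 2 * L T * g ^ 6 * s * (2 * e)) := by
            linarith [le_mul_of_one_le_right r2 he1]
        _ = _ := by ring
    have m2 : 2 * H * P.beta₁ T * (√(3 * (H : ℝ) ^ 3 * T) * √(4 * (d * H)))
        ≤ 240 * (e ^ 3 * L T * g ^ 6 * s) := by
      have r1 : √(3 * (H : ℝ) ^ 3 * T) ≤ 7 / 4 * (g ^ 3 * s) := by
        refine Real.sqrt_le_iff.2 ⟨by positivity, ?_⟩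
        rw [hs2, hg2]
        have : 0 ≤ g ^ 6 * s ^ 2 := by positivity
        linarith
      rw [hroot, hg2]
      rw [hg2] at r1
      have r2 : 0 ≤ e ^ 3 * L T * g ^ 6 * s := by positivity
      calc 2 * g ^ 2 * P.beta₁ T * (√(3 * (g ^ 2) ^ 3 * T) * (2 * e * g))
          ≤ 2 * g ^ 2 * (34 * (e ^ 2 * L T)) * (7 / 4 * (g ^ 3 * s) * (2 * e * g)) := by gcongr
        _ = 238 * (e ^ 3 * L T * g ^ 6 * s) := by ring
        _ ≤ _ := by linarith
    refine sumBonus_le_of_recursion (R := sumSqR T G P fc D b) hL he0 hg1 hs0 hY0 hy0 ?_ ?_ hR0 ?_ ?_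
    · rw [hY, he2, hg2, hs2]; ring
    · rw [hy, he2, hg2, hs2]; ring
    · rw [hroot] at h1
      refine h1.trans ?_
      calc 2 * P.beta T * (√(sumSqR T G P fc D b) * (2 * e * g))
          ≤ 2 * (25 * (e * L T)) * (√(sumSqR T G P fc D b) * (2 * e * g)) := by gcongr
        _ = _ := by ring
    · have v1 : 4 * (H : ℝ) ^ 2 * √(6 * (T * H) * L T) ≤ 12 * g ^ 5 * s * L T := by
        calc _ ≤ 4 * (H : ℝ) ^ 2 * (3 * (s * g * L T)) := by gcongr
          _ = _ := by rw [hg2]; ring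
      have v2 : 2 * (H : ℝ) ^ 2 * T = 2 * g ^ 4 * s ^ 2 := by rw [hg2, hs2]; ring
      have v3 : (H : ℝ) ^ 3 * T / d = g ^ 6 * s ^ 2 / e ^ 2 := by rw [hg2, hs2, he2]; ring
      have v4 : 2 * (H : ℝ) * sumBonus T G P fc D b = 2 * g ^ 2 * sumBonus T G P fc D b := by
        rw [hg2]
      linarith
  have hlast : 8 * H * √(6 * (T * H) * L T) ≤ 48 * (L T ^ 2 * Y) := by
    have k1 : e * g ^ 4 * s ≤ Y := by
      refine le_of_sq_le_sq ?_ hY0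
      rw [hY, he2, hg2, hs2]
      have : 0 ≤ e ^ 4 * g ^ 6 * s ^ 2 := by positivity
      linarith
    have l1 : L T ≤ L T ^ 2 := le_self_pow₀ hL two_ne_zero
    have l2 : g ^ 3 ≤ g ^ 4 := pow_le_pow_right₀ hg1 (by norm_num)
    calc 8 * H * √(6 * (T * H) * L T) ≤ 8 * H * (3 * (s * g * L T)) := by gcongr
      _ = 24 * (L T * (1 * g ^ 3 * s)) := by rw [hg2]; ring
      _ ≤ 24 * (L T ^ 2 * (2 * e * g ^ 4 * s)) := by gcongr
      _ = 48 * (L T ^ 2 * (e * g ^ 4 * s)) := by ring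
      _ ≤ _ := by gcongr
  have e1 : d ^ 2 * (H : ℝ) ^ 3 = e ^ 4 * g ^ 6 := by rw [he2, hg2]; ring
  rw [e1]
  have t1 := hsum true
  have t2 := hsum false
  have : 0 ≤ L T ^ 2 * Y := by positivity
  have : 0 ≤ L T ^ 2 * y := by positivity
  linarith

end Final

end KernelMG

end

open KernelMG in
theorem mainTheorem2 :
    ∃ C : ℝ, 0 < C ∧ ∃ k : ℕ,
      ∀ (S : Type*) (A : Type*) (F : Type*) (Ω : Type*)
        [Countable S] [MeasurableSpace S] [DiscreteMeasurableSpace S]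
        [Finite A] [MeasurableSpace A] [DiscreteMeasurableSpace A]
        [NormedAddCommGroup F] [InnerProductSpace ℝ F] [CompleteSpace F]
        [MeasurableSpace Ω] (μ : MeasureTheory.Measure Ω) [MeasureTheory.IsProbabilityMeasure μ]
        (H T : ℕ) (B δ : ℝ) (G : Game S A F H) (fc : CCEFinder S A)
        (X : ℕ → ℕ → Ω → S) (Y : ℕ → ℕ → Ω → A × A),
        1 ≤ H → 1 ≤ T → 0 < δ → δ < 1 →
        (∀ h ∈ Finset.Icc 1 H, ‖G.theta h‖ ≤ B) →
        IsRun μ G (tuned G B T δ) fc T X Y →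
        let d : ℝ := G.effDim T (1 / B ^ 2)
        let L : ℝ := Real.log (4 * (T : ℝ) ^ 2 * H / δ)
        ENNReal.ofReal (1 - δ) ≤ μ {ω |
          regret G (tuned G B T δ) fc (obs X Y ω) T
            ≤ C * L ^ k * (d ^ 2 * (H : ℝ) ^ 3
              + √(d * (H : ℝ) ^ 4 + d ^ 2 * (H : ℝ) ^ 3) * √T
              + (d ^ 7 * (H : ℝ) ^ 8 + d ^ 4 * (H : ℝ) ^ 9) ^ (1 / 4 : ℝ) * (T : ℝ) ^ (1 / 4 : ℝ))
          ∧ ((H : ℝ) ≤ d → d ^ 3 * (H : ℝ) ^ 2 + d ^ 2 * (H : ℝ) ^ 3 ≤ T →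
            regret G (tuned G B T δ) fc (obs X Y ω) T
              ≤ C * L ^ k * (d * (H : ℝ) ^ (3 / 2 : ℝ) * √T))} := by
  refine ⟨160000, by norm_num, 2, ?_⟩
  intro S A F Ω _ _ _ _ _ _ _ _ _ _ μ _ H T B δ G fc X Y hH hT hδ hδ1 hB hrun d L
  -- any outcome provides a state-action triplet, so that `B ≥ 1` and `d ≥ 1/3`
  obtain ⟨ω₀⟩ : Nonempty Ω := nonempty_of_isProbabilityMeasure μ
  have z : S × A × A := (X 1 1 ω₀, Y 1 1 ω₀)
  have h1 : 1 ∈ Finset.Icc 1 H := Finset.mem_Icc.2 ⟨le_rfl, hH⟩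
  have hB1 : 1 ≤ B := G.one_le_bound h1 z (hB 1 h1)
  have hP := tuned_good (T := T) G hH hB1 hδ hδ1 (G.one_third_le_effDim hH hT z (hB 1 h1))
  refine Likely.le_measure (Likely.mono (hrun.likely_goodEvent hT hH hδ hδ1 rfl hP) le_rfl
    fun ω hE => ?_) hδ.le
  have hreg : regret G (tuned G B T δ) fc (obs X Y ω) T ≤ 40000 * L ^ 2 * rate d H T :=
    regret_le_rate hT hH hP rfl hE hB
  have hd : 0 ≤ d := le_trans (by norm_num) hP.d_ge
  have hrate : 0 ≤ rate d H T := by rw [rate]; positivity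
  refine ⟨hreg.trans ?_, fun hdH hdT => hreg.trans ?_⟩
  · change _ ≤ 160000 * L ^ 2 * rate d H T
    gcongr
    norm_num
  · have h2 := mul_le_mul_of_nonneg_left (rate_le (by exact_mod_cast hH) hdH hdT)
      (show 0 ≤ 40000 * L ^ 2 by positivity)
    linarith
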